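/- Consider 1-dimensional control systems $\dot x=F(x,u,\dot u)$, regarded as sections $f=F(x,u,u_1)$ of the trivial line bundle $\kappa:\mathbb R^4\to\mathbb R^3$, $(x,u,u_1,f)\mapsto(x,u,u_1)$, and let $J^k\kappa$ be the space of $k$-jets of such sections, with coordinates $x,u,u_1$ and $f_\sigma$, $|\sigma|\le k$. A feedback vector field $a(x)\partial_x+b(x,u)\partial_u$ ($a,b$ smooth) acts on $\mathbb R^4$ by $$\widehat X_{a,b}=a\,\partial_x+b\,\partial_u+(u_1b_u+f\,b_x)\,\partial_{u_1}+a'f\,\partial_f ,$$ and on jets by the prolongations $\widehat X_{a,b}^{(k)}$. A feedback differential invariant of order $\le k$ on an open set $W\subset J^k\kappa$ is a function $I\in C^\infty(W)$ with $\widehat X^{(k)}_{a,b}(I)=0$ for all $a,b$. A feedback invariant derivation is a combination $A\frac{d}{dx}+B\frac{d}{du}+C\frac{d}{du_1}$ of total derivatives, with smooth coefficients of finite order, that commutes with all prolonged fields $\widehat X_{a,b}$. The orbit of a $k$-jet in $W$ is the set of all $k$-jets reached from it in finitely many steps along integral curves of fields $\widehat X_{a,b}^{(k)}$ that stay in $W$.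 For $k\ge 2$ a $k$-jet is called regular if $f$, $f_{u_1}$, $f_{u_1u_1}$ and $u_1f_{u_1}-f$ do not vanish at it. Put $$J=\frac{f^{2}f_{u_{1}u_{1}}}{(u_{1}f_{u_{1}}-f)\,f_{u_{1}}^{2}},$$ $$\nabla_1=\frac{u_1f_{u_1}-f}{f_{u_1}}\frac{d}{du}+\frac{f-u_1f_{u_1}}{f_{u_1}^2}f_u\frac{d}{du_1},\qquad \nabla_2=\frac{f}{f_{u_1}}\frac{d}{du_1},$$ $$\nabla_3=f\frac{d}{dx}+\frac{f}{f_{u_1}}\frac{d}{du}+\left(\frac{f_xf_{u_1}+f_u-u_1f_{uu_1}-f\,f_{xu_1}}{f_{u_1u_1}}+\frac{u_1f_{u_1}-f}{f_{u_1}^2}f_u\right)\frac{d}{du_1},$$ $$\begin{aligned}K={}&-u_1f_{xu}+2u_1\frac{f_u^2}{ff_{u_1}}-2\frac{f_u^2}{f_{u_1}^2}+\frac{f_{uu}u_1-2f_uf_x+ff_{xu}}{f_{u_1}}-u_1\frac{f_{uu}u_1-2f_uf_x}{f}\\&+\frac{c_1}{f_{u_1}f_{u_1u_1}^2}+\frac{c_2}{ff_{u_1u_1}^2}+\frac{c_3}{f_{u_1u_1}^2}+\frac{c_4}{ff_{u_1u_1}}+\frac{c_5}{f_{u_1}f_{u_1u_1}}+\frac{c_6}{f_{u_1u_1}},\end{aligned}$$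 where $$\begin{aligned} c_1={}&-ff_uf_{xu_1}f_{u_1u_1u_1}-u_1f_uf_{uu_1}f_{u_1u_1u_1}+f_u^2f_{u_1u_1u_1},\\ c_2={}&u_1\left(f_uf_{u_1}f_{uu_1u_1}-f_u^2f_{u_1u_1u_1}-f_xf_uf_{u_1}f_{u_1u_1u_1}+f_xf_{u_1}^2f_{uu_1u_1}\right)+u_1^2f_{uu_1}\left(-f_{u_1}f_{uu_1u_1}+f_uf_{u_1u_1u_1}\right),\\ c_3={}&ff_{xu_1}f_{uu_1u_1}+f_xf_uf_{u_1u_1u_1}-f_uf_{uu_1u_1}-f_xf_{u_1}f_{uu_1u_1}+u_1\left(f_uf_{xu_1}f_{u_1u_1u_1}-f_{u_1}f_{xu_1}f_{uu_1u_1}+f_{uu_1}f_{uu_1u_1}\right),\\ c_4={}&-u_1\left(2f_{u_1}f_xf_{uu_1}-f_{u_1}f_uf_{xu_1}+f_uf_{uu_1}+f_{u_1}f_{uu}+f_{u_1}^2f_{xu}\right)+u_1^2\left(f_{u_1}f_{uuu_1}-f_uf_{uu_1u_1}+f_{uu_1}^2\right),\\ c_5={}&ff_uf_{xu_1u_1}-ff_{xu_1}f_{uu_1}+f_uf_{uu_1}+u_1\left(f_uf_{uu_1u_1}-f_{uu_1}^2\right),\\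 c_6={}&f_{uu}-f_uf_{xu_1}+2f_xf_{uu_1}+f_{u_1}f_{xu}-ff_{xuu_1}+u_1\left(f_{u_1}f_{xuu_1}-f_{uuu_1}+f_{xu_1}f_{uu_1}-f_uf_{xu_1u_1}\right). \end{aligned}$$ **Theorem.** On regular jets, $\nabla_1,\nabla_2,\nabla_3$ are feedback invariant derivations, and $J$ (order $2$), $K$ (order $3$) and all their iterated derivatives $\nabla_{i_1}\cdots\nabla_{i_m}J$ (order $\le m+2$), $\nabla_{i_1}\cdots\nabla_{i_m}K$ (order $\le m+3$) are feedback differential invariants. They generate the algebra of feedback differential invariants in a neighbourhood of a regular orbit: if $k\ge2$, $W\subset J^k\kappa$ is an open set of regular $k$-jets, $I$ is a feedback differential invariant of order $\le k$ on $W$, and $\mathcal O$ is the orbit in $W$ of some point of $W$, then on some open set $V$ with $\mathcal O\subset V\subset W$ the function $I$ is a $C^\infty$ function of finitely many of the invariants $\nabla_{i_1}\cdots\nabla_{i_m}J$, $\nabla_{i_1}\cdots\nabla_{i_m}K$, $m\ge0$. -/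

import Mathlib

open scoped ContDiff

noncomputable section

namespace Feedback

/-! Jets of functions `f = f(x, u, u₁)` of three variables, with base coordinates indexed by
`Fin 3`: `0` is `x`, `1` is `u`, `2` is `u₁`. A multi-index `σ : Fin 3 → ℕ` stands for the
partial derivative `∂^{|σ|} f / ∂x^{σ 0} ∂u^{σ 1} ∂u₁^{σ 2}`. -/

/-- Multi-indices. -/
abbrev MIdx : Type := Fin 3 → ℕ

/-- The multi-indices of length at most `k`. -/
def multiIdx (k : ℕ) : Finset MIdx :=
  (Finset.Iic (fun _ : Fin 3 => k)).filter (fun σ => ∑ i, σ i ≤ k)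

theorem mem_multiIdx {k : ℕ} {σ : MIdx} : σ ∈ multiIdx k ↔ ∑ i, σ i ≤ k := by
  simp only [multiIdx, Finset.mem_filter, Finset.mem_Iic, and_iff_right_iff_imp]
  intro h i
  exact (Finset.single_le_sum (f := σ) (fun _ _ => Nat.zero_le _) (Finset.mem_univ i)).trans h

/-- The space of infinite jets: base point and all the jet coordinates `f_σ`. -/
abbrev JetInf : Type := (Fin 3 → ℝ) × (MIdx → ℝ)

/-- The space of `k`-jets: base point and the jet coordinates `f_σ` with `|σ| ≤ k`. -/
abbrev JetK (k : ℕ) : Type := (Fin 3 → ℝ) × (multiIdx k → ℝ)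

/-- The projection of infinite jets to `k`-jets. -/
def proj (k : ℕ) (θ : JetInf) : JetK k := (θ.1, fun σ => θ.2 σ)

/-- The infinite jet that has a given `k`-jet and whose coordinates of order `> k` are zero. -/
def ext (k : ℕ) (p : JetK k) : JetInf :=
  (p.1, fun σ => if h : σ ∈ multiIdx k then p.2 ⟨σ, h⟩ else 0)

/-- The coordinate `u₁`. -/
def u₁ (θ : JetInf) : ℝ := θ.1 2

/-- The jet coordinate `∂^{i+j+l} f / ∂x^i ∂u^j ∂u₁^l`. -/
def fd (i j l : ℕ) (θ : JetInf) : ℝ := θ.2 ![i, j, l]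

/-- Regular infinite jets: `f`, `f_{u₁}`, `f_{u₁u₁}` and `u₁ f_{u₁} - f` do not vanish. -/
def Regular (θ : JetInf) : Prop :=
  fd 0 0 0 θ ≠ 0 ∧ fd 0 0 1 θ ≠ 0 ∧ fd 0 0 2 θ ≠ 0 ∧ u₁ θ * fd 0 0 1 θ - fd 0 0 0 θ ≠ 0

/-- The regular `k`-jets (used for `k ≥ 2` only). -/
def regularSet (k : ℕ) : Set (JetK k) := {p | Regular (ext k p)}

/-! ### Total derivatives -/

/-- The total derivative as a vector field on the space of infinite jets,
`∂/∂x_i + ∑_σ f_{σ + 1_i} ∂/∂f_σ`. -/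
def totalVec (i : Fin 3) (θ : JetInf) : JetInf :=
  (Pi.single i 1, fun σ => θ.2 (σ + Pi.single i 1))

/-- The total derivative of a function on the space of infinite jets. -/
def totalD (i : Fin 3) (F : JetInf → ℝ) : JetInf → ℝ :=
  fun θ => lineDeriv ℝ F θ (totalVec i θ)

/-- The iterated total derivative along a multi-index. -/
def totalDs (σ : MIdx) (F : JetInf → ℝ) : JetInf → ℝ :=
  (totalD 0)^[σ 0] ((totalD 1)^[σ 1] ((totalD 2)^[σ 2] F))

/-! ### Feedback vector fields and their prolongations

A feedback vector field `a(x) ∂_x + b(x,u) ∂_u` acts on `(x, u, u₁, f)` by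
`a ∂_x + b ∂_u + (u₁ b_u + f b_x) ∂_{u₁} + a' f ∂_f`. -/

/-- The components of this vector field along the base coordinates `x, u, u₁`. -/
def xi (a : ℝ → ℝ) (b : ℝ × ℝ → ℝ) (θ : JetInf) : Fin 3 → ℝ :=
  ![a (θ.1 0), b (θ.1 0, θ.1 1),
    u₁ θ * fderiv ℝ b (θ.1 0, θ.1 1) (0, 1) + fd 0 0 0 θ * fderiv ℝ b (θ.1 0, θ.1 1) (1, 0)]

/-- The generating function `a' f - a f_x - b f_u - (u₁ b_u + f b_x) f_{u₁}`. -/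
def genFun (a : ℝ → ℝ) (b : ℝ × ℝ → ℝ) (θ : JetInf) : ℝ :=
  deriv a (θ.1 0) * fd 0 0 0 θ
    - (xi a b θ 0 * fd 1 0 0 θ + xi a b θ 1 * fd 0 1 0 θ + xi a b θ 2 * fd 0 0 1 θ)

/-- The prolongation to infinite jets: with `φ` the generating function, it is
`∑_σ D^σ φ ∂/∂f_σ + ∑_i ξ_i D_i`, where the `D_i` are the total derivatives. -/
def prol (a : ℝ → ℝ) (b : ℝ × ℝ → ℝ) (θ : JetInf) : JetInf :=
  ((0 : Fin 3 → ℝ), fun σ => totalDs σ (genFun a b) θ) + ∑ i, xi a b θ i • totalVec i θ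

/-- The prolongation to `k`-jets. Its value does not depend on the extension of the `k`-jet to an
infinite jet. -/
def prolK (k : ℕ) (a : ℝ → ℝ) (b : ℝ × ℝ → ℝ) (p : JetK k) : JetK k :=
  proj k (prol a b (ext k p))

/-- The action of the prolonged feedback vector field on functions on infinite jets. -/
def prolD (a : ℝ → ℝ) (b : ℝ × ℝ → ℝ) (F : JetInf → ℝ) : JetInf → ℝ :=
  fun θ => lineDeriv ℝ F θ (prol a b θ)

/-! ### Invariants, orbits, invariant derivations -/

/-- `I`, a function on `k`-jets, is a (smooth) feedback differential invariant of order `≤ k` on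
the set `W` of `k`-jets. -/
def IsInvariantOn (k : ℕ) (W : Set (JetK k)) (I : JetK k → ℝ) : Prop :=
  ContDiffOn ℝ ∞ I W ∧
    ∀ (a : ℝ → ℝ) (b : ℝ × ℝ → ℝ), ContDiff ℝ ∞ a → ContDiff ℝ ∞ b →
      ∀ θ : JetInf, proj k θ ∈ W → prolD a b (fun θ' => I (proj k θ')) θ = 0

/-- `F`, a function on infinite jets, is on regular jets a feedback differential invariant of
order `≤ k`. -/
def IsInvariant (k : ℕ) (F : JetInf → ℝ) : Prop :=
  ∃ I : JetK k → ℝ, IsInvariantOn k (regularSet k) I ∧ ∀ θ, Regular θ → F θ = I (proj k θ)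

/-- The `k`-jet `q` is reached from `p` along an integral curve of a prolonged feedback vector
field that stays in `W`. -/
def Step (k : ℕ) (W : Set (JetK k)) (p q : JetK k) : Prop :=
  ∃ (a : ℝ → ℝ) (b : ℝ × ℝ → ℝ) (γ : ℝ → JetK k), ContDiff ℝ ∞ a ∧ ContDiff ℝ ∞ b ∧
    γ 0 = p ∧ γ 1 = q ∧
    ∀ t ∈ Set.Icc (0 : ℝ) 1, γ t ∈ W ∧ HasDerivAt γ (prolK k a b (γ t)) t

/-- The feedback orbit of `p` in the set `W` of `k`-jets. For `W = regularSet k` this is the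
orbit of the regular point `p`. -/
def orbitIn (k : ℕ) (W : Set (JetK k)) (p : JetK k) : Set (JetK k) :=
  {q | Relation.ReflTransGen (Step k W) p q}

/-- The derivation `∑_j A_j D_j`, where the `D_j` are the total derivatives. -/
def derivation (A : Fin 3 → JetInf → ℝ) (F : JetInf → ℝ) : JetInf → ℝ :=
  fun θ => ∑ j, A j θ * totalD j F θ

/-- The derivation `∑_j A_j D_j` is feedback invariant on regular jets: its coefficients are
smooth functions of finite order there, and it commutes with all prolonged feedback vector fields
on (local) smooth functions of finite order. -/
def IsInvariantDerivation (A : Fin 3 → JetInf → ℝ) : Prop :=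
  (∀ j, ∃ k, 2 ≤ k ∧ ∃ g : JetK k → ℝ, ContDiffOn ℝ ∞ g (regularSet k) ∧
    ∀ θ, Regular θ → A j θ = g (proj k θ)) ∧
  ∀ (a : ℝ → ℝ) (b : ℝ × ℝ → ℝ), ContDiff ℝ ∞ a → ContDiff ℝ ∞ b →
    ∀ (k : ℕ) (W : Set (JetK k)) (g : JetK k → ℝ), IsOpen W → ContDiffOn ℝ ∞ g W →
      ∀ θ : JetInf, Regular θ → proj k θ ∈ W →
        prolD a b (derivation A (fun θ' => g (proj k θ'))) θ =
          derivation A (prolD a b (fun θ' => g (proj k θ'))) θ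

/-! ### The basic invariants and invariant derivations -/

/-- The coefficients of the three derivations `∇₁, ∇₂, ∇₃` (indices `0, 1, 2`) along
`d/dx, d/du, d/du₁`. -/
def nablaCoeff (i j : Fin 3) (θ : JetInf) : ℝ :=
  let z := u₁ θ
  let f := fd 0 0 0 θ
  let fx := fd 1 0 0 θ
  let fu := fd 0 1 0 θ
  let fz := fd 0 0 1 θ
  let fxz := fd 1 0 1 θ
  let fuz := fd 0 1 1 θ
  let fzz := fd 0 0 2 θ
  (![![0, (z * fz - f) / fz, (f - z * fz) / fz ^ 2 * fu],
     ![0, 0, f / fz],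
     ![f, f / fz,
       (fx * fz + fu - z * fuz - f * fxz) / fzz + (z * fz - f) / fz ^ 2 * fu]] :
    Fin 3 → Fin 3 → ℝ) i j

/-- The derivations `∇₁, ∇₂, ∇₃` (indices `0, 1, 2`). -/
def nabla (i : Fin 3) : (JetInf → ℝ) → JetInf → ℝ := derivation (nablaCoeff i)

/-- The iterated derivative `∇_{i₁} ∇_{i₂} ⋯ ∇_{i_m} F` along the word `i₁ i₂ … i_m`. -/
def nablaWord : List (Fin 3) → (JetInf → ℝ) → JetInf → ℝ
  | [], F => F
  | i :: w, F => nabla i (nablaWord w F)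

/-- The second order invariant `J`. -/
def J (θ : JetInf) : ℝ :=
  fd 0 0 0 θ ^ 2 * fd 0 0 2 θ / ((u₁ θ * fd 0 0 1 θ - fd 0 0 0 θ) * fd 0 0 1 θ ^ 2)

/-- The third order invariant `K`. -/
def K (θ : JetInf) : ℝ :=
  let z := u₁ θ
  let f := fd 0 0 0 θ
  let fx := fd 1 0 0 θ
  let fu := fd 0 1 0 θ
  let fz := fd 0 0 1 θ
  let fxu := fd 1 1 0 θ
  let fuu := fd 0 2 0 θ
  let fxz := fd 1 0 1 θ
  let fuz := fd 0 1 1 θ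
  let fzz := fd 0 0 2 θ
  let fxuz := fd 1 1 1 θ
  let fuuz := fd 0 2 1 θ
  let fxzz := fd 1 0 2 θ
  let fuzz := fd 0 1 2 θ
  let fzzz := fd 0 0 3 θ
  let c₁ := -f * fu * fxz * fzzz - z * fu * fuz * fzzz + fu ^ 2 * fzzz
  let c₂ := z * (fu * fz * fuzz - fu ^ 2 * fzzz - fx * fu * fz * fzzz + fx * fz ^ 2 * fuzz)
    + z ^ 2 * fuz * (-fz * fuzz + fu * fzzz)
  let c₃ := f * fxz * fuzz + fx * fu * fzzz - fu * fuzz - fx * fz * fuzz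
    + z * (fu * fxz * fzzz - fz * fxz * fuzz + fuz * fuzz)
  let c₄ := -z * (2 * fz * fx * fuz - fz * fu * fxz + fu * fuz + fz * fuu + fz ^ 2 * fxu)
    + z ^ 2 * (fz * fuuz - fu * fuzz + fuz ^ 2)
  let c₅ := f * fu * fxzz - f * fxz * fuz + fu * fuz + z * (fu * fuzz - fuz ^ 2)
  let c₆ := fuu - fu * fxz + 2 * fx * fuz + fz * fxu - f * fxuz
    + z * (fz * fxuz - fuuz + fxz * fuz - fu * fxzz);
  -z * fxu + 2 * z * (fu ^ 2 / (f * fz)) - 2 * (fu ^ 2 / fz ^ 2)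
    + (fuu * z - 2 * fu * fx + f * fxu) / fz - z * ((fuu * z - 2 * fu * fx) / f)
    + c₁ / (fz * fzz ^ 2) + c₂ / (f * fzz ^ 2) + c₃ / fzz ^ 2
    + c₄ / (f * fzz) + c₅ / (fz * fzz) + c₆ / fzz

end Feedback

end

/-! Invariance. The prolonged field X of (a, b) satisfies [X, D_i] = -Σ_j D_i(ξ_j) D_j, where D_0,
D_1, D_2 are the total derivatives and ξ_j the base components of X. This yields the recursion for
the coefficients of X on jets (`prol_add_single`) and shows that Σ A_j D_j commutes with X once
X(A_j) = Σ_i A_i D_i(ξ_j). This criterion for the three ∇'s, and X(J) = X(K) = 0, are finite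
computations with the coefficients of X up to order three. An invariant derivation maps invariants
to invariants, which settles all iterated derivatives.

Generation, infinitesimally. At a regular jet the common kernel of the differentials of the listed
invariants of order ≤ k consists exactly of the values of the prolonged fields
(`exists_prol_of_annihilates`). The proof is by induction on the order. After subtraction of a field
that already fits, the vector x is vertical and purely of top order m. On such vectors ∇'s act by
contraction v ↦ v(· + 1_j), and the ∇'s are linearly independent, so every contraction of x down to
order 2 kills dJ and every contraction down to order 3 kills dK. The symbol of J is a nonzero
multiple of ∂/∂f_{u₁u₁}, so x_σ = 0 when σ 2 ≥ 2. Modulo this, the symbol of K gives u₁ x_{i,j+2,1}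
+ f x_{i+1,j+1,1} = 0, which leaves at most two free components with σ 2 = 1. Fields with a and b
homogeneous of degree m about the base point adjust these, and fields with b homogeneous of degree m
+ 1 realise all components with σ 2 = 0.

Generation, locally. Let F collect the listed invariants of order ≤ k. The kernel of dF is
everywhere filled by the fields, so its dimension is locally constant: independent vectors of the
family stay independent, and the rank of dF cannot drop nearby. Hence suitable components of F form
a submersion whose fibres have the fields as tangent vectors, and an invariant I is locally Φ ∘ F
(`exists_submersion_factor`).

Generation, along an orbit. One Φ, found at the starting point, serves the whole orbit. The
difference I - Φ ∘ F is again a first integral, and F is constant on integral curves; the times near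
which the difference vanishes form an open and closed set (`eventually_eq_zero_of_curve`). -/

noncomputable section

namespace Feedback

open Filter Topology

/-! ### Smooth functions of finite order -/

/-- The projection to `k`-jets as a continuous linear map. -/
def projL (k : ℕ) : JetInf →L[ℝ] JetK k where
  toFun := proj k
  map_add' _ _ := rfl
  map_smul' _ _ := rfl
  cont := by unfold proj; fun_prop

theorem proj_add (k : ℕ) (θ v : JetInf) : proj k (θ + v) = proj k θ + proj k v := rfl

theorem proj_smul (k : ℕ) (t : ℝ) (v : JetInf) : proj k (t • v) = t • proj k v := rfl

theorem continuous_proj (k : ℕ) : Continuous (proj k) := (projL k).continuous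

@[simp] theorem proj_ext (k : ℕ) (p : JetK k) : proj k (ext k p) = p := by
  refine Prod.ext rfl ?_
  funext σ
  simp [proj, ext]

/-- The projection from `l`-jets to `k`-jets (meaningful for `k ≤ l`) as a linear map. -/
def resL (l k : ℕ) : JetK l →L[ℝ] JetK k where
  toFun p := proj k (ext l p)
  map_add' p q := by
    refine Prod.ext rfl ?_
    funext σ
    simp only [proj, ext, Prod.fst_add, Prod.snd_add, Pi.add_apply]
    split_ifs <;> simp
  map_smul' t p := by
    refine Prod.ext rfl ?_
    funext σ
    simp only [proj, ext, Prod.smul_fst, Prod.smul_snd, Pi.smul_apply, smul_eq_mul,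
      RingHom.id_apply]
    split_ifs <;> simp
  cont := by
    refine Continuous.prodMk continuous_fst (continuous_pi fun σ => ?_)
    by_cases h : (σ : MIdx) ∈ multiIdx l
    · simp only [ext, h, dif_pos]; fun_prop
    · simp only [ext, h, dif_neg, not_false_iff]; fun_prop

theorem multiIdx_mono {k l : ℕ} (h : k ≤ l) {σ : MIdx} (hσ : σ ∈ multiIdx k) :
    σ ∈ multiIdx l := mem_multiIdx.2 ((mem_multiIdx.1 hσ).trans h)

theorem resL_proj {k l : ℕ} (h : k ≤ l) (θ : JetInf) : resL l k (proj l θ) = proj k θ := by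
  refine Prod.ext rfl ?_
  funext σ
  simp [resL, proj, ext, multiIdx_mono h σ.2]

/-- `F` is on `U` a smooth function of order `≤ k`. -/
def SmoothOn (k : ℕ) (U : Set JetInf) (F : JetInf → ℝ) : Prop :=
  ∃ g : JetK k → ℝ, ∀ θ ∈ U, ContDiffAt ℝ ∞ g (proj k θ) ∧ F θ = g (proj k θ)

section SmoothOn

variable {k l : ℕ} {U U' : Set JetInf} {F G : JetInf → ℝ}

theorem SmoothOn.mono_set (hF : SmoothOn k U F) (h : U' ⊆ U) : SmoothOn k U' F := by
  obtain ⟨g, hg⟩ := hF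
  exact ⟨g, fun θ hθ => hg θ (h hθ)⟩

theorem SmoothOn.mono (hF : SmoothOn k U F) (h : k ≤ l) : SmoothOn l U F := by
  obtain ⟨g, hg⟩ := hF
  refine ⟨g ∘ resL l k, fun θ hθ => ⟨?_, ?_⟩⟩
  · refine ContDiffAt.comp _ ?_ (resL l k).contDiff.contDiffAt
    rw [resL_proj h]; exact (hg θ hθ).1
  · rw [Function.comp_apply, resL_proj h]; exact (hg θ hθ).2

theorem SmoothOn.congr (hF : SmoothOn k U F) (h : ∀ θ ∈ U, G θ = F θ) : SmoothOn k U G := by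
  obtain ⟨g, hg⟩ := hF
  exact ⟨g, fun θ hθ => ⟨(hg θ hθ).1, (h θ hθ).trans (hg θ hθ).2⟩⟩

theorem smoothOn_const (c : ℝ) : SmoothOn k U (fun _ => c) :=
  ⟨fun _ => c, fun _ _ => ⟨contDiffAt_const, rfl⟩⟩

theorem smoothOn_base (i : Fin 3) : SmoothOn k U (fun θ => θ.1 i) :=
  ⟨fun p => p.1 i, fun _ _ => ⟨by fun_prop, rfl⟩⟩

theorem smoothOn_jet {σ : MIdx} (h : ∑ i, σ i ≤ k) : SmoothOn k U (fun θ => θ.2 σ) :=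
  ⟨fun p => p.2 ⟨σ, mem_multiIdx.2 h⟩, fun _ _ => ⟨by fun_prop, rfl⟩⟩

theorem smoothOn_u₁ : SmoothOn k U u₁ := smoothOn_base 2

theorem smoothOn_fd {i j m : ℕ} (h : i + j + m ≤ k) : SmoothOn k U (fd i j m) :=
  smoothOn_jet (by simpa [Fin.sum_univ_three] using h)

theorem SmoothOn.add (hF : SmoothOn k U F) (hG : SmoothOn k U G) :
    SmoothOn k U (fun θ => F θ + G θ) := by
  obtain ⟨f, hf⟩ := hF
  obtain ⟨g, hg⟩ := hG
  exact ⟨fun p => f p + g p, fun θ hθ => ⟨(hf θ hθ).1.add (hg θ hθ).1, by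
    beta_reduce; rw [(hf θ hθ).2, (hg θ hθ).2]⟩⟩

theorem SmoothOn.neg (hF : SmoothOn k U F) : SmoothOn k U (fun θ => - F θ) := by
  obtain ⟨f, hf⟩ := hF
  exact ⟨fun p => - f p, fun θ hθ => ⟨(hf θ hθ).1.neg, by beta_reduce; rw [(hf θ hθ).2]⟩⟩

theorem SmoothOn.sub (hF : SmoothOn k U F) (hG : SmoothOn k U G) :
    SmoothOn k U (fun θ => F θ - G θ) := by
  simpa only [sub_eq_add_neg] using hF.add hG.neg

theorem SmoothOn.mul (hF : SmoothOn k U F) (hG : SmoothOn k U G) :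
    SmoothOn k U (fun θ => F θ * G θ) := by
  obtain ⟨f, hf⟩ := hF
  obtain ⟨g, hg⟩ := hG
  exact ⟨fun p => f p * g p, fun θ hθ => ⟨(hf θ hθ).1.mul (hg θ hθ).1, by
    beta_reduce; rw [(hf θ hθ).2, (hg θ hθ).2]⟩⟩

theorem SmoothOn.pow (hF : SmoothOn k U F) (n : ℕ) : SmoothOn k U (fun θ => F θ ^ n) := by
  obtain ⟨f, hf⟩ := hF
  exact ⟨fun p => f p ^ n, fun θ hθ => ⟨(hf θ hθ).1.pow n, by beta_reduce; rw [(hf θ hθ).2]⟩⟩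

theorem SmoothOn.div (hF : SmoothOn k U F) (hG : SmoothOn k U G) (h : ∀ θ ∈ U, G θ ≠ 0) :
    SmoothOn k U (fun θ => F θ / G θ) := by
  obtain ⟨f, hf⟩ := hF
  obtain ⟨g, hg⟩ := hG
  exact ⟨fun p => f p / g p, fun θ hθ => ⟨(hf θ hθ).1.div (hg θ hθ).1
    (by rw [← (hg θ hθ).2]; exact h θ hθ), by beta_reduce; rw [(hf θ hθ).2, (hg θ hθ).2]⟩⟩

theorem SmoothOn.sum {ι : Type*} {s : Finset ι} {F : ι → JetInf → ℝ}
    (hF : ∀ i ∈ s, SmoothOn k U (F i)) : SmoothOn k U (fun θ => ∑ i ∈ s, F i θ) := by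
  classical
  induction s using Finset.induction_on with
  | empty => simpa using smoothOn_const 0
  | insert a s ha ih =>
    simp only [Finset.sum_insert ha]
    exact (hF a (by simp)).add (ih fun i hi => hF i (by simp [hi]))

theorem smoothOn_comp_x {a : ℝ → ℝ} (ha : ContDiff ℝ ∞ a) : SmoothOn k U (fun θ => a (θ.1 0)) :=
  ⟨fun p => a (p.1 0), fun _ _ => ⟨ContDiff.contDiffAt (by fun_prop), rfl⟩⟩

theorem smoothOn_comp_xu {b : ℝ × ℝ → ℝ} (hb : ContDiff ℝ ∞ b) :
    SmoothOn k U (fun θ => b (θ.1 0, θ.1 1)) :=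
  ⟨fun p => b (p.1 0, p.1 1), fun _ _ => ⟨ContDiff.contDiffAt (by fun_prop), rfl⟩⟩

theorem eventually_line_mem (hU : IsOpen U) {θ : JetInf} (hθ : θ ∈ U) (v : JetInf) :
    ∀ᶠ t : ℝ in 𝓝 0, θ + t • v ∈ U := by
  have hc : Continuous fun t : ℝ => θ + t • v := by fun_prop
  exact hc.continuousAt.eventually (hU.mem_nhds (by simpa using hθ))

/-- Infinite jets carry no norm, so derivatives are taken along lines. For a function of finite
order they are values of the Fréchet derivative of a representative on `k`-jets, from which
linearity and symmetry are inherited. -/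
theorem hasLineDerivAt_of_eq (hU : IsOpen U) {g : JetK k → ℝ} {θ : JetInf} (hθ : θ ∈ U)
    (hF : ∀ θ ∈ U, F θ = g (proj k θ)) (hg : ContDiffAt ℝ ∞ g (proj k θ)) (v : JetInf) :
    HasLineDerivAt ℝ F (fderiv ℝ g (proj k θ) (proj k v)) θ v := by
  have h1 : HasDerivAt (fun t : ℝ => proj k θ + t • proj k v) (proj k v) 0 := by
    simpa using ((hasDerivAt_id (0 : ℝ)).smul_const (proj k v)).const_add (proj k θ)
  have hd : DifferentiableAt ℝ g (proj k θ) := hg.differentiableAt (by simp)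
  have h2 : HasFDerivAt g (fderiv ℝ g (proj k θ)) (proj k θ + (0 : ℝ) • proj k v) := by
    simpa using hd.hasFDerivAt
  have h3 := h2.comp_hasDerivAt (0 : ℝ) h1
  refine h3.congr_of_eventuallyEq ?_
  filter_upwards [eventually_line_mem hU hθ v] with t ht
  exact hF _ ht

theorem SmoothOn.hasLineDerivAt (hF : SmoothOn k U F) (hU : IsOpen U) {θ : JetInf} (hθ : θ ∈ U)
    (v : JetInf) : HasLineDerivAt ℝ F (lineDeriv ℝ F θ v) θ v := by
  obtain ⟨g, hg⟩ := hF
  exact (hasLineDerivAt_of_eq hU hθ (fun θ hθ => (hg θ hθ).2) (hg θ hθ).1 v).lineDifferentiableAt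
    |>.hasLineDerivAt

theorem lineDeriv_congr_of_eqOn (hU : IsOpen U) {θ : JetInf} (hθ : θ ∈ U)
    (h : ∀ θ ∈ U, F θ = G θ) (v : JetInf) : lineDeriv ℝ F θ v = lineDeriv ℝ G θ v := by
  refine Filter.EventuallyEq.deriv_eq ?_
  filter_upwards [eventually_line_mem hU hθ v] with t ht
  exact h _ ht

theorem SmoothOn.lineDeriv_add_vec (hF : SmoothOn k U F) (hU : IsOpen U) {θ : JetInf}
    (hθ : θ ∈ U) (v w : JetInf) :
    lineDeriv ℝ F θ (v + w) = lineDeriv ℝ F θ v + lineDeriv ℝ F θ w := by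
  obtain ⟨g, hg⟩ := hF
  have h := hasLineDerivAt_of_eq hU hθ (fun θ hθ => (hg θ hθ).2) (hg θ hθ).1
  rw [(h _).lineDeriv, (h _).lineDeriv, (h _).lineDeriv, proj_add, map_add]

theorem lineDeriv_smul_vec (F : JetInf → ℝ) (θ : JetInf) (t : ℝ) (v : JetInf) :
    lineDeriv ℝ F θ (t • v) = t * lineDeriv ℝ F θ v := by
  rw [lineDeriv_smul, smul_eq_mul]

theorem SmoothOn.lineDeriv_sum_vec (hF : SmoothOn k U F) (hU : IsOpen U) {θ : JetInf}
    (hθ : θ ∈ U) {ι : Type*} (s : Finset ι) (c : ι → ℝ) (v : ι → JetInf) :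
    lineDeriv ℝ F θ (∑ i ∈ s, c i • v i) = ∑ i ∈ s, c i * lineDeriv ℝ F θ (v i) := by
  classical
  induction s using Finset.induction_on with
  | empty => simp [lineDeriv_zero]
  | insert a s ha ih =>
    rw [Finset.sum_insert ha, Finset.sum_insert ha, hF.lineDeriv_add_vec hU hθ, ih,
      lineDeriv_smul_vec]

/-- The derivative depends only on the projection of the direction to `k`-jets. -/
theorem SmoothOn.lineDeriv_congr_vec (hF : SmoothOn k U F) (hU : IsOpen U) {θ : JetInf}
    (hθ : θ ∈ U) {v w : JetInf} (h : proj k v = proj k w) :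
    lineDeriv ℝ F θ v = lineDeriv ℝ F θ w := by
  obtain ⟨g, hg⟩ := hF
  have h' := hasLineDerivAt_of_eq hU hθ (fun θ hθ => (hg θ hθ).2) (hg θ hθ).1
  rw [(h' _).lineDeriv, (h' _).lineDeriv, h]

/-- A vector field all of whose components are smooth functions of finite order on `U`. -/
def SmoothField (U : Set JetInf) (V : JetInf → JetInf) : Prop :=
  (∀ i, ∃ l, SmoothOn l U fun θ => (V θ).1 i) ∧ ∀ σ, ∃ l, SmoothOn l U fun θ => (V θ).2 σ

/-- Only the components of `V` up to order `k` enter, since the differential of `F` sees no others.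
The order of the result is therefore governed by these finitely many components. -/
theorem SmoothOn.lineDeriv_field {V : JetInf → JetInf} (hF : SmoothOn k U F) (hU : IsOpen U)
    (hkl : k ≤ l) (h1 : ∀ i, SmoothOn l U fun θ => (V θ).1 i)
    (h2 : ∀ σ : MIdx, ∑ i, σ i ≤ k → SmoothOn l U fun θ => (V θ).2 σ) :
    SmoothOn l U (fun θ => lineDeriv ℝ F θ (V θ)) := by
  obtain ⟨g, hg⟩ := hF
  choose A hA using h1
  choose B hB using h2
  refine ⟨fun p => fderiv ℝ g (resL l k p)
    ((fun i => A i p, fun σ => B σ (mem_multiIdx.1 σ.2) p) : JetK k), fun θ hθ => ⟨?_, ?_⟩⟩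
  · have h3 : ContDiffAt ℝ ∞ (fun p => fderiv ℝ g (resL l k p)) (proj l θ) := by
      refine ContDiffAt.comp (g := fderiv ℝ g) _ ?_ (resL l k).contDiff.contDiffAt
      rw [resL_proj hkl]
      exact (hg θ hθ).1.fderiv_right (by simp)
    refine h3.clm_apply (ContDiffAt.prodMk ?_ ?_)
    · exact contDiffAt_pi.2 fun i => (hA i θ hθ).1
    · exact contDiffAt_pi.2 fun σ => (hB σ _ θ hθ).1
  · beta_reduce
    rw [(hasLineDerivAt_of_eq hU hθ (fun θ hθ => (hg θ hθ).2) (hg θ hθ).1 _).lineDeriv,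
      resL_proj hkl]
    congr 1
    refine Prod.ext ?_ ?_
    · funext i; exact (hA i θ hθ).2
    · funext σ; exact (hB σ _ θ hθ).2

/-- The Lie bracket of two vector fields on the space of infinite jets. -/
def bracket (V W : JetInf → JetInf) (θ : JetInf) : JetInf :=
  (fun i => lineDeriv ℝ (fun θ' => (W θ').1 i) θ (V θ)
      - lineDeriv ℝ (fun θ' => (V θ').1 i) θ (W θ),
   fun σ => lineDeriv ℝ (fun θ' => (W θ').2 σ) θ (V θ)
      - lineDeriv ℝ (fun θ' => (V θ').2 σ) θ (W θ))

theorem SmoothField.hasDerivAt_proj {W : JetInf → JetInf} (hW : SmoothField U W) (hU : IsOpen U)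
    {θ : JetInf} (hθ : θ ∈ U) (v : JetInf) (k : ℕ) :
    HasDerivAt (fun t : ℝ => proj k (W (θ + t • v)))
      (proj k (fun i => lineDeriv ℝ (fun θ' => (W θ').1 i) θ v,
        fun σ => lineDeriv ℝ (fun θ' => (W θ').2 σ) θ v)) 0 := by
  refine HasDerivAt.prodMk ?_ ?_
  · refine hasDerivAt_pi.2 fun i => ?_
    obtain ⟨l, hl⟩ := hW.1 i
    exact hl.hasLineDerivAt hU hθ v
  · refine hasDerivAt_pi.2 fun σ => ?_
    obtain ⟨l, hl⟩ := hW.2 σ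
    exact hl.hasLineDerivAt hU hθ v

theorem hasDerivAt_clm_line {E : Type*} [NormedAddCommGroup E] [NormedSpace ℝ E]
    {g : E → E →L[ℝ] ℝ} {p : E} (w : E) {y : ℝ → E} {y' : E} (hg : DifferentiableAt ℝ g p)
    (hy : HasDerivAt y y' 0) :
    HasDerivAt (fun t : ℝ => g (p + t • w) (y t)) (fderiv ℝ g p w (y 0) + g p y') 0 := by
  have h1 : HasDerivAt (fun t : ℝ => p + t • w) w 0 := by
    simpa using ((hasDerivAt_id (0 : ℝ)).smul_const w).const_add p
  have h2 : HasFDerivAt g (fderiv ℝ g p) (p + (0 : ℝ) • w) := by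
    simpa using hg.hasFDerivAt
  have h3 : HasDerivAt (fun t : ℝ => g (p + t • w)) (fderiv ℝ g p w) 0 :=
    h2.comp_hasDerivAt (0 : ℝ) h1
  have h4 := h3.clm_apply hy
  rw [zero_smul, add_zero] at h4
  exact h4

theorem hasDerivAt_lineDeriv_field {W : JetInf → JetInf} (hW : SmoothField U W) (hU : IsOpen U)
    {g : JetK k → ℝ} (hg : ∀ θ ∈ U, ContDiffAt ℝ ∞ g (proj k θ) ∧ F θ = g (proj k θ))
    {θ : JetInf} (hθ : θ ∈ U) (v : JetInf) :
    lineDeriv ℝ (fun θ' => lineDeriv ℝ F θ' (W θ')) θ v =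
      fderiv ℝ (fderiv ℝ g) (proj k θ) (proj k v) (proj k (W θ)) +
      fderiv ℝ g (proj k θ) (proj k (fun i => lineDeriv ℝ (fun θ' => (W θ').1 i) θ v,
        fun σ => lineDeriv ℝ (fun θ' => (W θ').2 σ) θ v)) := by
  have h3 := hasDerivAt_clm_line (proj k v)
    (((hg θ hθ).1.fderiv_right (m := ∞) (by simp)).differentiableAt (by simp))
    (hW.hasDerivAt_proj hU hθ v k)
  have h4 : (fun t : ℝ => lineDeriv ℝ F (θ + t • v) (W (θ + t • v))) =ᶠ[𝓝 0]
      fun t => fderiv ℝ g (proj k θ + t • proj k v) (proj k (W (θ + t • v))) := by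
    filter_upwards [eventually_line_mem hU hθ v] with t ht
    rw [(hasLineDerivAt_of_eq hU ht (fun θ hθ => (hg θ hθ).2) (hg _ ht).1 _).lineDeriv,
      proj_add, proj_smul]
  have h6 := (h3.congr_of_eventuallyEq h4).deriv
  simp only [zero_smul, add_zero] at h6
  exact h6

/-- Both iterated derivatives contain the second derivative of the representative; it is symmetric
and cancels. What is left is its first derivative on the differentiated components of the fields. -/
theorem SmoothOn.commutator {V W : JetInf → JetInf} (hF : SmoothOn k U F) (hU : IsOpen U)
    (hV : SmoothField U V) (hW : SmoothField U W) {θ : JetInf} (hθ : θ ∈ U) :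
    lineDeriv ℝ (fun θ' => lineDeriv ℝ F θ' (W θ')) θ (V θ)
      - lineDeriv ℝ (fun θ' => lineDeriv ℝ F θ' (V θ')) θ (W θ)
      = lineDeriv ℝ F θ (bracket V W θ) := by
  obtain ⟨g, hg⟩ := hF
  rw [hasDerivAt_lineDeriv_field hW hU hg hθ, hasDerivAt_lineDeriv_field hV hU hg hθ,
    (hasLineDerivAt_of_eq hU hθ (fun θ hθ => (hg θ hθ).2) (hg θ hθ).1 _).lineDeriv]
  have hs : IsSymmSndFDerivAt ℝ g (proj k θ) :=
    (hg θ hθ).1.isSymmSndFDerivAt (by simpa using (mod_cast le_top : ((2 : ℕ∞) : WithTop ℕ∞) ≤ ∞))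
  rw [hs (proj k (V θ)) (proj k (W θ)), add_sub_add_left_eq_sub, ← map_sub]
  rfl

end SmoothOn

/-! ### Total derivatives -/

/-- Smooth functions of finite order on the whole space of infinite jets. -/
def Smooth (F : JetInf → ℝ) : Prop := ∃ k, SmoothOn k Set.univ F

theorem totalVec_fst (i j : Fin 3) (θ : JetInf) :
    (totalVec i θ).1 j = (Pi.single i 1 : Fin 3 → ℝ) j := rfl

theorem totalVec_snd (i : Fin 3) (θ : JetInf) (σ : MIdx) :
    (totalVec i θ).2 σ = θ.2 (σ + Pi.single i 1) := rfl

theorem sum_add_single (σ : MIdx) (i : Fin 3) :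
    ∑ j, (σ + Pi.single i 1 : MIdx) j = ∑ j, σ j + 1 := by
  simp [Finset.sum_add_distrib]

theorem SmoothOn.totalD {k : ℕ} {U : Set JetInf} {F : JetInf → ℝ} (hF : SmoothOn k U F)
    (hU : IsOpen U) (i : Fin 3) : SmoothOn (k + 1) U (totalD i F) := by
  refine hF.lineDeriv_field hU (Nat.le_succ k) (fun j => smoothOn_const _) fun σ hσ => ?_
  exact smoothOn_jet (by rw [sum_add_single]; omega)

theorem smoothField_totalVec (U : Set JetInf) (i : Fin 3) : SmoothField U (totalVec i) :=
  ⟨fun _ => ⟨0, smoothOn_const _⟩, fun _ => ⟨_, smoothOn_jet le_rfl⟩⟩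

theorem lineDeriv_base (i : Fin 3) (θ v : JetInf) :
    lineDeriv ℝ (fun θ' : JetInf => θ'.1 i) θ v = v.1 i := by
  have : HasDerivAt (fun t : ℝ => θ.1 i + t * v.1 i) (v.1 i) 0 := by
    simpa using ((hasDerivAt_id (0 : ℝ)).mul_const (v.1 i)).const_add (θ.1 i)
  exact this.deriv

theorem lineDeriv_jet (σ : MIdx) (θ v : JetInf) :
    lineDeriv ℝ (fun θ' : JetInf => θ'.2 σ) θ v = v.2 σ := by
  have : HasDerivAt (fun t : ℝ => θ.2 σ + t * v.2 σ) (v.2 σ) 0 := by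
    simpa using ((hasDerivAt_id (0 : ℝ)).mul_const (v.2 σ)).const_add (θ.2 σ)
  exact this.deriv

theorem lineDeriv_fun_const (c : ℝ) (θ v : JetInf) :
    lineDeriv ℝ (fun _ : JetInf => c) θ v = 0 := by
  simp [lineDeriv]

theorem bracket_totalVec (i j : Fin 3) (θ : JetInf) :
    bracket (totalVec i) (totalVec j) θ = 0 := by
  refine Prod.ext ?_ ?_
  · funext m
    simp [bracket, totalVec_fst, lineDeriv_fun_const]
  · funext σ
    simp only [bracket, totalVec_snd, lineDeriv_jet]
    simp [add_right_comm]

theorem SmoothOn.totalD_comm {k : ℕ} {U : Set JetInf} {F : JetInf → ℝ} (hF : SmoothOn k U F)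
    (hU : IsOpen U) (i j : Fin 3) {θ : JetInf} (hθ : θ ∈ U) :
    Feedback.totalD i (Feedback.totalD j F) θ = Feedback.totalD j (Feedback.totalD i F) θ := by
  have := hF.commutator hU (smoothField_totalVec U i) (smoothField_totalVec U j) hθ
  rw [bracket_totalVec, lineDeriv_zero, sub_eq_zero] at this
  exact this

theorem Smooth.totalD {F : JetInf → ℝ} (hF : Smooth F) (i : Fin 3) :
    Smooth (Feedback.totalD i F) :=
  let ⟨k, hk⟩ := hF
  ⟨k + 1, hk.totalD isOpen_univ i⟩

theorem Smooth.totalD_comm {F : JetInf → ℝ} (hF : Smooth F) (i j : Fin 3) :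
    Feedback.totalD i (Feedback.totalD j F) = Feedback.totalD j (Feedback.totalD i F) :=
  let ⟨_, hk⟩ := hF
  funext fun _ => hk.totalD_comm isOpen_univ i j (Set.mem_univ _)

theorem Smooth.iterate_totalD {F : JetInf → ℝ} (hF : Smooth F) (i : Fin 3) (n : ℕ) :
    Smooth ((Feedback.totalD i)^[n] F) := by
  induction n with
  | zero => exact hF
  | succ n ih => rw [Function.iterate_succ_apply']; exact ih.totalD i

theorem Smooth.totalD_iterate_comm {F : JetInf → ℝ} (hF : Smooth F) (i j : Fin 3) (n : ℕ) :
    Feedback.totalD i ((Feedback.totalD j)^[n] F) =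
      (Feedback.totalD j)^[n] (Feedback.totalD i F) := by
  induction n with
  | zero => rfl
  | succ n ih =>
    rw [Function.iterate_succ_apply', Function.iterate_succ_apply',
      (hF.iterate_totalD j n).totalD_comm, ih]

theorem Smooth.totalDs {F : JetInf → ℝ} (hF : Smooth F) (σ : MIdx) :
    Smooth (Feedback.totalDs σ F) :=
  ((hF.iterate_totalD 2 _).iterate_totalD 1 _).iterate_totalD 0 _

theorem Smooth.totalD_totalDs {F : JetInf → ℝ} (hF : Smooth F) (i : Fin 3) (σ : MIdx) :
    Feedback.totalD i (Feedback.totalDs σ F) = Feedback.totalDs σ (Feedback.totalD i F) := by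
  unfold Feedback.totalDs
  rw [((hF.iterate_totalD 2 _).iterate_totalD 1 _).totalD_iterate_comm,
    (hF.iterate_totalD 2 _).totalD_iterate_comm, hF.totalD_iterate_comm]

/-- `totalDs` applies the total derivatives in a fixed order, so raising an index that is not
outermost uses that they commute. -/
theorem Smooth.totalDs_add_single {F : JetInf → ℝ} (hF : Smooth F) (σ : MIdx) (i : Fin 3) :
    Feedback.totalDs (σ + Pi.single i 1) F = Feedback.totalD i (Feedback.totalDs σ F) := by
  have h2 := hF.iterate_totalD 2 (σ 2)
  have h1 := h2.iterate_totalD 1 (σ 1)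
  unfold Feedback.totalDs
  fin_cases i
  · simp [Function.iterate_succ_apply']
  · simp [Function.iterate_succ_apply', h1.totalD_iterate_comm]
  · simp [Function.iterate_succ_apply', h1.totalD_iterate_comm, h2.totalD_iterate_comm]

theorem Smooth.totalDs_add_single' {F : JetInf → ℝ} (hF : Smooth F) (σ : MIdx) (i : Fin 3) :
    Feedback.totalDs (σ + Pi.single i 1) F = Feedback.totalDs σ (Feedback.totalD i F) := by
  rw [hF.totalDs_add_single, hF.totalD_totalDs]

/-! ### Prolonged feedback vector fields -/

section Prolongation

variable {k l : ℕ} {U : Set JetInf} {F G : JetInf → ℝ}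

theorem SmoothOn.lineDeriv_mul (hF : SmoothOn k U F) (hG : SmoothOn l U G) (hU : IsOpen U)
    {θ : JetInf} (hθ : θ ∈ U) (v : JetInf) :
    lineDeriv ℝ (fun θ' => F θ' * G θ') θ v =
      lineDeriv ℝ F θ v * G θ + F θ * lineDeriv ℝ G θ v := by
  have h : HasDerivAt (fun t : ℝ => F (θ + t • v) * G (θ + t • v)) _ 0 :=
    HasDerivAt.mul (hF.hasLineDerivAt hU hθ v) (hG.hasLineDerivAt hU hθ v)
  have h' := h.deriv
  simp only [zero_smul, add_zero] at h'
  exact h'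

theorem SmoothOn.lineDeriv_add (hF : SmoothOn k U F) (hG : SmoothOn l U G) (hU : IsOpen U)
    {θ : JetInf} (hθ : θ ∈ U) (v : JetInf) :
    lineDeriv ℝ (fun θ' => F θ' + G θ') θ v = lineDeriv ℝ F θ v + lineDeriv ℝ G θ v := by
  have h : HasDerivAt (fun t : ℝ => F (θ + t • v) + G (θ + t • v)) _ 0 :=
    HasDerivAt.add (hF.hasLineDerivAt hU hθ v) (hG.hasLineDerivAt hU hθ v)
  exact h.deriv

theorem SmoothOn.lineDeriv_sum {ι : Type*} (s : Finset ι) {F : ι → JetInf → ℝ}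
    (hF : ∀ i ∈ s, SmoothOn k U (F i)) (hU : IsOpen U) {θ : JetInf} (hθ : θ ∈ U) (v : JetInf) :
    lineDeriv ℝ (fun θ' => ∑ i ∈ s, F i θ') θ v = ∑ i ∈ s, lineDeriv ℝ (F i) θ v := by
  classical
  induction s using Finset.induction_on with
  | empty => simp [lineDeriv_fun_const]
  | insert a s ha ih =>
    simp only [Finset.sum_insert ha]
    rw [SmoothOn.lineDeriv_add (hF a (by simp))
      (SmoothOn.sum fun i hi => hF i (by simp [hi])) hU hθ, ih fun i hi => hF i (by simp [hi])]

variable {a : ℝ → ℝ} {b : ℝ × ℝ → ℝ}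

theorem contDiff_deriv (ha : ContDiff ℝ ∞ a) : ContDiff ℝ ∞ (deriv a) :=
  ((contDiff_infty_iff_deriv).1 ha).2

theorem contDiff_fderiv_apply (hb : ContDiff ℝ ∞ b) (v : ℝ × ℝ) :
    ContDiff ℝ ∞ (fun q => fderiv ℝ b q v) :=
  (hb.fderiv_right (by simp)).clm_apply contDiff_const

theorem smoothOn_xi (ha : ContDiff ℝ ∞ a) (hb : ContDiff ℝ ∞ b) (j : Fin 3) :
    SmoothOn k U (fun θ => xi a b θ j) := by
  fin_cases j
  · exact smoothOn_comp_x ha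
  · exact smoothOn_comp_xu hb
  · exact (smoothOn_u₁.mul (smoothOn_comp_xu (contDiff_fderiv_apply hb (0, 1)))).add
      ((smoothOn_fd (by simp)).mul (smoothOn_comp_xu (contDiff_fderiv_apply hb (1, 0))))

theorem smooth_genFun (ha : ContDiff ℝ ∞ a) (hb : ContDiff ℝ ∞ b) : Smooth (genFun a b) :=
  ⟨1, ((smoothOn_comp_x (contDiff_deriv ha)).mul (smoothOn_fd (by simp))).sub
    ((((smoothOn_xi ha hb 0).mul (smoothOn_fd (by simp))).add
      ((smoothOn_xi ha hb 1).mul (smoothOn_fd (by simp)))).add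
      ((smoothOn_xi ha hb 2).mul (smoothOn_fd (by simp))))⟩

theorem prol_fst (a : ℝ → ℝ) (b : ℝ × ℝ → ℝ) (θ : JetInf) : (prol a b θ).1 = xi a b θ := by
  funext j
  simp only [prol, Fin.sum_univ_three, Prod.fst_add, Prod.smul_fst, Pi.add_apply, Pi.smul_apply,
    totalVec_fst, smul_eq_mul, Pi.zero_apply]
  fin_cases j <;> simp

theorem prol_snd (a : ℝ → ℝ) (b : ℝ × ℝ → ℝ) (θ : JetInf) (σ : MIdx) :
    (prol a b θ).2 σ =
      totalDs σ (genFun a b) θ + ∑ i, xi a b θ i * θ.2 (σ + Pi.single i 1) := by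
  simp only [prol, Fin.sum_univ_three, Prod.snd_add, Prod.smul_snd, Pi.add_apply, Pi.smul_apply,
    totalVec_snd, smul_eq_mul]

theorem smooth_prol_snd (ha : ContDiff ℝ ∞ a) (hb : ContDiff ℝ ∞ b) (σ : MIdx) :
    Smooth fun θ => (prol a b θ).2 σ := by
  simp only [prol_snd]
  obtain ⟨m, hm⟩ := (smooth_genFun ha hb).totalDs σ
  refine ⟨max m (∑ j, σ j + 1), (hm.mono (le_max_left _ _)).add (SmoothOn.sum fun i _ =>
    (smoothOn_xi ha hb i).mul (smoothOn_jet ?_))⟩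
  rw [sum_add_single]
  exact le_max_right _ _

theorem Smooth.smoothOn (hF : Smooth F) (U : Set JetInf) : ∃ m, SmoothOn m U F :=
  let ⟨m, hm⟩ := hF
  ⟨m, hm.mono_set (Set.subset_univ U)⟩

theorem smoothField_prol (ha : ContDiff ℝ ∞ a) (hb : ContDiff ℝ ∞ b) :
    SmoothField U (prol a b) :=
  ⟨fun i => ⟨0, by simpa only [prol_fst] using smoothOn_xi ha hb i⟩,
    fun σ => (smooth_prol_snd ha hb σ).smoothOn U⟩

theorem prol_zero (a : ℝ → ℝ) (b : ℝ × ℝ → ℝ) (θ : JetInf) :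
    (prol a b θ).2 0 = deriv a (θ.1 0) * θ.2 0 := by
  have h0 : (Pi.single 0 1 : MIdx) = ![1, 0, 0] := by ext i; fin_cases i <;> rfl
  have h1 : (Pi.single 1 1 : MIdx) = ![0, 1, 0] := by ext i; fin_cases i <;> rfl
  have h2 : (Pi.single 2 1 : MIdx) = ![0, 0, 1] := by ext i; fin_cases i <;> rfl
  have h3 : (![0, 0, 0] : MIdx) = 0 := by ext i; fin_cases i <;> rfl
  simp only [prol_snd, totalDs, Pi.zero_apply, Function.iterate_zero, id, genFun, fd,
    Fin.sum_univ_three, zero_add, h0, h1, h2, h3]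
  ring

/-- The recursion formula for the coefficients of the prolongation. -/
theorem prol_add_single (ha : ContDiff ℝ ∞ a) (hb : ContDiff ℝ ∞ b) (θ : JetInf) (σ : MIdx)
    (i : Fin 3) :
    (prol a b θ).2 (σ + Pi.single i 1) = totalD i (fun θ' => (prol a b θ').2 σ) θ
      - ∑ j, θ.2 (σ + Pi.single j 1) * totalD i (fun θ' => xi a b θ' j) θ := by
  obtain ⟨m, hm⟩ := (smooth_genFun ha hb).totalDs σ
  have hx : ∀ j, SmoothOn 0 Set.univ fun θ => xi a b θ j := smoothOn_xi ha hb
  have hs : ∀ j : Fin 3, SmoothOn (∑ j, σ j + 1) Set.univ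
      fun θ : JetInf => θ.2 (σ + Pi.single j 1) :=
    fun j => smoothOn_jet (by rw [sum_add_single])
  have hmul : ∀ j : Fin 3, SmoothOn (∑ j, σ j + 1) Set.univ
      fun θ : JetInf => xi a b θ j * θ.2 (σ + Pi.single j 1) :=
    fun j => ((hx j).mono (Nat.zero_le _)).mul (hs j)
  simp only [prol_snd]
  rw [(smooth_genFun ha hb).totalDs_add_single]
  simp only [totalD]
  rw [SmoothOn.lineDeriv_add hm (SmoothOn.sum fun j _ => hmul j) isOpen_univ (Set.mem_univ θ),
    SmoothOn.lineDeriv_sum _ (fun j _ => hmul j) isOpen_univ (Set.mem_univ θ)]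
  simp only [(hx _).lineDeriv_mul (hs _) isOpen_univ (Set.mem_univ θ), lineDeriv_jet, totalVec_snd,
    Finset.sum_add_distrib]
  simp only [add_right_comm σ (Pi.single i 1), mul_comm (θ.2 _)]
  ring

/-- The base components of `totalVec` are constant, so there only the derivative of `xi` survives;
on the jet coordinates the identity is the recursion formula `prol_add_single`. -/
theorem bracket_prol_totalVec (ha : ContDiff ℝ ∞ a) (hb : ContDiff ℝ ∞ b) (θ : JetInf)
    (i : Fin 3) :
    bracket (prol a b) (totalVec i) θ =
      ∑ j, (-totalD i (fun θ' => xi a b θ' j) θ) • totalVec j θ := by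
  refine Prod.ext ?_ ?_
  · funext m
    simp only [bracket, totalVec_fst, lineDeriv_fun_const, prol_fst, Prod.fst_add, Prod.smul_fst,
      Pi.add_apply, Pi.smul_apply, totalD, Fin.sum_univ_three, smul_eq_mul]
    fin_cases m <;> simp
  · funext σ
    simp only [bracket, totalVec_snd, lineDeriv_jet, Prod.snd_sum, Prod.smul_snd,
      Finset.sum_apply, Pi.smul_apply, smul_eq_mul, prol_add_single ha hb]
    simp only [totalD, Fin.sum_univ_three]
    ring

theorem SmoothOn.prolD_totalD (hF : SmoothOn k U F) (hU : IsOpen U) (ha : ContDiff ℝ ∞ a)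
    (hb : ContDiff ℝ ∞ b) {θ : JetInf} (hθ : θ ∈ U) (i : Fin 3) :
    prolD a b (Feedback.totalD i F) θ = Feedback.totalD i (prolD a b F) θ
      - ∑ j, Feedback.totalD i (fun θ' => xi a b θ' j) θ * Feedback.totalD j F θ := by
  have h := hF.commutator hU (smoothField_prol ha hb) (smoothField_totalVec U i) hθ
  rw [bracket_prol_totalVec ha hb, hF.lineDeriv_sum_vec hU hθ] at h
  simp only [neg_mul, Finset.sum_neg_distrib] at h
  exact sub_eq_iff_eq_add.1 h |>.trans (by rw [add_comm, ← sub_eq_add_neg]; rfl)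

theorem SmoothOn.derivation {A : Fin 3 → JetInf → ℝ} (hA : ∀ j, SmoothOn (k + 1) U (A j))
    (hF : SmoothOn k U F) (hU : IsOpen U) : SmoothOn (k + 1) U (derivation A F) :=
  SmoothOn.sum fun j _ => (hA j).mul (hF.totalD hU j)

/-- The hypothesis `h` says that the coefficient of each D_j in the commutator of X with Σ A_i D_i,
namely X(A_j) - Σ_i A_i D_i(ξ_j), vanishes at `θ`. -/
theorem SmoothOn.prolD_derivation {A : Fin 3 → JetInf → ℝ} (hA : ∀ j, SmoothOn l U (A j))
    (hF : SmoothOn k U F) (hU : IsOpen U) (ha : ContDiff ℝ ∞ a) (hb : ContDiff ℝ ∞ b)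
    {θ : JetInf} (hθ : θ ∈ U)
    (h : ∀ j, Feedback.prolD a b (A j) θ =
      ∑ i, A i θ * Feedback.totalD i (fun θ' => xi a b θ' j) θ) :
    Feedback.prolD a b (Feedback.derivation A F) θ =
      Feedback.derivation A (Feedback.prolD a b F) θ := by
  have hA' : ∀ j, SmoothOn (max l (k + 1)) U (A j) := fun j => (hA j).mono (le_max_left _ _)
  have hD : ∀ j, SmoothOn (max l (k + 1)) U (Feedback.totalD j F) :=
    fun j => (hF.totalD hU j).mono (le_max_right _ _)
  have h1 : Feedback.prolD a b (Feedback.derivation A F) θ = ∑ j,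
      (Feedback.prolD a b (A j) θ * Feedback.totalD j F θ
        + A j θ * Feedback.prolD a b (Feedback.totalD j F) θ) := by
    unfold Feedback.derivation Feedback.prolD
    rw [SmoothOn.lineDeriv_sum _ (fun j _ => (hA' j).mul (hD j)) hU hθ]
    exact Finset.sum_congr rfl fun j _ => (hA' j).lineDeriv_mul (hD j) hU hθ _
  rw [h1]
  simp only [h, hF.prolD_totalD hU ha hb hθ, Feedback.derivation, Fin.sum_univ_three]
  ring

end Prolongation

/-! ### Calculus of explicit expressions -/

section Rules

variable {F G : JetInf → ℝ}

@[simp] theorem Smooth.add (hF : Smooth F) (hG : Smooth G) : Smooth fun θ => F θ + G θ := by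
  obtain ⟨k, hk⟩ := hF
  obtain ⟨l, hl⟩ := hG
  exact ⟨max k l, (hk.mono (le_max_left _ _)).add (hl.mono (le_max_right _ _))⟩

@[simp] theorem Smooth.mul (hF : Smooth F) (hG : Smooth G) : Smooth fun θ => F θ * G θ := by
  obtain ⟨k, hk⟩ := hF
  obtain ⟨l, hl⟩ := hG
  exact ⟨max k l, (hk.mono (le_max_left _ _)).mul (hl.mono (le_max_right _ _))⟩

@[simp] theorem Smooth.neg (hF : Smooth F) : Smooth fun θ => -F θ :=
  let ⟨k, hk⟩ := hF
  ⟨k, hk.neg⟩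

@[simp] theorem Smooth.sub (hF : Smooth F) (hG : Smooth G) : Smooth fun θ => F θ - G θ := by
  simpa only [sub_eq_add_neg] using hF.add hG.neg

@[simp] theorem Smooth.sq (hF : Smooth F) : Smooth fun θ => F θ ^ 2 :=
  let ⟨k, hk⟩ := hF
  ⟨k, hk.pow 2⟩

@[simp] theorem smooth_const (c : ℝ) : Smooth fun _ => c := ⟨0, smoothOn_const c⟩

@[simp] theorem smooth_u₁ : Smooth u₁ := ⟨0, smoothOn_u₁⟩

@[simp] theorem smooth_fd (i j l : ℕ) : Smooth (fd i j l) := ⟨_, smoothOn_fd le_rfl⟩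

@[simp] theorem Smooth.lineDeriv_add (hF : Smooth F) (hG : Smooth G) (θ v : JetInf) :
    lineDeriv ℝ (fun θ => F θ + G θ) θ v = lineDeriv ℝ F θ v + lineDeriv ℝ G θ v := by
  obtain ⟨k, hk⟩ := hF
  obtain ⟨l, hl⟩ := hG
  exact hk.lineDeriv_add hl isOpen_univ (Set.mem_univ θ) v

@[simp] theorem Smooth.lineDeriv_mul (hF : Smooth F) (hG : Smooth G) (θ v : JetInf) :
    lineDeriv ℝ (fun θ => F θ * G θ) θ v =
      lineDeriv ℝ F θ v * G θ + F θ * lineDeriv ℝ G θ v := by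
  obtain ⟨k, hk⟩ := hF
  obtain ⟨l, hl⟩ := hG
  exact hk.lineDeriv_mul hl isOpen_univ (Set.mem_univ θ) v

@[simp] theorem lineDeriv_fun_neg (F : JetInf → ℝ) (θ v : JetInf) :
    lineDeriv ℝ (fun θ => -F θ) θ v = -lineDeriv ℝ F θ v :=
  deriv.fun_neg

@[simp] theorem Smooth.lineDeriv_sub (hF : Smooth F) (hG : Smooth G) (θ v : JetInf) :
    lineDeriv ℝ (fun θ => F θ - G θ) θ v = lineDeriv ℝ F θ v - lineDeriv ℝ G θ v := by
  simp only [sub_eq_add_neg, hF.lineDeriv_add hG.neg, lineDeriv_fun_neg]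

@[simp] theorem Smooth.lineDeriv_sq (hF : Smooth F) (θ v : JetInf) :
    lineDeriv ℝ (fun θ => F θ ^ 2) θ v = 2 * F θ * lineDeriv ℝ F θ v := by
  simp only [pow_two, hF.lineDeriv_mul hF]
  ring

attribute [simp] lineDeriv_fun_const

/-- The quotient rule comes from differentiating Q G = F, so no smoothness of `F` has to be supplied
separately. -/
theorem SmoothOn.lineDeriv_div {k : ℕ} {U : Set JetInf} {Q : JetInf → ℝ} (hQ : SmoothOn k U Q)
    (hU : IsOpen U) (hG : Smooth G) (h0 : ∀ θ ∈ U, G θ ≠ 0)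
    (h : ∀ θ ∈ U, Q θ = F θ / G θ) {θ : JetInf} (hθ : θ ∈ U) (v : JetInf) :
    lineDeriv ℝ Q θ v = (lineDeriv ℝ F θ v * G θ - F θ * lineDeriv ℝ G θ v) / G θ ^ 2 := by
  obtain ⟨m, hm⟩ := hG.smoothOn U
  have h1 := hQ.lineDeriv_mul hm hU hθ v
  rw [lineDeriv_congr_of_eqOn hU hθ (G := F)
    (fun θ' hθ' => by rw [h θ' hθ', div_mul_cancel₀ _ (h0 θ' hθ')])] at h1
  have h2 := h0 θ hθ
  rw [h1, h θ hθ]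
  field_simp
  ring

end Rules

/-- The partial derivative of a function of two variables in the first variable. -/
def pdx (b : ℝ × ℝ → ℝ) (q : ℝ × ℝ) : ℝ := fderiv ℝ b q (1, 0)

/-- The partial derivative of a function of two variables in the second variable. -/
def pdu (b : ℝ × ℝ → ℝ) (q : ℝ × ℝ) : ℝ := fderiv ℝ b q (0, 1)

/-- The derivatives of `a = a(x)` as functions on the space of infinite jets. -/
def aJet (a : ℝ → ℝ) (n : ℕ) (θ : JetInf) : ℝ := (deriv^[n] a) (θ.1 0)

/-- The partial derivatives of `b = b(x, u)` as functions on the space of infinite jets. -/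
def bJet (b : ℝ × ℝ → ℝ) (p q : ℕ) (θ : JetInf) : ℝ := (pdx^[p] (pdu^[q] b)) (θ.1 0, θ.1 1)

/-! ### Coefficients of the prolongation up to order three -/

section Explicit

variable {a : ℝ → ℝ} {b : ℝ × ℝ → ℝ}

theorem contDiff_iterate_deriv (ha : ContDiff ℝ ∞ a) (n : ℕ) : ContDiff ℝ ∞ (deriv^[n] a) := by
  induction n with
  | zero => exact ha
  | succ n ih => rw [Function.iterate_succ_apply']; exact contDiff_deriv ih

theorem contDiff_pdx (hb : ContDiff ℝ ∞ b) : ContDiff ℝ ∞ (pdx b) := contDiff_fderiv_apply hb _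

theorem contDiff_pdu (hb : ContDiff ℝ ∞ b) : ContDiff ℝ ∞ (pdu b) := contDiff_fderiv_apply hb _

theorem contDiff_iterate_pdx (hb : ContDiff ℝ ∞ b) (n : ℕ) : ContDiff ℝ ∞ (pdx^[n] b) := by
  induction n with
  | zero => exact hb
  | succ n ih => rw [Function.iterate_succ_apply']; exact contDiff_pdx ih

theorem contDiff_iterate_pdu (hb : ContDiff ℝ ∞ b) (n : ℕ) : ContDiff ℝ ∞ (pdu^[n] b) := by
  induction n with
  | zero => exact hb
  | succ n ih => rw [Function.iterate_succ_apply']; exact contDiff_pdu ih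

theorem pdu_pdx (hb : ContDiff ℝ ∞ b) : pdu (pdx b) = pdx (pdu b) := by
  funext q
  have hd : DifferentiableAt ℝ (fderiv ℝ b) q :=
    ((hb.fderiv_right (m := ∞) (by simp)).differentiable (by simp)).differentiableAt
  have hs : IsSymmSndFDerivAt ℝ b q := (hb.contDiffAt (x := q)).isSymmSndFDerivAt
    (by simpa using (mod_cast le_top : ((2 : ℕ∞) : WithTop ℕ∞) ≤ ∞))
  have h1 : ∀ v, HasFDerivAt (fun q' => fderiv ℝ b q' v)
      ((ContinuousLinearMap.apply ℝ ℝ v).comp (fderiv ℝ (fderiv ℝ b) q)) q := fun v =>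
    (ContinuousLinearMap.apply ℝ ℝ v).hasFDerivAt.comp q hd.hasFDerivAt
  change fderiv ℝ (fun q' => fderiv ℝ b q' (1, 0)) q (0, 1)
    = fderiv ℝ (fun q' => fderiv ℝ b q' (0, 1)) q (1, 0)
  rw [(h1 _).fderiv, (h1 _).fderiv]
  exact hs _ _

theorem pdu_iterate_pdx (hb : ContDiff ℝ ∞ b) (n : ℕ) :
    pdu (pdx^[n] b) = pdx^[n] (pdu b) := by
  induction n with
  | zero => rfl
  | succ n ih =>
    rw [Function.iterate_succ_apply', pdu_pdx (contDiff_iterate_pdx hb n), ih,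
      ← Function.iterate_succ_apply' pdx]

@[simp] theorem smooth_aJet (ha : ContDiff ℝ ∞ a) (n : ℕ) : Smooth (aJet a n) :=
  ⟨0, smoothOn_comp_x (contDiff_iterate_deriv ha n)⟩

@[simp] theorem smooth_bJet (hb : ContDiff ℝ ∞ b) (p q : ℕ) : Smooth (bJet b p q) :=
  ⟨0, smoothOn_comp_xu (contDiff_iterate_pdx (contDiff_iterate_pdu hb q) p)⟩

theorem lineDeriv_comp_x (ha : ContDiff ℝ ∞ a) (θ v : JetInf) :
    lineDeriv ℝ (fun θ' : JetInf => a (θ'.1 0)) θ v = deriv a (θ.1 0) * v.1 0 := by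
  have h1 : HasDerivAt (fun t : ℝ => θ.1 0 + t * v.1 0) (v.1 0) 0 := by
    simpa using ((hasDerivAt_id (0 : ℝ)).mul_const (v.1 0)).const_add (θ.1 0)
  have h2 : HasDerivAt a (deriv a (θ.1 0)) (θ.1 0 + 0 * v.1 0) := by
    simpa using (ha.differentiable (by simp)).differentiableAt.hasDerivAt
  exact (h2.comp (0 : ℝ) h1).deriv

theorem lineDeriv_comp_xu (hb : ContDiff ℝ ∞ b) (θ v : JetInf) :
    lineDeriv ℝ (fun θ' : JetInf => b (θ'.1 0, θ'.1 1)) θ v =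
      fderiv ℝ b (θ.1 0, θ.1 1) (v.1 0, v.1 1) := by
  have h1 : ∀ i : Fin 3, HasDerivAt (fun t : ℝ => θ.1 i + t * v.1 i) (v.1 i) 0 := fun i => by
    simpa using ((hasDerivAt_id (0 : ℝ)).mul_const (v.1 i)).const_add (θ.1 i)
  have h2 : HasFDerivAt b (fderiv ℝ b (θ.1 0, θ.1 1))
      (θ.1 0 + 0 * v.1 0, θ.1 1 + 0 * v.1 1) := by
    simpa using (hb.differentiable (by simp)).differentiableAt.hasFDerivAt
  exact (h2.comp_hasDerivAt (0 : ℝ) ((h1 0).prodMk (h1 1))).deriv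

@[simp] theorem lineDeriv_aJet (ha : ContDiff ℝ ∞ a) (n : ℕ) (i : Fin 3) (θ : JetInf) :
    lineDeriv ℝ (aJet a n) θ (totalVec i θ) = if i = 0 then aJet a (n + 1) θ else 0 := by
  refine (lineDeriv_comp_x (contDiff_iterate_deriv ha n) θ _).trans ?_
  rw [totalVec_fst, aJet, Function.iterate_succ_apply']
  fin_cases i <;> simp

@[simp] theorem lineDeriv_bJet (hb : ContDiff ℝ ∞ b) (p q : ℕ) (i : Fin 3) (θ : JetInf) :
    lineDeriv ℝ (bJet b p q) θ (totalVec i θ) =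
      if i = 0 then bJet b (p + 1) q θ else if i = 1 then bJet b p (q + 1) θ else 0 := by
  refine (lineDeriv_comp_xu (contDiff_iterate_pdx (contDiff_iterate_pdu hb q) p) θ _).trans ?_
  simp only [totalVec_fst, bJet, Function.iterate_succ_apply',
    ← pdu_iterate_pdx (contDiff_iterate_pdu hb q)]
  fin_cases i
  · simp [pdx]
  · simp [pdu]
  · simp [← Prod.zero_eq_mk]

@[simp] theorem lineDeriv_u₁_totalVec (i : Fin 3) (θ : JetInf) :
    lineDeriv ℝ u₁ θ (totalVec i θ) = if i = 2 then 1 else 0 := by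
  refine (lineDeriv_base 2 θ _).trans ?_
  fin_cases i <;> simp [totalVec_fst]

theorem lineDeriv_fd (i j l : ℕ) (θ v : JetInf) :
    lineDeriv ℝ (fd i j l) θ v = v.2 ![i, j, l] := lineDeriv_jet _ θ v

theorem add_single_zero (i j l : ℕ) : (![i, j, l] + Pi.single 0 1 : MIdx) = ![i + 1, j, l] := by
  ext m; fin_cases m <;> simp

theorem add_single_one (i j l : ℕ) : (![i, j, l] + Pi.single 1 1 : MIdx) = ![i, j + 1, l] := by
  ext m; fin_cases m <;> simp

theorem add_single_two (i j l : ℕ) : (![i, j, l] + Pi.single 2 1 : MIdx) = ![i, j, l + 1] := by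
  ext m; fin_cases m <;> simp

@[simp] theorem lineDeriv_fd_totalVec_zero (i j l : ℕ) (θ : JetInf) :
    lineDeriv ℝ (fd i j l) θ (totalVec 0 θ) = fd (i + 1) j l θ := by
  rw [lineDeriv_fd, totalVec_snd, add_single_zero, fd]

@[simp] theorem lineDeriv_fd_totalVec_one (i j l : ℕ) (θ : JetInf) :
    lineDeriv ℝ (fd i j l) θ (totalVec 1 θ) = fd i (j + 1) l θ := by
  rw [lineDeriv_fd, totalVec_snd, add_single_one, fd]

@[simp] theorem lineDeriv_fd_totalVec_two (i j l : ℕ) (θ : JetInf) :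
    lineDeriv ℝ (fd i j l) θ (totalVec 2 θ) = fd i j (l + 1) θ := by
  rw [lineDeriv_fd, totalVec_snd, add_single_two, fd]

theorem totalD_congr {F G : JetInf → ℝ} (i : Fin 3) (h : ∀ θ, F θ = G θ) (θ : JetInf) :
    totalD i F θ = totalD i G θ := by rw [funext h]

theorem xi_zero (a : ℝ → ℝ) (b : ℝ × ℝ → ℝ) (θ : JetInf) : xi a b θ 0 = aJet a 0 θ := rfl

theorem xi_one (a : ℝ → ℝ) (b : ℝ × ℝ → ℝ) (θ : JetInf) : xi a b θ 1 = bJet b 0 0 θ := rfl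

theorem xi_two (a : ℝ → ℝ) (b : ℝ × ℝ → ℝ) (θ : JetInf) :
    xi a b θ 2 = u₁ θ * bJet b 0 1 θ + fd 0 0 0 θ * bJet b 1 0 θ := rfl

theorem prol_succ_x (ha : ContDiff ℝ ∞ a) (hb : ContDiff ℝ ∞ b) (θ : JetInf) (i j l : ℕ) :
    (prol a b θ).2 ![i + 1, j, l] = totalD 0 (fun θ' => (prol a b θ').2 ![i, j, l]) θ
      - (fd (i + 1) j l θ * aJet a 1 θ + fd i (j + 1) l θ * bJet b 1 0 θ
        + fd i j (l + 1) θ * (u₁ θ * bJet b 1 1 θ + fd 1 0 0 θ * bJet b 1 0 θ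
          + fd 0 0 0 θ * bJet b 2 0 θ)) := by
  rw [← add_single_zero, prol_add_single ha hb]
  simp only [Fin.sum_univ_three, xi_zero, xi_one, xi_two, totalD, add_single_zero,
    add_single_one, add_single_two]
  simp (maxDischargeDepth := 10) [ha, hb, Smooth.lineDeriv_add, Smooth.lineDeriv_mul]
  simp only [fd]
  ring

theorem prol_succ_u (ha : ContDiff ℝ ∞ a) (hb : ContDiff ℝ ∞ b) (θ : JetInf) (i j l : ℕ) :
    (prol a b θ).2 ![i, j + 1, l] = totalD 1 (fun θ' => (prol a b θ').2 ![i, j, l]) θ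
      - (fd i (j + 1) l θ * bJet b 0 1 θ
        + fd i j (l + 1) θ * (u₁ θ * bJet b 0 2 θ + fd 0 1 0 θ * bJet b 1 0 θ
          + fd 0 0 0 θ * bJet b 1 1 θ)) := by
  rw [← add_single_one, prol_add_single ha hb]
  simp only [Fin.sum_univ_three, xi_zero, xi_one, xi_two, totalD, add_single_zero,
    add_single_one, add_single_two]
  simp (maxDischargeDepth := 10) [ha, hb, Smooth.lineDeriv_add, Smooth.lineDeriv_mul]
  simp only [fd]
  ring

theorem prol_succ_z (ha : ContDiff ℝ ∞ a) (hb : ContDiff ℝ ∞ b) (θ : JetInf) (i j l : ℕ) :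
    (prol a b θ).2 ![i, j, l + 1] = totalD 2 (fun θ' => (prol a b θ').2 ![i, j, l]) θ
      - fd i j (l + 1) θ * (bJet b 0 1 θ + fd 0 0 1 θ * bJet b 1 0 θ) := by
  rw [← add_single_two, prol_add_single ha hb]
  simp only [Fin.sum_univ_three, xi_zero, xi_one, xi_two, totalD, add_single_zero,
    add_single_one, add_single_two]
  simp (maxDischargeDepth := 10) [ha, hb, Smooth.lineDeriv_add, Smooth.lineDeriv_mul]
  simp [fd]

theorem prol_000 (a : ℝ → ℝ) (b : ℝ × ℝ → ℝ) (θ : JetInf) :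
    (prol a b θ).2 ![0, 0, 0] = aJet a 1 θ * fd 0 0 0 θ := by
  have h : (![0, 0, 0] : MIdx) = 0 := by ext i; fin_cases i <;> rfl
  simp only [h, prol_zero, fd]
  rfl

/-- Together with `prol_000`, this and the formulas below cover exactly the jet coordinates that
occur in J, K and the coefficients of the ∇'s. Each follows from one of lower order by a single step
of the recursion. -/
theorem prol_100 (ha : ContDiff ℝ ∞ a) (hb : ContDiff ℝ ∞ b) (θ : JetInf) :
    (prol a b θ).2 ![1, 0, 0] =
      aJet a 2 θ * fd 0 0 0 θ + bJet b 1 0 θ * (-fd 0 1 0 θ - fd 0 0 1 θ * fd 1 0 0 θ) +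
      bJet b 1 1 θ * (-u₁ θ * fd 0 0 1 θ) + bJet b 2 0 θ * (-fd 0 0 0 θ * fd 0 0 1 θ) := by
  rw [prol_succ_x ha hb, totalD_congr _ (prol_000 a b)]
  simp (maxDischargeDepth := 40) [totalD, ha]
  ring

theorem prol_010 (ha : ContDiff ℝ ∞ a) (hb : ContDiff ℝ ∞ b) (θ : JetInf) :
    (prol a b θ).2 ![0, 1, 0] =
      aJet a 1 θ * fd 0 1 0 θ + bJet b 0 1 θ * (-fd 0 1 0 θ) + bJet b 0 2 θ * (-u₁ θ *
      fd 0 0 1 θ) + bJet b 1 0 θ * (-fd 0 0 1 θ * fd 0 1 0 θ) + bJet b 1 1 θ * (-fd 0 0 0 θ *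
      fd 0 0 1 θ) := by
  rw [prol_succ_u ha hb, totalD_congr _ (prol_000 a b)]
  simp (maxDischargeDepth := 40) [totalD, ha]
  ring

theorem prol_001 (ha : ContDiff ℝ ∞ a) (hb : ContDiff ℝ ∞ b) (θ : JetInf) :
    (prol a b θ).2 ![0, 0, 1] =
      aJet a 1 θ * fd 0 0 1 θ + bJet b 0 1 θ * (-fd 0 0 1 θ) + bJet b 1 0 θ * (-fd 0 0 1 θ ^ 2) := by
  rw [prol_succ_z ha hb, totalD_congr _ (prol_000 a b)]
  simp (maxDischargeDepth := 40) [totalD, ha]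
  ring

theorem prol_110 (ha : ContDiff ℝ ∞ a) (hb : ContDiff ℝ ∞ b) (θ : JetInf) :
    (prol a b θ).2 ![1, 1, 0] =
      aJet a 2 θ * fd 0 1 0 θ + bJet b 0 1 θ * (-fd 1 1 0 θ) + bJet b 0 2 θ * (-u₁ θ *
      fd 1 0 1 θ) + bJet b 1 0 θ * (-fd 0 1 0 θ * fd 1 0 1 θ - fd 0 0 1 θ * fd 1 1 0 θ -
      fd 0 2 0 θ - fd 0 1 1 θ * fd 1 0 0 θ) + bJet b 1 1 θ * (-fd 0 1 0 θ - fd 0 0 1 θ *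
      fd 1 0 0 θ - fd 0 0 0 θ * fd 1 0 1 θ - u₁ θ * fd 0 1 1 θ) + bJet b 1 2 θ * (-u₁ θ *
      fd 0 0 1 θ) + bJet b 2 0 θ * (-fd 0 0 1 θ * fd 0 1 0 θ - fd 0 0 0 θ * fd 0 1 1 θ) +
      bJet b 2 1 θ * (-fd 0 0 0 θ * fd 0 0 1 θ) := by
  rw [prol_succ_x ha hb, totalD_congr _ (prol_010 ha hb)]
  simp (maxDischargeDepth := 40) [totalD, ha, hb]
  ring

theorem prol_020 (ha : ContDiff ℝ ∞ a) (hb : ContDiff ℝ ∞ b) (θ : JetInf) :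
    (prol a b θ).2 ![0, 2, 0] =
      aJet a 1 θ * fd 0 2 0 θ + bJet b 0 1 θ * (-2 * fd 0 2 0 θ) + bJet b 0 2 θ * (-fd 0 1 0 θ -
      2 * u₁ θ * fd 0 1 1 θ) + bJet b 0 3 θ * (-u₁ θ * fd 0 0 1 θ) + bJet b 1 0 θ * (-2 *
      fd 0 1 0 θ * fd 0 1 1 θ - fd 0 0 1 θ * fd 0 2 0 θ) + bJet b 1 1 θ * (-2 * fd 0 0 1 θ *
      fd 0 1 0 θ - 2 * fd 0 0 0 θ * fd 0 1 1 θ) + bJet b 1 2 θ * (-fd 0 0 0 θ * fd 0 0 1 θ) := by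
  rw [prol_succ_u ha hb, totalD_congr _ (prol_010 ha hb)]
  simp (maxDischargeDepth := 40) [totalD, ha, hb]
  ring

theorem prol_101 (ha : ContDiff ℝ ∞ a) (hb : ContDiff ℝ ∞ b) (θ : JetInf) :
    (prol a b θ).2 ![1, 0, 1] =
      aJet a 2 θ * fd 0 0 1 θ + bJet b 0 1 θ * (-fd 1 0 1 θ) + bJet b 1 0 θ * (-2 * fd 0 0 1 θ *
      fd 1 0 1 θ - fd 0 1 1 θ - fd 0 0 2 θ * fd 1 0 0 θ) + bJet b 1 1 θ * (-fd 0 0 1 θ - u₁ θ *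
      fd 0 0 2 θ) + bJet b 2 0 θ * (-fd 0 0 1 θ ^ 2 - fd 0 0 0 θ * fd 0 0 2 θ) := by
  rw [prol_succ_x ha hb, totalD_congr _ (prol_001 ha hb)]
  simp (maxDischargeDepth := 40) [totalD, ha, hb]
  ring

theorem prol_011 (ha : ContDiff ℝ ∞ a) (hb : ContDiff ℝ ∞ b) (θ : JetInf) :
    (prol a b θ).2 ![0, 1, 1] =
      aJet a 1 θ * fd 0 1 1 θ + bJet b 0 1 θ * (-2 * fd 0 1 1 θ) + bJet b 0 2 θ * (-fd 0 0 1 θ -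
      u₁ θ * fd 0 0 2 θ) + bJet b 1 0 θ * (-2 * fd 0 0 1 θ * fd 0 1 1 θ - fd 0 0 2 θ *
      fd 0 1 0 θ) + bJet b 1 1 θ * (-fd 0 0 1 θ ^ 2 - fd 0 0 0 θ * fd 0 0 2 θ) := by
  rw [prol_succ_u ha hb, totalD_congr _ (prol_001 ha hb)]
  simp (maxDischargeDepth := 40) [totalD, ha, hb]
  ring

theorem prol_002 (ha : ContDiff ℝ ∞ a) (hb : ContDiff ℝ ∞ b) (θ : JetInf) :
    (prol a b θ).2 ![0, 0, 2] =
      aJet a 1 θ * fd 0 0 2 θ + bJet b 0 1 θ * (-2 * fd 0 0 2 θ) + bJet b 1 0 θ * (-3 *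
      fd 0 0 1 θ * fd 0 0 2 θ) := by
  rw [prol_succ_z ha hb, totalD_congr _ (prol_001 ha hb)]
  simp (maxDischargeDepth := 40) [totalD, ha, hb]
  ring

theorem prol_111 (ha : ContDiff ℝ ∞ a) (hb : ContDiff ℝ ∞ b) (θ : JetInf) :
    (prol a b θ).2 ![1, 1, 1] =
      aJet a 2 θ * fd 0 1 1 θ + bJet b 0 1 θ * (-2 * fd 1 1 1 θ) + bJet b 0 2 θ * (-fd 1 0 1 θ -
      u₁ θ * fd 1 0 2 θ) + bJet b 1 0 θ * (-2 * fd 0 1 1 θ * fd 1 0 1 θ - 2 * fd 0 0 1 θ *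
      fd 1 1 1 θ - fd 0 1 0 θ * fd 1 0 2 θ - fd 0 0 2 θ * fd 1 1 0 θ - fd 0 2 1 θ - fd 0 1 2 θ *
      fd 1 0 0 θ) + bJet b 1 1 θ * (-2 * fd 0 1 1 θ - 2 * fd 0 0 1 θ * fd 1 0 1 θ - fd 0 0 2 θ *
      fd 1 0 0 θ - fd 0 0 0 θ * fd 1 0 2 θ - u₁ θ * fd 0 1 2 θ) + bJet b 1 2 θ * (-fd 0 0 1 θ -
      u₁ θ * fd 0 0 2 θ) + bJet b 2 0 θ * (-2 * fd 0 0 1 θ * fd 0 1 1 θ - fd 0 0 2 θ *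
      fd 0 1 0 θ - fd 0 0 0 θ * fd 0 1 2 θ) + bJet b 2 1 θ * (-fd 0 0 1 θ ^ 2 - fd 0 0 0 θ *
      fd 0 0 2 θ) := by
  rw [prol_succ_x ha hb, totalD_congr _ (prol_011 ha hb)]
  simp (maxDischargeDepth := 40) [totalD, ha, hb]
  ring

theorem prol_021 (ha : ContDiff ℝ ∞ a) (hb : ContDiff ℝ ∞ b) (θ : JetInf) :
    (prol a b θ).2 ![0, 2, 1] =
      aJet a 1 θ * fd 0 2 1 θ + bJet b 0 1 θ * (-3 * fd 0 2 1 θ) + bJet b 0 2 θ * (-3 *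
      fd 0 1 1 θ - 2 * u₁ θ * fd 0 1 2 θ) + bJet b 0 3 θ * (-fd 0 0 1 θ - u₁ θ * fd 0 0 2 θ) +
      bJet b 1 0 θ * (-2 * fd 0 1 1 θ ^ 2 - 2 * fd 0 0 1 θ * fd 0 2 1 θ - 2 * fd 0 1 0 θ *
      fd 0 1 2 θ - fd 0 0 2 θ * fd 0 2 0 θ) + bJet b 1 1 θ * (-4 * fd 0 0 1 θ * fd 0 1 1 θ - 2 *
      fd 0 0 2 θ * fd 0 1 0 θ - 2 * fd 0 0 0 θ * fd 0 1 2 θ) + bJet b 1 2 θ * (-fd 0 0 1 θ ^ 2 -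
      fd 0 0 0 θ * fd 0 0 2 θ) := by
  rw [prol_succ_u ha hb, totalD_congr _ (prol_011 ha hb)]
  simp (maxDischargeDepth := 40) [totalD, ha, hb]
  ring

theorem prol_102 (ha : ContDiff ℝ ∞ a) (hb : ContDiff ℝ ∞ b) (θ : JetInf) :
    (prol a b θ).2 ![1, 0, 2] =
      aJet a 2 θ * fd 0 0 2 θ + bJet b 0 1 θ * (-2 * fd 1 0 2 θ) + bJet b 1 0 θ * (-3 *
      fd 0 0 2 θ * fd 1 0 1 θ - 3 * fd 0 0 1 θ * fd 1 0 2 θ - fd 0 1 2 θ - fd 0 0 3 θ *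
      fd 1 0 0 θ) + bJet b 1 1 θ * (-2 * fd 0 0 2 θ - u₁ θ * fd 0 0 3 θ) + bJet b 2 0 θ * (-3 *
      fd 0 0 1 θ * fd 0 0 2 θ - fd 0 0 0 θ * fd 0 0 3 θ) := by
  rw [prol_succ_x ha hb, totalD_congr _ (prol_002 ha hb)]
  simp (maxDischargeDepth := 40) [totalD, ha, hb]
  ring

theorem prol_012 (ha : ContDiff ℝ ∞ a) (hb : ContDiff ℝ ∞ b) (θ : JetInf) :
    (prol a b θ).2 ![0, 1, 2] =
      aJet a 1 θ * fd 0 1 2 θ + bJet b 0 1 θ * (-3 * fd 0 1 2 θ) + bJet b 0 2 θ * (-2 *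
      fd 0 0 2 θ - u₁ θ * fd 0 0 3 θ) + bJet b 1 0 θ * (-3 * fd 0 0 2 θ * fd 0 1 1 θ - 3 *
      fd 0 0 1 θ * fd 0 1 2 θ - fd 0 0 3 θ * fd 0 1 0 θ) + bJet b 1 1 θ * (-3 * fd 0 0 1 θ *
      fd 0 0 2 θ - fd 0 0 0 θ * fd 0 0 3 θ) := by
  rw [prol_succ_u ha hb, totalD_congr _ (prol_002 ha hb)]
  simp (maxDischargeDepth := 40) [totalD, ha, hb]
  ring

theorem prol_003 (ha : ContDiff ℝ ∞ a) (hb : ContDiff ℝ ∞ b) (θ : JetInf) :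
    (prol a b θ).2 ![0, 0, 3] =
      aJet a 1 θ * fd 0 0 3 θ + bJet b 0 1 θ * (-3 * fd 0 0 3 θ) + bJet b 1 0 θ * (-3 *
      fd 0 0 2 θ ^ 2 - 4 * fd 0 0 1 θ * fd 0 0 3 θ) := by
  rw [prol_succ_z ha hb, totalD_congr _ (prol_002 ha hb)]
  simp (maxDischargeDepth := 40) [totalD, ha, hb]
  ring

end Explicit

/-! ### Invariance of the basic invariants and derivations -/

/-- The set of regular infinite jets. -/
def regJet : Set JetInf := {θ | Regular θ}

/-- Regularity involves no jet coordinate of order above two. For k < 2 the extension by zero would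
annul f_{u₁u₁}, and `regularSet k` would be empty. -/
theorem regular_ext_proj {k : ℕ} (hk : 2 ≤ k) (θ : JetInf) :
    proj k θ ∈ regularSet k ↔ Regular θ := by
  have h : ∀ l, l ≤ 2 → fd 0 0 l (ext k (proj k θ)) = fd 0 0 l θ := by
    intro l hl
    have : (![0, 0, l] : MIdx) ∈ multiIdx k := by
      rw [mem_multiIdx]
      simpa [Fin.sum_univ_three] using hl.trans hk
    simp [fd, ext, proj, this]
  have hu : u₁ (ext k (proj k θ)) = u₁ θ := rfl
  simp only [regularSet, Regular, Set.mem_ofPred_eq, h 0 (by simp), h 1 (by simp), h 2 le_rfl, hu]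

theorem continuous_fd (i j l : ℕ) : Continuous (fd i j l) :=
  (continuous_apply _).comp continuous_snd

theorem continuous_u₁ : Continuous u₁ := (continuous_apply _).comp continuous_fst

theorem isOpen_regJet : IsOpen regJet := by
  have h1 := (continuous_fd 0 0 0).isOpen_preimage _ (isOpen_ne (x := (0 : ℝ)))
  have h2 := (continuous_fd 0 0 1).isOpen_preimage _ (isOpen_ne (x := (0 : ℝ)))
  have h3 := (continuous_fd 0 0 2).isOpen_preimage _ (isOpen_ne (x := (0 : ℝ)))
  have h4 := ((continuous_u₁.mul (continuous_fd 0 0 1)).sub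
    (continuous_fd 0 0 0)).isOpen_preimage _ (isOpen_ne (x := (0 : ℝ)))
  exact h1.inter (h2.inter (h3.inter h4))

@[simp] theorem lineDeriv_fd_prol (a : ℝ → ℝ) (b : ℝ × ℝ → ℝ) (i j l : ℕ) (θ : JetInf) :
    lineDeriv ℝ (fd i j l) θ (prol a b θ) = (prol a b θ).2 ![i, j, l] := lineDeriv_fd i j l θ _

@[simp] theorem lineDeriv_u₁_prol (a : ℝ → ℝ) (b : ℝ × ℝ → ℝ) (θ : JetInf) :
    lineDeriv ℝ u₁ θ (prol a b θ) = u₁ θ * bJet b 0 1 θ + fd 0 0 0 θ * bJet b 1 0 θ := by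
  rw [← xi_two a, ← prol_fst]
  exact lineDeriv_base 2 θ _

theorem smoothOn_nablaCoeff (i j : Fin 3) : SmoothOn 2 regJet (nablaCoeff i j) := by
  have h : ∀ i j l, i + j + l ≤ 2 → SmoothOn 2 regJet (fd i j l) := fun i j l => smoothOn_fd
  have hz : SmoothOn 2 regJet u₁ := smoothOn_u₁
  have h0 : ∀ θ ∈ regJet, fd 0 0 1 θ ≠ 0 := fun θ hθ => hθ.2.1
  have h1 : ∀ θ ∈ regJet, fd 0 0 1 θ ^ 2 ≠ 0 := fun θ hθ => pow_ne_zero 2 hθ.2.1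
  have h2 : ∀ θ ∈ regJet, fd 0 0 2 θ ≠ 0 := fun θ hθ => hθ.2.2.1
  have f := h 0 0 0 (by simp)
  have fx := h 1 0 0 (by simp)
  have fu := h 0 1 0 (by simp)
  have fz := h 0 0 1 (by simp)
  have fxz := h 1 0 1 (by simp)
  have fuz := h 0 1 1 (by simp)
  have fzz := h 0 0 2 (by simp)
  fin_cases i <;> fin_cases j
  · exact smoothOn_const 0
  · exact ((hz.mul fz).sub f).div fz h0
  · exact ((f.sub (hz.mul fz)).div (fz.pow 2) h1).mul fu
  · exact smoothOn_const 0
  · exact smoothOn_const 0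
  · exact f.div fz h0
  · exact f
  · exact f.div fz h0
  · exact ((((((fx.mul fz).add fu).sub (hz.mul fuz)).sub (f.mul fxz)).div fzz h2).add
      ((((hz.mul fz).sub f).div (fz.pow 2) h1).mul fu))

section Invariance

variable {a : ℝ → ℝ} {b : ℝ × ℝ → ℝ}

-- This is the criterion of `SmoothOn.prolD_derivation` for the three ∇'s. Each nontrivial
-- coefficient is written as one quotient of polynomials in the jet coordinates, differentiated by
-- the quotient rule, and compared after clearing denominators.
set_option linter.unusedSimpArgs false in
theorem prolD_nablaCoeff (ha : ContDiff ℝ ∞ a) (hb : ContDiff ℝ ∞ b) (i j : Fin 3) {θ : JetInf}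
    (hθ : θ ∈ regJet) :
    prolD a b (nablaCoeff i j) θ =
      ∑ m, nablaCoeff i m θ * totalD m (fun θ' => xi a b θ' j) θ := by
  obtain ⟨hf, hz, hzz, hw⟩ := id hθ
  have key : ∀ (i j : Fin 3) (F G : JetInf → ℝ), Smooth G → (∀ θ ∈ regJet, G θ ≠ 0) →
      (∀ θ ∈ regJet, nablaCoeff i j θ = F θ / G θ) → prolD a b (nablaCoeff i j) θ =
        (prolD a b F θ * G θ - F θ * prolD a b G θ) / G θ ^ 2 := fun i j F G hG h0 h =>
    (smoothOn_nablaCoeff i j).lineDeriv_div isOpen_regJet hG h0 h hθ _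
  have h0 : ∀ θ ∈ regJet, fd 0 0 1 θ ≠ 0 := fun θ hθ => hθ.2.1
  have h1 : ∀ θ ∈ regJet, fd 0 0 1 θ ^ 2 ≠ 0 := fun θ hθ => pow_ne_zero 2 hθ.2.1
  have h2 : ∀ θ ∈ regJet, fd 0 0 2 θ * fd 0 0 1 θ ^ 2 ≠ 0 :=
    fun θ hθ => mul_ne_zero hθ.2.2.1 (h1 θ hθ)
  have c1 : ∀ θ ∈ regJet, nablaCoeff 0 1 θ = (u₁ θ * fd 0 0 1 θ - fd 0 0 0 θ) / fd 0 0 1 θ :=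
    fun θ _ => rfl
  have c2 : ∀ θ ∈ regJet, nablaCoeff 0 2 θ =
      (fd 0 0 0 θ - u₁ θ * fd 0 0 1 θ) * fd 0 1 0 θ / fd 0 0 1 θ ^ 2 :=
    fun θ _ => div_mul_eq_mul_div _ _ _
  have c3 : ∀ θ ∈ regJet, nablaCoeff 1 2 θ = fd 0 0 0 θ / fd 0 0 1 θ := fun θ _ => rfl
  have c4 : ∀ θ ∈ regJet, nablaCoeff 2 1 θ = fd 0 0 0 θ / fd 0 0 1 θ := fun θ _ => rfl
  have c5 : ∀ θ ∈ regJet, nablaCoeff 2 2 θ =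
      ((fd 1 0 0 θ * fd 0 0 1 θ + fd 0 1 0 θ - u₁ θ * fd 0 1 1 θ - fd 0 0 0 θ * fd 1 0 1 θ)
        * fd 0 0 1 θ ^ 2 + (u₁ θ * fd 0 0 1 θ - fd 0 0 0 θ) * fd 0 1 0 θ * fd 0 0 2 θ)
      / (fd 0 0 2 θ * fd 0 0 1 θ ^ 2) := by
    intro θ hθ
    obtain ⟨hf, hz, hzz, hw⟩ := id hθ
    simp only [nablaCoeff, Matrix.cons_val]
    field_simp
  have z00 : nablaCoeff 0 0 = fun _ => (0 : ℝ) := rfl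
  have z10 : nablaCoeff 1 0 = fun _ => (0 : ℝ) := rfl
  have z11 : nablaCoeff 1 1 = fun _ => (0 : ℝ) := rfl
  have z20 : nablaCoeff 2 0 = fd 0 0 0 := rfl
  fin_cases i <;> fin_cases j <;>
    simp only [Fin.zero_eta, Fin.mk_one, Fin.reduceFinMk, Fin.sum_univ_three]
  · simp only [z00, c1 θ hθ, c2 θ hθ, prolD, totalD, xi_zero, xi_one, xi_two]
    simp (maxDischargeDepth := 10) [ha, hb]
  · rw [key 0 1 _ _ (by simp (maxDischargeDepth := 10)) h0 c1]
    simp only [z00, c1 θ hθ, c2 θ hθ, prolD, totalD, xi_zero, xi_one, xi_two]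
    simp (maxDischargeDepth := 10) [ha, hb]
    simp only [prol_000, prol_001 ha hb]
    field_simp
    ring
  · rw [key 0 2 _ _ (by simp (maxDischargeDepth := 10)) h1 c2]
    simp only [z00, c1 θ hθ, c2 θ hθ, prolD, totalD, xi_zero, xi_one, xi_two]
    simp (maxDischargeDepth := 10) [ha, hb]
    simp only [prol_000, prol_010 ha hb, prol_001 ha hb]
    field_simp
    ring
  · simp only [z10, z11, c3 θ hθ, prolD, totalD, xi_zero, xi_one, xi_two]
    simp (maxDischargeDepth := 10) [ha, hb]
  · simp only [z10, z11, c3 θ hθ, prolD, totalD, xi_zero, xi_one, xi_two]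
    simp (maxDischargeDepth := 10) [ha, hb]
  · rw [key 1 2 _ _ (by simp (maxDischargeDepth := 10)) h0 c3]
    simp only [z10, z11, c3 θ hθ, prolD, totalD, xi_zero, xi_one, xi_two]
    simp (maxDischargeDepth := 10) [ha, hb]
    simp only [prol_000, prol_001 ha hb]
    field_simp
    ring
  · simp only [z20, c4 θ hθ, c5 θ hθ, prolD, totalD, xi_zero, xi_one, xi_two]
    simp (maxDischargeDepth := 10) [ha, hb]
    simp only [prol_000]
    ring
  · rw [key 2 1 _ _ (by simp (maxDischargeDepth := 10)) h0 c4]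
    simp only [z20, c4 θ hθ, c5 θ hθ, prolD, totalD, xi_zero, xi_one, xi_two]
    simp (maxDischargeDepth := 10) [ha, hb]
    simp only [prol_000, prol_001 ha hb]
    field_simp
    ring
  · rw [key 2 2 _ _ (by simp (maxDischargeDepth := 10)) h2 c5]
    simp only [z20, c4 θ hθ, c5 θ hθ, prolD, totalD, xi_zero, xi_one, xi_two]
    simp (maxDischargeDepth := 10) [ha, hb]
    simp only [prol_000, prol_100 ha hb, prol_010 ha hb, prol_001 ha hb, prol_101 ha hb, prol_011 ha hb, prol_002 ha hb]
    field_simp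
    ring

theorem smoothOn_J : SmoothOn 2 regJet J :=
  (((smoothOn_fd (by simp)).pow 2).mul (smoothOn_fd (by simp))).div
    (((smoothOn_u₁.mul (smoothOn_fd (by simp))).sub (smoothOn_fd (by simp))).mul
      ((smoothOn_fd (by simp)).pow 2))
    fun _ hθ => mul_ne_zero hθ.2.2.2 (pow_ne_zero 2 hθ.2.1)

/-- Numerator and denominator of J are relative invariants of the same weight 3a' - 2b_u -
3f_{u₁}b_x. -/
theorem prolD_J (ha : ContDiff ℝ ∞ a) (hb : ContDiff ℝ ∞ b) {θ : JetInf} (hθ : θ ∈ regJet) :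
    prolD a b J θ = 0 := by
  obtain ⟨hf, hz, hzz, hw⟩ := id hθ
  have h := smoothOn_J.lineDeriv_div isOpen_regJet
    (F := fun θ => fd 0 0 0 θ ^ 2 * fd 0 0 2 θ)
    (G := fun θ => (u₁ θ * fd 0 0 1 θ - fd 0 0 0 θ) * fd 0 0 1 θ ^ 2)
    (by simp (maxDischargeDepth := 10))
    (fun _ hθ => mul_ne_zero hθ.2.2.2 (pow_ne_zero 2 hθ.2.1)) (fun _ _ => rfl) hθ (prol a b θ)
  rw [prolD, h]
  simp (maxDischargeDepth := 10) only [Smooth.lineDeriv_sub, Smooth.lineDeriv_mul,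
    Smooth.lineDeriv_sq, Smooth.sub, Smooth.mul, Smooth.sq, smooth_fd, smooth_u₁,
    lineDeriv_fd_prol, lineDeriv_u₁_prol, prol_000, prol_001 ha hb, prol_002 ha hb]
  rw [div_eq_zero_iff]
  left
  ring

/-- The numerator of `K`, for the denominator `f f_{u₁}² f_{u₁u₁}²`. -/
def numK (θ : JetInf) : ℝ :=
  fd 0 0 0 θ * fd 0 0 1 θ * (-fd 0 0 0 θ * fd 0 1 0 θ * fd 1 0 1 θ * fd 0 0 3 θ - u₁ θ *
    fd 0 1 0 θ * fd 0 1 1 θ * fd 0 0 3 θ + fd 0 1 0 θ ^ 2 * fd 0 0 3 θ) + fd 0 0 1 θ ^ 2 * (u₁ θ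
    * (fd 0 1 0 θ * fd 0 0 1 θ * fd 0 1 2 θ - fd 0 1 0 θ ^ 2 * fd 0 0 3 θ - fd 1 0 0 θ *
    fd 0 1 0 θ * fd 0 0 1 θ * fd 0 0 3 θ + fd 1 0 0 θ * fd 0 0 1 θ ^ 2 * fd 0 1 2 θ) + u₁ θ ^ 2
    * fd 0 1 1 θ * (-fd 0 0 1 θ * fd 0 1 2 θ + fd 0 1 0 θ * fd 0 0 3 θ)) + fd 0 0 0 θ *
    fd 0 0 1 θ ^ 2 * (fd 0 0 0 θ * fd 1 0 1 θ * fd 0 1 2 θ + fd 1 0 0 θ * fd 0 1 0 θ *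
    fd 0 0 3 θ - fd 0 1 0 θ * fd 0 1 2 θ - fd 1 0 0 θ * fd 0 0 1 θ * fd 0 1 2 θ + u₁ θ *
    (fd 0 1 0 θ * fd 1 0 1 θ * fd 0 0 3 θ - fd 0 0 1 θ * fd 1 0 1 θ * fd 0 1 2 θ + fd 0 1 1 θ *
    fd 0 1 2 θ)) + fd 0 0 2 θ * (fd 0 0 1 θ ^ 2 * (-u₁ θ * (2 * fd 0 0 1 θ * fd 1 0 0 θ *
    fd 0 1 1 θ - fd 0 0 1 θ * fd 0 1 0 θ * fd 1 0 1 θ + fd 0 1 0 θ * fd 0 1 1 θ + fd 0 0 1 θ *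
    fd 0 2 0 θ + fd 0 0 1 θ ^ 2 * fd 1 1 0 θ) + u₁ θ ^ 2 * (fd 0 0 1 θ * fd 0 2 1 θ - fd 0 1 0 θ
    * fd 0 1 2 θ + fd 0 1 1 θ ^ 2)) + fd 0 0 0 θ * fd 0 0 1 θ * (fd 0 0 0 θ * fd 0 1 0 θ *
    fd 1 0 2 θ - fd 0 0 0 θ * fd 1 0 1 θ * fd 0 1 1 θ + fd 0 1 0 θ * fd 0 1 1 θ + u₁ θ *
    (fd 0 1 0 θ * fd 0 1 2 θ - fd 0 1 1 θ ^ 2)) + fd 0 0 0 θ * fd 0 0 1 θ ^ 2 * (fd 0 2 0 θ -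
    fd 0 1 0 θ * fd 1 0 1 θ + 2 * fd 1 0 0 θ * fd 0 1 1 θ + fd 0 0 1 θ * fd 1 1 0 θ - fd 0 0 0 θ
    * fd 1 1 1 θ + u₁ θ * (fd 0 0 1 θ * fd 1 1 1 θ - fd 0 2 1 θ + fd 1 0 1 θ * fd 0 1 1 θ -
    fd 0 1 0 θ * fd 1 0 2 θ))) + fd 0 0 2 θ ^ 2 * (-u₁ θ * fd 1 1 0 θ * fd 0 0 0 θ *
    fd 0 0 1 θ ^ 2 + 2 * u₁ θ * fd 0 1 0 θ ^ 2 * fd 0 0 1 θ - 2 * fd 0 1 0 θ ^ 2 * fd 0 0 0 θ +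
    (fd 0 2 0 θ * u₁ θ - 2 * fd 0 1 0 θ * fd 1 0 0 θ + fd 0 0 0 θ * fd 1 1 0 θ) * fd 0 0 0 θ *
    fd 0 0 1 θ - u₁ θ * (fd 0 2 0 θ * u₁ θ - 2 * fd 0 1 0 θ * fd 1 0 0 θ) * fd 0 0 1 θ ^ 2)

theorem K_eq {θ : JetInf} (hθ : θ ∈ regJet) :
    K θ = numK θ / (fd 0 0 0 θ * fd 0 0 1 θ ^ 2 * fd 0 0 2 θ ^ 2) := by
  obtain ⟨hf, hz, hzz, hw⟩ := id hθ
  simp only [K, numK]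
  field_simp
  ring

theorem smoothOn_numK {U : Set JetInf} : SmoothOn 3 U numK := by
  unfold numK
  simp (maxDischargeDepth := 60) [SmoothOn.add, SmoothOn.sub, SmoothOn.mul, SmoothOn.neg,
    SmoothOn.pow, smoothOn_const, smoothOn_u₁, smoothOn_fd]

/-- The weight found here is also that of f f_{u₁}² f_{u₁u₁}², the denominator of K, which is why K
is invariant. As `numK` is polynomial, regularity plays no role. -/
theorem prolD_numK (ha : ContDiff ℝ ∞ a) (hb : ContDiff ℝ ∞ b) (θ : JetInf) :
    prolD a b numK θ =
      (5 * aJet a 1 θ - 6 * bJet b 0 1 θ - 8 * fd 0 0 1 θ * bJet b 1 0 θ) * numK θ := by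
  unfold numK prolD
  simp (maxDischargeDepth := 60) only [Smooth.lineDeriv_sub, Smooth.lineDeriv_mul,
    Smooth.lineDeriv_add, lineDeriv_fun_neg, Smooth.neg, lineDeriv_fun_const, smooth_const,
    Smooth.lineDeriv_sq, Smooth.sub, Smooth.mul, Smooth.sq, Smooth.add, smooth_fd, smooth_u₁,
    lineDeriv_fd_prol, lineDeriv_u₁_prol]
  simp only [prol_000, prol_100 ha hb, prol_010 ha hb, prol_001 ha hb, prol_110 ha hb,
    prol_020 ha hb, prol_101 ha hb, prol_011 ha hb, prol_002 ha hb, prol_111 ha hb,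
    prol_021 ha hb, prol_102 ha hb, prol_012 ha hb, prol_003 ha hb]
  ring

theorem smoothOn_K : SmoothOn 3 regJet K := by
  refine (SmoothOn.div smoothOn_numK (((smoothOn_fd (by simp)).mul
    ((smoothOn_fd (by simp)).pow 2)).mul ((smoothOn_fd (by simp)).pow 2)) ?_).congr
    fun θ hθ => K_eq hθ
  exact fun θ hθ => mul_ne_zero (mul_ne_zero hθ.1 (pow_ne_zero 2 hθ.2.1))
    (pow_ne_zero 2 hθ.2.2.1)

theorem prolD_K (ha : ContDiff ℝ ∞ a) (hb : ContDiff ℝ ∞ b) {θ : JetInf} (hθ : θ ∈ regJet) :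
    prolD a b K θ = 0 := by
  have h := smoothOn_K.lineDeriv_div isOpen_regJet (F := numK)
    (G := fun θ => fd 0 0 0 θ * fd 0 0 1 θ ^ 2 * fd 0 0 2 θ ^ 2)
    (by simp (maxDischargeDepth := 10))
    (fun θ hθ => mul_ne_zero (mul_ne_zero hθ.1 (pow_ne_zero 2 hθ.2.1))
      (pow_ne_zero 2 hθ.2.2.1)) (fun _ hθ => K_eq hθ) hθ (prol a b θ)
  have h' := prolD_numK ha hb θ
  rw [prolD] at h' ⊢
  rw [h, h']
  simp (maxDischargeDepth := 10) only [Smooth.lineDeriv_mul,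
    Smooth.lineDeriv_sq, Smooth.mul, Smooth.sq, smooth_fd,
    lineDeriv_fd_prol, prol_000, prol_001 ha hb, prol_002 ha hb]
  rw [div_eq_zero_iff]
  left
  ring

theorem smoothOn_nablaWord {k : ℕ} {F : JetInf → ℝ} (hF : SmoothOn k regJet F) (hk : 1 ≤ k)
    (w : List (Fin 3)) : SmoothOn (k + w.length) regJet (nablaWord w F) := by
  induction w with
  | nil => exact hF
  | cons i w ih =>
    -- The coefficients have order 2 and each ∇ raises the order by one; 1 ≤ k is what makes 2 ≤ k +
    -- |w| + 1.
    exact SmoothOn.derivation (k := k + w.length)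
      (fun j => (smoothOn_nablaCoeff i j).mono (by omega)) ih isOpen_regJet

theorem prolD_nablaWord {k : ℕ} {F : JetInf → ℝ} (hF : SmoothOn k regJet F) (hk : 1 ≤ k)
    (h : ∀ (a : ℝ → ℝ) (b : ℝ × ℝ → ℝ), ContDiff ℝ ∞ a → ContDiff ℝ ∞ b → ∀ θ ∈ regJet,
      prolD a b F θ = 0) (w : List (Fin 3)) (ha : ContDiff ℝ ∞ a) (hb : ContDiff ℝ ∞ b)
    {θ : JetInf} (hθ : θ ∈ regJet) : prolD a b (nablaWord w F) θ = 0 := by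
  induction w generalizing θ with
  | nil => exact h a b ha hb θ hθ
  | cons i w ih =>
    have h1 := SmoothOn.prolD_derivation (smoothOn_nablaCoeff i) (smoothOn_nablaWord hF hk w)
      isOpen_regJet ha hb hθ fun j => prolD_nablaCoeff ha hb i j hθ
    refine h1.trans (Finset.sum_eq_zero fun j _ => ?_)
    -- The induction hypothesis holds on the whole open set of regular jets, so it may be
    -- differentiated.
    have h2 : totalD j (prolD a b (nablaWord w F)) θ = 0 :=
      (lineDeriv_congr_of_eqOn isOpen_regJet hθ (G := fun _ => 0) (fun θ' hθ' => ih hθ') _).trans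
        (lineDeriv_fun_const _ _ _)
    rw [h2, mul_zero]

theorem isInvariant_of_smoothOn {k : ℕ} (hk : 2 ≤ k) {F : JetInf → ℝ} (hF : SmoothOn k regJet F)
    (h : ∀ (a : ℝ → ℝ) (b : ℝ × ℝ → ℝ), ContDiff ℝ ∞ a → ContDiff ℝ ∞ b → ∀ θ ∈ regJet,
      prolD a b F θ = 0) : IsInvariant k F := by
  obtain ⟨g, hg⟩ := hF
  refine ⟨g, ⟨fun p hp => ?_, fun a b ha hb θ hθ => ?_⟩, fun θ hθ => (hg θ hθ).2⟩
  · have := (hg (ext k p) hp).1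
    rw [proj_ext] at this
    exact this.contDiffWithinAt
  · have hθ' : θ ∈ regJet := (regular_ext_proj hk θ).1 hθ
    rw [← h a b ha hb θ hθ']
    exact lineDeriv_congr_of_eqOn isOpen_regJet hθ' (fun θ' h' => (hg θ' h').2.symm) _

theorem isInvariant_nablaWord_J (w : List (Fin 3)) :
    IsInvariant (2 + w.length) (nablaWord w J) :=
  isInvariant_of_smoothOn (by omega) (smoothOn_nablaWord smoothOn_J (by simp) w)
    fun _ _ ha hb _ hθ => prolD_nablaWord smoothOn_J (by simp)
      (fun _ _ ha hb _ hθ => prolD_J ha hb hθ) w ha hb hθ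

theorem isInvariant_nablaWord_K (w : List (Fin 3)) :
    IsInvariant (3 + w.length) (nablaWord w K) :=
  isInvariant_of_smoothOn (by omega) (smoothOn_nablaWord smoothOn_K (by simp) w)
    fun _ _ ha hb _ hθ => prolD_nablaWord smoothOn_K (by simp)
      (fun _ _ ha hb _ hθ => prolD_K ha hb hθ) w ha hb hθ

theorem isInvariantDerivation_nablaCoeff (i : Fin 3) :
    IsInvariantDerivation (nablaCoeff i) := by
  refine ⟨fun j => ?_, fun a b ha hb k W g hW hg θ hθ hθW => ?_⟩
  · obtain ⟨g, hg⟩ := smoothOn_nablaCoeff i j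
    refine ⟨2, le_rfl, g, fun p hp => ?_, fun θ hθ => (hg θ hθ).2⟩
    have := (hg (ext 2 p) hp).1
    rw [proj_ext] at this
    exact this.contDiffWithinAt
  · have hU : IsOpen (regJet ∩ proj k ⁻¹' W) :=
      isOpen_regJet.inter (hW.preimage (continuous_proj k))
    have hF : SmoothOn k (regJet ∩ proj k ⁻¹' W) fun θ' => g (proj k θ') :=
      ⟨g, fun θ' h' => ⟨hg.contDiffAt (hW.mem_nhds h'.2), rfl⟩⟩
    exact SmoothOn.prolD_derivation
      (fun j => (smoothOn_nablaCoeff i j).mono_set Set.inter_subset_left) hF hU ha hb ⟨hθ, hθW⟩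
      fun j => prolD_nablaCoeff ha hb i j hθ

end Invariance

/-! ### Symbols of the invariants -/

theorem MIdx.induction {P : MIdx → Prop} (h0 : P 0)
    (h : ∀ σ i, P σ → P (σ + Pi.single i 1)) (σ : MIdx) : P σ := by
  suffices ∀ n, ∀ σ : MIdx, ∑ i, σ i = n → P σ from this _ σ rfl
  intro n
  induction n with
  | zero =>
    intro σ hσ
    have : σ = 0 := by
      funext i
      exact Finset.sum_eq_zero_iff.1 hσ i (Finset.mem_univ i)
    rwa [this]
  | succ n ih =>
    intro σ hσ
    obtain ⟨i, hi⟩ : ∃ i, 0 < σ i := by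
      by_contra! hcon
      have : ∑ i, σ i = 0 := Finset.sum_eq_zero fun i _ => Nat.le_zero.1 (hcon i)
      omega
    have hle : (Pi.single i 1 : MIdx) ≤ σ := by
      intro j
      by_cases hj : j = i
      · subst hj; rw [Pi.single_eq_same]; exact hi
      · simp [hj]
    have he : σ - Pi.single i 1 + Pi.single i 1 = σ := tsub_add_cancel_of_le hle
    rw [← he]
    refine h _ _ (ih _ ?_)
    rw [← he, sum_add_single] at hσ
    omega

section Symbol

variable {k : ℕ} {U : Set JetInf} {F : JetInf → ℝ}

theorem SmoothOn.lineDeriv_eq_zero (hF : SmoothOn k U F) (hU : IsOpen U) {θ : JetInf}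
    (hθ : θ ∈ U) {v : JetInf} (h : proj k v = 0) : lineDeriv ℝ F θ v = 0 := by
  rw [hF.lineDeriv_congr_vec hU hθ (w := 0) h, lineDeriv_zero]

theorem proj_vertical_eq_zero {v : MIdx → ℝ} (hv : ∀ σ : MIdx, ∑ i, σ i ≤ k → v σ = 0) :
    proj k ((0, v) : JetInf) = 0 :=
  Prod.ext rfl (funext fun σ => hv σ (mem_multiIdx.1 σ.2))

/-- In D_j F the coordinates of order above `k` occur only as the factors f_{σ+1_j} of ∂F/∂f_σ. A
vertical vector without components of order ≤ k therefore meets D_j F through its contraction by 1_j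
alone. -/
theorem SmoothOn.lineDeriv_totalD_vertical (hF : SmoothOn k U F) (hU : IsOpen U) {θ : JetInf}
    (hθ : θ ∈ U) {v : MIdx → ℝ} (hv : ∀ σ : MIdx, ∑ i, σ i ≤ k → v σ = 0) (j : Fin 3) :
    lineDeriv ℝ (Feedback.totalD j F) θ (0, v) =
      lineDeriv ℝ F θ (0, fun σ => v (σ + Pi.single j 1)) := by
  obtain ⟨g, hg⟩ := hF
  refine (hasDerivAt_lineDeriv_field (smoothField_totalVec U j) hU hg hθ (0, v)).trans ?_
  rw [(hasLineDerivAt_of_eq hU hθ (fun θ hθ => (hg θ hθ).2) (hg θ hθ).1 _).lineDeriv,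
    proj_vertical_eq_zero hv, map_zero, zero_apply, zero_add]
  simp only [totalVec_fst, lineDeriv_fun_const, totalVec_snd, lineDeriv_jet]
  rfl

/-- The coefficients have order ≤ k and are not affected by `v`; only the D_j F contribute. -/
theorem SmoothOn.lineDeriv_derivation_vertical {A : Fin 3 → JetInf → ℝ}
    (hA : ∀ j, SmoothOn k U (A j)) (hF : SmoothOn k U F) (hU : IsOpen U) {θ : JetInf}
    (hθ : θ ∈ U) {v : MIdx → ℝ} (hv : ∀ σ : MIdx, ∑ i, σ i ≤ k → v σ = 0) :
    lineDeriv ℝ (Feedback.derivation A F) θ (0, v) =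
      ∑ j, A j θ * lineDeriv ℝ F θ (0, fun σ => v (σ + Pi.single j 1)) := by
  have hD : ∀ j, SmoothOn (k + 1) U (Feedback.totalD j F) := fun j => hF.totalD hU j
  unfold Feedback.derivation
  rw [SmoothOn.lineDeriv_sum _ (fun j _ => ((hA j).mono (Nat.le_succ k)).mul (hD j)) hU hθ]
  refine Finset.sum_congr rfl fun j _ => ?_
  rw [(hA j).lineDeriv_mul (hD j) hU hθ, hF.lineDeriv_totalD_vertical hU hθ hv,
    (hA j).lineDeriv_eq_zero hU hθ (proj_vertical_eq_zero hv), zero_mul, zero_add]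

/-- At regular jets the derivations `∇₁, ∇₂, ∇₃` are linearly independent. -/
theorem eq_zero_of_nablaCoeff {θ : JetInf} (hθ : θ ∈ regJet) {x : Fin 3 → ℝ}
    (h : ∀ i, ∑ j, nablaCoeff i j θ * x j = 0) (j : Fin 3) : x j = 0 := by
  obtain ⟨hf, hz, hzz, hw⟩ := id hθ
  have h0 := h 0
  have h1 := h 1
  have h2 := h 2
  simp only [nablaCoeff, Fin.sum_univ_three, Matrix.cons_val] at h0 h1 h2
  have e2 : x 2 = 0 := by
    simpa [hf, hz] using h1
  have e1 : x 1 = 0 := by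
    simpa [hz, hw, e2] using h0
  have e0 : x 0 = 0 := by
    simpa [hf, e1, e2] using h2
  fin_cases j
  · exact e0
  · exact e1
  · exact e2

/-- If a vertical vector of order `k + n` annihilates all derivatives `∇_{i₁} ⋯ ∇_{i_n} F` of a
function `F` of order `k`, then all its contractions annihilate `F`. -/
theorem SmoothOn.lineDeriv_shift_eq_zero (hF : SmoothOn k regJet F) (hk : 2 ≤ k) {θ : JetInf}
    (hθ : θ ∈ regJet) (n : ℕ) {v : MIdx → ℝ} (hv : ∀ σ : MIdx, ∑ i, σ i < k + n → v σ = 0)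
    (h : ∀ w : List (Fin 3), w.length = n → lineDeriv ℝ (nablaWord w F) θ (0, v) = 0)
    (τ : MIdx) (hτ : ∑ i, τ i = n) : lineDeriv ℝ F θ (0, fun σ => v (σ + τ)) = 0 := by
  induction τ using MIdx.induction generalizing n v with
  | h0 =>
    have : n = 0 := by simpa using hτ.symm
    subst this
    simpa [nablaWord] using h [] rfl
  | h τ i ih =>
    rw [sum_add_single] at hτ
    subst hτ
    -- For a fixed word the three derivatives ∇_i of it give a homogeneous linear system for the
    -- contractions by 1_0, 1_1, 1_2, with the invertible matrix of the ∇'s. So each single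
    -- contraction satisfies the hypothesis for words one letter shorter.
    have key : ∀ w : List (Fin 3), w.length = ∑ i, τ i → ∀ j,
        lineDeriv ℝ (nablaWord w F) θ (0, fun σ => v (σ + Pi.single j 1)) = 0 := by
      intro w hw
      refine eq_zero_of_nablaCoeff hθ fun i => ?_
      have h1 := SmoothOn.lineDeriv_derivation_vertical (k := k + w.length)
        (fun j => (smoothOn_nablaCoeff i j).mono (by omega))
        (smoothOn_nablaWord hF (by omega) w) isOpen_regJet hθ (v := v)
        fun σ hσ => hv σ (by omega)
      rw [← h1]
      exact h (i :: w) (by simp [hw])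
    have := ih (∑ i, τ i) (v := fun σ => v (σ + Pi.single i 1))
      (fun σ hσ => hv _ (by rw [sum_add_single]; omega)) (fun w hw => key w hw i) rfl
    simpa only [add_assoc] using this

end Symbol

theorem lineDeriv_u₁_vertical (θ : JetInf) (v : MIdx → ℝ) : lineDeriv ℝ u₁ θ (0, v) = 0 :=
  lineDeriv_base 2 θ _

/-- The only second order coordinate in J is f_{u₁u₁}, which enters linearly with a coefficient that
is nonzero at regular jets. -/
theorem apply_eq_zero_of_lineDeriv_J {θ : JetInf} (hθ : θ ∈ regJet) {v : MIdx → ℝ}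
    (hv : ∀ σ : MIdx, ∑ i, σ i < 2 → v σ = 0) (h : lineDeriv ℝ J θ (0, v) = 0) :
    v ![0, 0, 2] = 0 := by
  obtain ⟨hf, hz, hzz, hw⟩ := id hθ
  have h0 : v ![0, 0, 0] = 0 := hv _ (by simp [Fin.sum_univ_three])
  have h1 : v ![0, 0, 1] = 0 := hv _ (by simp [Fin.sum_univ_three])
  rw [smoothOn_J.lineDeriv_div isOpen_regJet
    (F := fun θ => fd 0 0 0 θ ^ 2 * fd 0 0 2 θ)
    (G := fun θ => (u₁ θ * fd 0 0 1 θ - fd 0 0 0 θ) * fd 0 0 1 θ ^ 2)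
    (by simp (maxDischargeDepth := 10))
    (fun _ hθ => mul_ne_zero hθ.2.2.2 (pow_ne_zero 2 hθ.2.1)) (fun _ _ => rfl) hθ] at h
  simp (maxDischargeDepth := 10) only [Smooth.lineDeriv_sub, Smooth.lineDeriv_mul,
    Smooth.lineDeriv_sq, Smooth.sub, Smooth.mul, Smooth.sq, smooth_fd, smooth_u₁,
    lineDeriv_fd, lineDeriv_u₁_vertical, h0, h1] at h
  simpa [hf, hz, hw] using h

/-- `numK` is affine in the third order coordinates. Once the components with at least two
u₁-indices are gone, its symbol is f_{u₁}² f_{u₁u₁} (u₁ f_{u₁} - f) times the stated combination. -/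
theorem apply_eq_zero_of_lineDeriv_K {θ : JetInf} (hθ : θ ∈ regJet) {v : MIdx → ℝ}
    (hv : ∀ σ : MIdx, ∑ i, σ i < 3 → v σ = 0) (h102 : v ![1, 0, 2] = 0)
    (h012 : v ![0, 1, 2] = 0) (h003 : v ![0, 0, 3] = 0) (h : lineDeriv ℝ K θ (0, v) = 0) :
    u₁ θ * v ![0, 2, 1] + fd 0 0 0 θ * v ![1, 1, 1] = 0 := by
  obtain ⟨hf, hz, hzz, hw⟩ := id hθ
  have h' : ∀ i j l, i + j + l < 3 → v ![i, j, l] = 0 := fun i j l hl =>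
    hv _ (by simpa [Fin.sum_univ_three] using hl)
  rw [smoothOn_K.lineDeriv_div isOpen_regJet (F := numK)
    (G := fun θ => fd 0 0 0 θ * fd 0 0 1 θ ^ 2 * fd 0 0 2 θ ^ 2)
    (by simp (maxDischargeDepth := 10))
    (fun θ hθ => mul_ne_zero (mul_ne_zero hθ.1 (pow_ne_zero 2 hθ.2.1))
      (pow_ne_zero 2 hθ.2.2.1)) (fun _ hθ => K_eq hθ) hθ] at h
  unfold numK at h
  simp (maxDischargeDepth := 60) only [Smooth.lineDeriv_sub, Smooth.lineDeriv_mul,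
    Smooth.lineDeriv_add, lineDeriv_fun_neg, Smooth.neg, lineDeriv_fun_const, smooth_const,
    Smooth.lineDeriv_sq, Smooth.sub, Smooth.mul, Smooth.sq, Smooth.add, smooth_fd, smooth_u₁,
    lineDeriv_fd, lineDeriv_u₁_vertical, h102, h012, h003, h' 0 0 0 (by simp),
    h' 1 0 0 (by simp), h' 0 1 0 (by simp), h' 0 0 1 (by simp), h' 1 1 0 (by simp),
    h' 0 2 0 (by simp), h' 1 0 1 (by simp), h' 0 1 1 (by simp), h' 0 0 2 (by simp)] at h
  rw [div_eq_zero_iff, or_iff_left (by positivity)] at h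
  -- The prefactor is that of the symbol of `numK` times the denominator of K, which the quotient
  -- rule contributes.
  have h2 : (fd 0 0 0 θ * fd 0 0 1 θ ^ 4 * fd 0 0 2 θ ^ 3 * (u₁ θ * fd 0 0 1 θ - fd 0 0 0 θ)) *
      (u₁ θ * v ![0, 2, 1] + fd 0 0 0 θ * v ![1, 1, 1]) = 0 := by
    linear_combination h
  exact (mul_eq_zero.1 h2).resolve_left (by simp [hf, hz, hzz, hw])

/-! ### Top order vertical vectors annihilated by the invariants -/

section Annihilator

variable {θ : JetInf} {m : ℕ} {v : MIdx → ℝ}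

/-- Contraction by τ = σ - (0,0,2) reduces the claim to the symbol of J: the component of index
(0,0,2) of the contracted vector is `v σ`. -/
theorem apply_eq_zero_of_annihilates_J (hθ : θ ∈ regJet)
    (hv : ∀ σ : MIdx, ∑ i, σ i < m → v σ = 0)
    (hJ : ∀ w : List (Fin 3), w.length + 2 ≤ m → lineDeriv ℝ (nablaWord w J) θ (0, v) = 0)
    {σ : MIdx} (hσ : ∑ i, σ i = m) (h2 : 2 ≤ σ 2) : v σ = 0 := by
  set τ : MIdx := ![σ 0, σ 1, σ 2 - 2] with hτ
  have hs : ![0, 0, 2] + τ = σ := by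
    funext i
    fin_cases i <;> simp [hτ]
    omega
  have hm : ∑ i, τ i + 2 = m := by
    rw [← hσ]
    simp only [hτ, Fin.sum_univ_three, Matrix.cons_val]
    omega
  have h := smoothOn_J.lineDeriv_shift_eq_zero le_rfl hθ (∑ i, τ i) (v := v)
    (fun σ hσ => hv σ (by omega)) (fun w hw => hJ w (by omega)) τ rfl
  have := apply_eq_zero_of_lineDeriv_J hθ (v := fun σ => v (σ + τ)) (fun σ hσ => hv _ (by
    simp only [Pi.add_apply, Finset.sum_add_distrib]; omega)) h
  rwa [hs] at this

/-- The vector is contracted by (i, j, 0) and fed to the symbol of K. The remaining third order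
components seen by K have at least two u₁-indices and vanish because of J. -/
theorem relation_of_annihilates_K (hθ : θ ∈ regJet)
    (hv : ∀ σ : MIdx, ∑ i, σ i < m → v σ = 0)
    (hJ : ∀ w : List (Fin 3), w.length + 2 ≤ m → lineDeriv ℝ (nablaWord w J) θ (0, v) = 0)
    (hK : ∀ w : List (Fin 3), w.length + 3 ≤ m → lineDeriv ℝ (nablaWord w K) θ (0, v) = 0)
    {i j : ℕ} (hij : i + j + 3 = m) :
    u₁ θ * v ![i, j + 2, 1] + fd 0 0 0 θ * v ![i + 1, j + 1, 1] = 0 := by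
  have hτ : ∑ l, (![i, j, 0] : MIdx) l = i + j := by simp [Fin.sum_univ_three]
  have h := smoothOn_K.lineDeriv_shift_eq_zero (by simp) hθ (i + j) (v := v)
    (fun σ hσ => hv σ (by omega)) (fun w hw => hK w (by omega)) ![i, j, 0] hτ
  have hJ' : ∀ p q r, p + q + r = 3 → 2 ≤ r → v (![p, q, r] + ![i, j, 0]) = 0 := by
    intro p q r h3 hr
    refine apply_eq_zero_of_annihilates_J hθ hv hJ ?_ (by simpa using hr)
    simp [Fin.sum_univ_three]
    omega
  have := apply_eq_zero_of_lineDeriv_K hθ (v := fun σ => v (σ + ![i, j, 0]))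
    (fun σ hσ => hv _ (by simp only [Pi.add_apply, Finset.sum_add_distrib, hτ]; omega))
    (hJ' _ _ _ (by simp) le_rfl) (hJ' _ _ _ (by simp) le_rfl) (hJ' _ _ _ (by simp) (by simp)) h
  simpa [add_comm] using this

end Annihilator

/-! ### Homogeneous feedback vector fields -/

/-! ### Additivity of the prolongation -/

section Additivity

variable {F G : JetInf → ℝ}

theorem Smooth.totalDs_add (hF : Smooth F) (hG : Smooth G) (σ : MIdx) :
    Feedback.totalDs σ (fun θ => F θ + G θ) =
      fun θ => Feedback.totalDs σ F θ + Feedback.totalDs σ G θ := by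
  induction σ using MIdx.induction generalizing F G with
  | h0 => rfl
  | h σ i ih =>
    have h1 : Feedback.totalD i (fun θ => F θ + G θ) =
        fun θ => Feedback.totalD i F θ + Feedback.totalD i G θ :=
      funext fun θ => hF.lineDeriv_add hG θ _
    rw [(hF.add hG).totalDs_add_single', h1, ih (hF.totalD i) (hG.totalD i),
      hF.totalDs_add_single', hG.totalDs_add_single']

variable {a a' : ℝ → ℝ} {b b' : ℝ × ℝ → ℝ}

theorem xi_add (hb : ContDiff ℝ ∞ b) (hb' : ContDiff ℝ ∞ b') (θ : JetInf) :
    xi (a + a') (b + b') θ = xi a b θ + xi a' b' θ := by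
  have h1 : fderiv ℝ (b + b') (θ.1 0, θ.1 1) = _ := fderiv_add
    (hb.differentiable (by simp)).differentiableAt (hb'.differentiable (by simp)).differentiableAt
  funext i
  simp only [xi, h1]
  fin_cases i
  · simp
  · simp
  · simp
    ring

theorem prol_add (ha : ContDiff ℝ ∞ a) (hb : ContDiff ℝ ∞ b) (ha' : ContDiff ℝ ∞ a')
    (hb' : ContDiff ℝ ∞ b') (θ : JetInf) :
    prol (a + a') (b + b') θ = prol a b θ + prol a' b' θ := by
  refine Prod.ext ?_ (funext fun σ => ?_)
  · rw [Prod.fst_add, prol_fst, prol_fst, prol_fst, xi_add hb hb']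
  · have h : genFun (a + a') (b + b') = fun θ => genFun a b θ + genFun a' b' θ := by
      funext θ
      have h1 : deriv (a + a') (θ.1 0) = _ := deriv_add
        (ha.differentiable (by simp)).differentiableAt
        (ha'.differentiable (by simp)).differentiableAt
      simp only [genFun, h1, xi_add hb hb', Pi.add_apply]
      ring
    rw [Prod.snd_add, Pi.add_apply, prol_snd, prol_snd, prol_snd, h,
      (smooth_genFun ha hb).totalDs_add (smooth_genFun ha' hb'), xi_add hb hb']
    simp only [Pi.add_apply, add_mul, Finset.sum_add_distrib]
    ring

end Additivity

/-- The divided power `s ^ n / n!`. -/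
def dpow (n : ℕ) (s : ℝ) : ℝ := s ^ n / n.factorial

theorem dpow_zero (s : ℝ) : dpow 0 s = 1 := by simp [dpow]

theorem dpow_succ_zero (n : ℕ) : dpow (n + 1) 0 = 0 := by simp [dpow]

theorem contDiff_dpow (n : ℕ) : ContDiff ℝ ∞ (dpow n) := by
  unfold dpow; fun_prop

theorem hasDerivAt_dpow_succ (n : ℕ) (s : ℝ) : HasDerivAt (dpow (n + 1)) (dpow n s) s := by
  refine ((hasDerivAt_pow (n + 1) s).div_const _).congr_deriv ?_
  have : (n.factorial : ℝ) ≠ 0 := by positivity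
  rw [dpow, Nat.factorial_succ]
  push_cast
  field_simp

/-- The homogeneous polynomial of degree `m` centred at the point `q₀` with derivatives `c`. -/
def hom (q₀ : ℝ × ℝ) (m : ℕ) (c : ℕ → ℕ → ℝ) (q : ℝ × ℝ) : ℝ :=
  ∑ p ∈ Finset.HasAntidiagonal.antidiagonal m, c p.1 p.2 * (dpow p.1 (q.1 - q₀.1) * dpow p.2 (q.2 - q₀.2))

/-! ### Total derivatives of homogeneous polynomials in x and u -/

section Hom

variable (q₀ : ℝ × ℝ) (m : ℕ) (c : ℕ → ℕ → ℝ)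

theorem contDiff_hom : ContDiff ℝ ∞ (hom q₀ m c) := by
  unfold hom
  refine ContDiff.sum fun p _ => contDiff_const.mul (ContDiff.mul ?_ ?_)
  · exact (contDiff_dpow _).comp (contDiff_fst.sub contDiff_const)
  · exact (contDiff_dpow _).comp (contDiff_snd.sub contDiff_const)

theorem hom_zero : hom q₀ 0 c = fun _ => c 0 0 := by
  funext q
  simp [hom, dpow_zero]

theorem hom_succ_self : hom q₀ (m + 1) c q₀ = 0 := by
  refine Finset.sum_eq_zero fun p hp => ?_
  obtain ⟨i, j⟩ := p
  rw [Finset.HasAntidiagonal.mem_antidiagonal] at hp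
  rcases i with _ | i
  · rcases j with _ | j
    · simp at hp
    · simp [dpow_succ_zero]
  · simp [dpow_succ_zero]

theorem pdx_eq_deriv {b : ℝ × ℝ → ℝ} (hb : ContDiff ℝ ∞ b) (q : ℝ × ℝ) :
    HasDerivAt (fun s => b (s, q.2)) (pdx b q) q.1 := by
  have h1 : HasFDerivAt b (fderiv ℝ b q) (q.1, q.2) :=
    (hb.differentiable (by simp)).differentiableAt.hasFDerivAt
  exact h1.comp_hasDerivAt q.1 ((hasDerivAt_id q.1).prodMk (hasDerivAt_const q.1 q.2))

theorem pdu_eq_deriv {b : ℝ × ℝ → ℝ} (hb : ContDiff ℝ ∞ b) (q : ℝ × ℝ) :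
    HasDerivAt (fun s => b (q.1, s)) (pdu b q) q.2 := by
  have h1 : HasFDerivAt b (fderiv ℝ b q) (q.1, q.2) :=
    (hb.differentiable (by simp)).differentiableAt.hasFDerivAt
  exact h1.comp_hasDerivAt q.2 ((hasDerivAt_const q.2 q.1).prodMk (hasDerivAt_id q.2))

/-- With divided powers, differentiation merely shifts the coefficient array and lowers the degree
by one. -/
theorem pdx_hom_succ : pdx (hom q₀ (m + 1) c) = hom q₀ m (fun i j => c (i + 1) j) := by
  funext q
  refine (pdx_eq_deriv (contDiff_hom q₀ (m + 1) c) q).unique ?_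
  have h : ∀ s : ℝ, hom q₀ (m + 1) c (s, q.2) = c 0 (m + 1) * (1 * dpow (m + 1) (q.2 - q₀.2))
      + ∑ p ∈ Finset.HasAntidiagonal.antidiagonal m,
        c (p.1 + 1) p.2 * (dpow (p.1 + 1) (s - q₀.1) * dpow p.2 (q.2 - q₀.2)) := fun s => by
    rw [hom, Finset.Nat.sum_antidiagonal_succ, dpow_zero]
  simp only [h]
  refine (HasDerivAt.fun_sum fun p _ => ?_).const_add _
  refine HasDerivAt.const_mul _ (HasDerivAt.mul_const ?_ _)
  exact (hasDerivAt_dpow_succ _ _).comp_sub_const _ _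

theorem pdu_hom_succ : pdu (hom q₀ (m + 1) c) = hom q₀ m (fun i j => c i (j + 1)) := by
  funext q
  refine (pdu_eq_deriv (contDiff_hom q₀ (m + 1) c) q).unique ?_
  have h : ∀ s : ℝ, hom q₀ (m + 1) c (q.1, s) = c (m + 1) 0 * (dpow (m + 1) (q.1 - q₀.1) * 1)
      + ∑ p ∈ Finset.HasAntidiagonal.antidiagonal m,
        c p.1 (p.2 + 1) * (dpow p.1 (q.1 - q₀.1) * dpow (p.2 + 1) (s - q₀.2)) := fun s => by
    rw [hom, Finset.Nat.sum_antidiagonal_succ', dpow_zero, add_comm]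
  simp only [h]
  refine (HasDerivAt.fun_sum fun p _ => ?_).const_add _
  refine HasDerivAt.const_mul _ (HasDerivAt.const_mul _ ?_)
  exact (hasDerivAt_dpow_succ _ _).comp_sub_const _ _

/-- The homogeneous polynomial `hom q₀ m c` as a function on the space of infinite jets. -/
def homJet (θ : JetInf) : ℝ := hom q₀ m c (θ.1 0, θ.1 1)

@[simp] theorem smooth_homJet : Smooth (homJet q₀ m c) :=
  ⟨0, smoothOn_comp_xu (contDiff_hom q₀ m c)⟩

theorem totalD_zero_homJet_succ :
    totalD 0 (homJet q₀ (m + 1) c) = homJet q₀ m fun i j => c (i + 1) j := by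
  funext θ
  refine (lineDeriv_comp_xu (contDiff_hom q₀ (m + 1) c) θ _).trans ?_
  rw [homJet, ← pdx_hom_succ]
  simp [totalVec_fst, pdx]

theorem totalD_one_homJet_succ :
    totalD 1 (homJet q₀ (m + 1) c) = homJet q₀ m fun i j => c i (j + 1) := by
  funext θ
  refine (lineDeriv_comp_xu (contDiff_hom q₀ (m + 1) c) θ _).trans ?_
  rw [homJet, ← pdu_hom_succ]
  simp [totalVec_fst, pdu]

theorem totalD_two_homJet : totalD 2 (homJet q₀ m c) = fun _ => 0 := by
  funext θ
  refine (lineDeriv_comp_xu (contDiff_hom q₀ m c) θ _).trans ?_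
  simp [totalVec_fst, ← Prod.zero_eq_mk]

variable {q₀ m c} {G : JetInf → ℝ} {θ : JetInf}

/-- The polynomial vanishes to order `m` in (x, u) at the base point. Fewer than `m` derivatives in
x and u cannot remove this, and derivatives in u₁ do not act on it, so `σ 2` is arbitrary. -/
theorem totalDs_homJet_mul_of_lt (hθ : q₀ = (θ.1 0, θ.1 1)) (hG : Smooth G) (σ : MIdx)
    (h : σ 0 + σ 1 < m) : totalDs σ (fun θ => homJet q₀ m c θ * G θ) θ = 0 := by
  obtain ⟨m, rfl⟩ : ∃ n, m = n + 1 := ⟨m - 1, by omega⟩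
  induction σ using MIdx.induction generalizing m c G with
  | h0 =>
    change homJet q₀ (m + 1) c θ * G θ = 0
    rw [homJet, ← hθ, hom_succ_self, zero_mul]
  | h σ i ih =>
    have h1 : totalD i (fun θ => homJet q₀ (m + 1) c θ * G θ) =
        fun θ => totalD i (homJet q₀ (m + 1) c) θ * G θ + homJet q₀ (m + 1) c θ * totalD i G θ :=
      funext fun θ => (smooth_homJet q₀ (m + 1) c).lineDeriv_mul hG θ _
    rw [((smooth_homJet q₀ (m + 1) c).mul hG).totalDs_add_single', h1,
      (((smooth_homJet q₀ (m + 1) c).totalD i).mul hG).totalDs_add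
        ((smooth_homJet q₀ (m + 1) c).mul (hG.totalD i))]
    have h2 := ih (m := m) (c := c) (hG.totalD i) (by simp only [Pi.add_apply] at h; omega)
    beta_reduce
    rw [h2, add_zero]
    fin_cases i
    · simp only [Fin.zero_eta, totalD_zero_homJet_succ]
      rcases m with _ | m
      · simp at h
      · exact ih (m := m) hG (by simp at h; omega)
    · simp only [Fin.mk_one, totalD_one_homJet_succ]
      rcases m with _ | m
      · simp at h
      · exact ih (m := m) hG (by simp at h; omega)
    · simp only [Fin.reduceFinMk, totalD_two_homJet]
      -- The vanishing u₁-derivative is treated as a homogeneous polynomial with zero coefficients,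
      -- so that the induction hypothesis applies.
      have h3 := ih (m := m) (c := 0) hG (by simp at h; omega)
      have h4 : (fun θ => homJet q₀ (m + 1) 0 θ * G θ) = fun θ => 0 * G θ := by
        funext θ; simp [homJet, hom]
      rwa [h4] at h3

/-- To survive at the base point, all `m` derivatives in x and u must fall on the polynomial; the
u₁-derivatives are then left for `G`. -/
theorem totalDs_homJet_mul_of_eq (hθ : q₀ = (θ.1 0, θ.1 1)) (hG : Smooth G) (σ : MIdx)
    (h : σ 0 + σ 1 = m) :
    totalDs σ (fun θ => homJet q₀ m c θ * G θ) θ = c (σ 0) (σ 1) * (totalD 2)^[σ 2] G θ := by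
  induction σ using MIdx.induction generalizing m c G with
  | h0 =>
    have hm : m = 0 := by simpa using h.symm
    subst hm
    change homJet q₀ 0 c θ * G θ = _
    rw [homJet, hom_zero]
    rfl
  | h σ i ih =>
    have h1 : totalD i (fun θ => homJet q₀ m c θ * G θ) =
        fun θ => totalD i (homJet q₀ m c) θ * G θ + homJet q₀ m c θ * totalD i G θ :=
      funext fun θ => (smooth_homJet q₀ m c).lineDeriv_mul hG θ _
    rw [((smooth_homJet q₀ m c).mul hG).totalDs_add_single', h1,
      (((smooth_homJet q₀ m c).totalD i).mul hG).totalDs_add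
        ((smooth_homJet q₀ m c).mul (hG.totalD i))]
    beta_reduce
    fin_cases i
    · simp only [Fin.zero_eta, Pi.add_apply, Pi.single_eq_same] at h ⊢
      obtain ⟨m, rfl⟩ : ∃ n, m = n + 1 := ⟨m - 1, by omega⟩
      rw [totalD_zero_homJet_succ, ih hG (by simp at h; omega),
        totalDs_homJet_mul_of_lt hθ (hG.totalD 0) σ (by simp at h; omega)]
      simp
    · simp only [Fin.mk_one, Pi.add_apply, Pi.single_eq_same] at h ⊢
      obtain ⟨m, rfl⟩ : ∃ n, m = n + 1 := ⟨m - 1, by omega⟩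
      rw [totalD_one_homJet_succ, ih hG (by simp at h; omega),
        totalDs_homJet_mul_of_lt hθ (hG.totalD 1) σ (by simp at h; omega)]
      simp
    · simp only [Fin.reduceFinMk, Pi.add_apply, Pi.single_eq_same] at h ⊢
      have h2 : homJet q₀ m 0 = fun _ => 0 := by
        funext θ; simp [homJet, hom]
      have h3 := ih (c := 0) (m := m) hG (by simpa using h)
      rw [h2] at h3
      rw [totalD_two_homJet, h3, ih (hG.totalD 2) (by simpa using h)]
      simp [Function.iterate_succ_apply]

end Hom

/-! ### The vector fields which vanish to a given order -/

section TestField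

variable (θ : JetInf) (n : ℕ) (α : ℝ) (c : ℕ → ℕ → ℝ)

/-- The function `α (x - x₀)^(n+1) / (n+1)!`, where `x₀` is the value of `x` at `θ`. -/
def testA (s : ℝ) : ℝ := α * dpow (n + 1) (s - θ.1 0)

/-- The homogeneous polynomial of degree `n + 1` centred at the base point of `θ` with
derivatives `c`. -/
def testB : ℝ × ℝ → ℝ := hom (θ.1 0, θ.1 1) (n + 1) c

theorem contDiff_testA : ContDiff ℝ ∞ (testA θ n α) := by
  unfold testA
  exact contDiff_const.mul ((contDiff_dpow _).comp (contDiff_id.sub contDiff_const))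

theorem contDiff_testB : ContDiff ℝ ∞ (testB θ n c) := contDiff_hom _ _ _

/-- Powers of x - x₀ alone are put in the same form, so that a and b are handled by the same lemmas.
-/
theorem hom_single (q₀ q : ℝ × ℝ) (m : ℕ) :
    hom q₀ m (fun _ j => if j = 0 then α else 0) q = α * dpow m (q.1 - q₀.1) := by
  rw [hom, Finset.sum_eq_single (m, 0)]
  · simp [dpow_zero]
  · intro p hp hne
    have : p.2 ≠ 0 := by
      rintro h
      rw [Finset.HasAntidiagonal.mem_antidiagonal] at hp
      exact hne (Prod.ext (by simp only; omega) h)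
    simp [this]
  · simp

/-- The terms with a', b_u and b_x have a factor homogeneous of degree `n`, those with a and b one
of degree `n + 1`. Hence the last two do not contribute to derivatives with σ 0 + σ 1 ≤ n. -/
theorem genFun_test : genFun (testA θ n α) (testB θ n c) =
    let q₀ := (θ.1 0, θ.1 1)
    let δ : ℕ → ℕ → ℝ := fun _ j => if j = 0 then α else 0
    fun θ' => homJet q₀ n δ θ' * fd 0 0 0 θ'
      + (homJet q₀ n (fun i j => c i (j + 1)) θ' * (-(u₁ θ' * fd 0 0 1 θ'))
      + (homJet q₀ n (fun i j => c (i + 1) j) θ' * (-(fd 0 0 0 θ' * fd 0 0 1 θ'))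
      + (homJet q₀ (n + 1) δ θ' * (-fd 1 0 0 θ') + homJet q₀ (n + 1) c θ' * (-fd 0 1 0 θ')))) := by
  extract_lets q₀ δ
  funext θ'
  have h1 : deriv (testA θ n α) (θ'.1 0) = homJet q₀ n δ θ' := by
    rw [homJet, hom_single]
    exact (((hasDerivAt_dpow_succ n _).comp_sub_const _ _).const_mul α).deriv
  have h2 : testA θ n α (θ'.1 0) = homJet q₀ (n + 1) δ θ' := by
    rw [homJet, hom_single]; rfl
  have h3 : fderiv ℝ (testB θ n c) (θ'.1 0, θ'.1 1) (1, 0) =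
      homJet q₀ n (fun i j => c (i + 1) j) θ' := by
    rw [homJet, ← pdx_hom_succ]; rfl
  have h4 : fderiv ℝ (testB θ n c) (θ'.1 0, θ'.1 1) (0, 1) =
      homJet q₀ n (fun i j => c i (j + 1)) θ' := by
    rw [homJet, ← pdu_hom_succ]; rfl
  have h5 : testB θ n c (θ'.1 0, θ'.1 1) = homJet q₀ (n + 1) c θ' := rfl
  simp only [genFun, xi, Matrix.cons_val, h1, h2, h3, h4, h5]
  ring

theorem totalDs_genFun_test (σ : MIdx) (h : σ 0 + σ 1 ≤ n) :
    totalDs σ (genFun (testA θ n α) (testB θ n c)) θ =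
      if σ 0 + σ 1 = n then (if σ 1 = 0 then α else 0) * (totalD 2)^[σ 2] (fd 0 0 0) θ
        + c (σ 0) (σ 1 + 1) * (totalD 2)^[σ 2] (fun θ' => -(u₁ θ' * fd 0 0 1 θ')) θ
        + c (σ 0 + 1) (σ 1) * (totalD 2)^[σ 2] (fun θ' => -(fd 0 0 0 θ' * fd 0 0 1 θ')) θ
      else 0 := by
  have s1 : Smooth (fd 0 0 0) := smooth_fd 0 0 0
  have s2 : Smooth fun θ' => -(u₁ θ' * fd 0 0 1 θ') := (smooth_u₁.mul (smooth_fd 0 0 1)).neg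
  have s3 : Smooth fun θ' => -(fd 0 0 0 θ' * fd 0 0 1 θ') := (s1.mul (smooth_fd 0 0 1)).neg
  have s4 : Smooth fun θ' => -fd 1 0 0 θ' := (smooth_fd 1 0 0).neg
  have s5 : Smooth fun θ' => -fd 0 1 0 θ' := (smooth_fd 0 1 0).neg
  have t := smooth_homJet (θ.1 0, θ.1 1)
  rw [genFun_test]
  dsimp only
  rw [((t _ _).mul s1).totalDs_add (((t _ _).mul s2).add (((t _ _).mul s3).add
      (((t _ _).mul s4).add ((t _ _).mul s5)))),
    ((t _ _).mul s2).totalDs_add (((t _ _).mul s3).add (((t _ _).mul s4).add ((t _ _).mul s5))),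
    ((t _ _).mul s3).totalDs_add (((t _ _).mul s4).add ((t _ _).mul s5)),
    ((t _ _).mul s4).totalDs_add ((t _ _).mul s5)]
  dsimp only
  rw [totalDs_homJet_mul_of_lt rfl s4 σ (by omega), totalDs_homJet_mul_of_lt rfl s5 σ (by omega)]
  split_ifs with h1
  all_goals try rw [totalDs_homJet_mul_of_eq rfl s1 σ h1, totalDs_homJet_mul_of_eq rfl s2 σ h1,
    totalDs_homJet_mul_of_eq rfl s3 σ h1]
  · simp [*, add_assoc]
  · simp [*]
  · have h2 : σ 0 + σ 1 < n := by omega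
    rw [totalDs_homJet_mul_of_lt rfl s1 σ h2, totalDs_homJet_mul_of_lt rfl s2 σ h2,
      totalDs_homJet_mul_of_lt rfl s3 σ h2]
    simp

variable {θ n α c}

/-- For n ≥ 1 both b and its gradient vanish at the base point. For n = 0 the gradient does not, and
the hypothesis is exactly the vanishing of u₁ b_u + f b_x. -/
theorem xi_test (h : n = 0 → u₁ θ * c 0 1 + fd 0 0 0 θ * c 1 0 = 0) :
    xi (testA θ n α) (testB θ n c) θ = 0 := by
  have h1 : testA θ n α (θ.1 0) = 0 := by simp [testA, dpow_succ_zero]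
  have h2 : testB θ n c (θ.1 0, θ.1 1) = 0 := hom_succ_self _ _ _
  have h3 : fderiv ℝ (testB θ n c) (θ.1 0, θ.1 1) (1, 0) =
      hom (θ.1 0, θ.1 1) n (fun i j => c (i + 1) j) (θ.1 0, θ.1 1) := by
    rw [← pdx_hom_succ]; rfl
  have h4 : fderiv ℝ (testB θ n c) (θ.1 0, θ.1 1) (0, 1) =
      hom (θ.1 0, θ.1 1) n (fun i j => c i (j + 1)) (θ.1 0, θ.1 1) := by
    rw [← pdu_hom_succ]; rfl
  funext i
  simp only [xi, h1, h2, h3, h4, Pi.zero_apply]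
  fin_cases i
  · rfl
  · rfl
  · rcases n with _ | n
    · simpa [hom_zero] using h rfl
    · simp [hom_succ_self]

theorem prol_test_of_lt (h : n = 0 → u₁ θ * c 0 1 + fd 0 0 0 θ * c 1 0 = 0) {σ : MIdx}
    (hσ : σ 0 + σ 1 < n) : (prol (testA θ n α) (testB θ n c) θ).2 σ = 0 := by
  rw [prol_snd, xi_test h, totalDs_genFun_test _ _ _ _ _ hσ.le, if_neg hσ.ne]
  simp

theorem prol_test_zero (h : n = 0 → u₁ θ * c 0 1 + fd 0 0 0 θ * c 1 0 = 0) {σ : MIdx}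
    (hσ : σ 0 + σ 1 = n) (h2 : σ 2 = 0) : (prol (testA θ n α) (testB θ n c) θ).2 σ =
      (if σ 1 = 0 then α else 0) * fd 0 0 0 θ
        - fd 0 0 1 θ * (u₁ θ * c (σ 0) (σ 1 + 1) + fd 0 0 0 θ * c (σ 0 + 1) (σ 1)) := by
  rw [prol_snd, xi_test h, totalDs_genFun_test _ _ _ _ _ hσ.le, if_pos hσ, h2]
  simp only [Function.iterate_zero, id, Pi.zero_apply, zero_mul, Finset.sum_const_zero]
  ring

theorem prol_test_one (h : n = 0 → u₁ θ * c 0 1 + fd 0 0 0 θ * c 1 0 = 0) {σ : MIdx}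
    (hσ : σ 0 + σ 1 = n) (h2 : σ 2 = 1) : (prol (testA θ n α) (testB θ n c) θ).2 σ =
      (if σ 1 = 0 then α else 0) * fd 0 0 1 θ
        - c (σ 0) (σ 1 + 1) * (fd 0 0 1 θ + u₁ θ * fd 0 0 2 θ)
        - c (σ 0 + 1) (σ 1) * (fd 0 0 1 θ ^ 2 + fd 0 0 0 θ * fd 0 0 2 θ) := by
  rw [prol_snd, xi_test h, totalDs_genFun_test _ _ _ _ _ hσ.le, if_pos hσ, h2]
  simp (maxDischargeDepth := 10) only [Function.iterate_one, totalD, lineDeriv_fun_neg,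
    Smooth.lineDeriv_mul, smooth_u₁, smooth_fd, lineDeriv_u₁_totalVec, lineDeriv_fd_totalVec_two,
    Pi.zero_apply, zero_mul, Finset.sum_const_zero, if_true]
  ring

end TestField

/-! ### The common kernel of the invariants is tangent to the orbits -/

/-- With a and b affine in x, the values a, b, f b_x, a' f at the base point are arbitrary because f
≠ 0. -/
theorem exists_prol_base {θ : JetInf} (hf : fd 0 0 0 θ ≠ 0) (v : JetInf) :
    ∃ (a : ℝ → ℝ) (b : ℝ × ℝ → ℝ), ContDiff ℝ ∞ a ∧ ContDiff ℝ ∞ b ∧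
      proj 0 (prol a b θ) = proj 0 v := by
  have ha : ∀ s : ℝ, HasDerivAt (fun s => v.1 0 + v.2 0 / fd 0 0 0 θ * (s - θ.1 0))
      (v.2 0 / fd 0 0 0 θ) s := fun s => by
    simpa using (((hasDerivAt_id s).sub_const (θ.1 0)).const_mul (v.2 0 / fd 0 0 0 θ)).const_add
      (v.1 0)
  have hb : ∀ q : ℝ × ℝ, HasFDerivAt
      (fun q : ℝ × ℝ => v.1 1 + v.1 2 / fd 0 0 0 θ * (q.1 - θ.1 0))
      ((v.1 2 / fd 0 0 0 θ) • ContinuousLinearMap.fst ℝ ℝ ℝ) q := fun q => by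
    simpa using ((hasFDerivAt_fst.sub_const (θ.1 0)).const_mul
      (v.1 2 / fd 0 0 0 θ)).const_add (v.1 1)
  refine ⟨fun s => v.1 0 + v.2 0 / fd 0 0 0 θ * (s - θ.1 0),
    fun q => v.1 1 + v.1 2 / fd 0 0 0 θ * (q.1 - θ.1 0), by fun_prop, by fun_prop,
    Prod.ext ?_ ?_⟩
  · change (prol _ _ θ).1 = v.1
    rw [prol_fst]
    funext i
    simp only [xi, (hb _).fderiv]
    fin_cases i
    · simp
    · simp
    · simp [mul_div_cancel₀, hf]
  · funext σ
    change (prol _ _ θ).2 σ = v.2 σ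
    have hσ : (σ : MIdx) = 0 := by
      funext i
      exact Finset.sum_eq_zero_iff.1 (Nat.le_zero.1 (mem_multiIdx.1 σ.2)) i (Finset.mem_univ i)
    have h0 : fd 0 0 0 θ = θ.2 0 := by
      have h : (![0, 0, 0] : MIdx) = 0 := by ext i; fin_cases i <;> rfl
      rw [fd, h]
    rw [hσ, prol_zero, (ha _).deriv, h0, div_mul_cancel₀ _ (h0 ▸ hf)]

variable {θ : JetInf} {m : ℕ} {v : MIdx → ℝ}

/-- The components of order `m + 1` with index `(i, j, 1)` of a vertical vector annihilated by the
invariants are determined by two of them. -/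
theorem apply_one_eq
    (h : ∀ i j, i + j + 2 = m →
      u₁ θ * v ![i, j + 2, 1] + fd 0 0 0 θ * v ![i + 1, j + 1, 1] = 0) (p q : ℕ)
    (hpq : p + q + 1 = m) :
    v ![p, q + 1, 1] * (-fd 0 0 0 θ) ^ p = u₁ θ ^ p * v ![0, m, 1] := by
  induction p generalizing q with
  | zero =>
    obtain rfl : q + 1 = m := by omega
    simp
  | succ p ih =>
    have h1 := ih (q + 1) (by omega)
    have h2 := h p q (by omega)
    rw [pow_succ, pow_succ]
    linear_combination (u₁ θ) * h1 - (-fd 0 0 0 θ) ^ p * h2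

/-- The relation leaves free only the components (0, m, 1) and (m, 0, 1). The parameters β and α
below match these, within the fields of degree m + 1 that have no components with σ 0 + σ 1 = m, σ 2
= 0. -/
theorem exists_prol_apply_one (hθ : θ ∈ regJet)
    (h : ∀ i j, i + j + 2 = m →
      u₁ θ * v ![i, j + 2, 1] + fd 0 0 0 θ * v ![i + 1, j + 1, 1] = 0) :
    ∃ (a : ℝ → ℝ) (b : ℝ × ℝ → ℝ), ContDiff ℝ ∞ a ∧ ContDiff ℝ ∞ b ∧
      (prol a b θ).1 = 0 ∧ (∀ σ, σ 0 + σ 1 < m → (prol a b θ).2 σ = 0) ∧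
      (∀ σ, σ 0 + σ 1 = m → σ 2 = 0 → (prol a b θ).2 σ = 0) ∧
      (∀ σ, σ 0 + σ 1 = m → σ 2 = 1 → (prol a b θ).2 σ = v σ) := by
  obtain ⟨hf, hz, hzz, hw⟩ := id hθ
  set f := fd 0 0 0 θ with hfd
  set fz := fd 0 0 1 θ with hfz
  set fzz := fd 0 0 2 θ with hfzz
  set z := u₁ θ with hzd
  have hf' : -f ≠ 0 := neg_ne_zero.2 hf
  have hw' : fz * z - f ≠ 0 := by rwa [mul_comm]
  -- β is solved from the component (0, m, 1); for m > 0 the α-terms do not enter it.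
  set β : ℝ := -v ![0, m, 1] / ((-f) ^ m * fz * (z * fz - f)) with hβ
  -- For m > 0, α is solved from the component (m, 0, 1) with β known. For m = 0 both components
  -- coincide, and α = 0 is also what keeps the base components zero.
  set α : ℝ := if m = 0 then 0 else
    -(v ![m, 0, 1] + β * z ^ m * fz * (z * fz - f)) * fz / (f * fzz) with hα
  -- The β-part solves z c_{p,q+1} + f c_{p+1,q} = 0, so it produces no components with σ 2 = 0; the
  -- part α / fz cancels the contribution α f of a'.
  set c : ℕ → ℕ → ℝ := fun p q => (if q = 0 then α / fz else 0) + β * z ^ p * (-f) ^ q with hc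
  have hξ : m = 0 → z * c 0 1 + f * c 1 0 = 0 := by
    intro h0
    simp only [hc, hα, h0]
    simp
    ring
  refine ⟨testA θ m α, testB θ m c, contDiff_testA θ m α, contDiff_testB θ m c, ?_,
    fun σ hσ => prol_test_of_lt hξ hσ, fun σ hσ h2 => ?_, fun σ hσ h2 => ?_⟩
  · rw [prol_fst, xi_test hξ]
  · rw [prol_test_zero hξ hσ h2]
    simp only [hc, Nat.add_eq_zero_iff, one_ne_zero, and_false, if_false, ← hfd, ← hfz, ← hzd]
    split_ifs
    · field_simp
      ring
    · ring
  · rw [prol_test_one hξ hσ h2]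
    have hs : σ = ![σ 0, σ 1, 1] := by
      funext i; fin_cases i <;> simp [h2]
    rw [hs]
    simp only [hc, Nat.add_eq_zero_iff, one_ne_zero, and_false, if_false, ← hfd, ← hfz, ← hzd,
      ← hfzz, Matrix.cons_val]
    generalize σ 0 = p at hσ ⊢
    generalize σ 1 = q at hσ ⊢
    rcases q with _ | q
    · obtain rfl : p = m := by omega
      simp only [if_true, zero_add, pow_one, pow_zero, mul_one]
      rcases p with _ | p
      · simp only [hα, if_true, hβ]
        field_simp
        ring
      · simp only [hα, Nat.add_eq_zero_iff, one_ne_zero, and_false, if_false]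
        field_simp
        ring
    · have h1 := apply_one_eq h p q (by omega)
      have h3 : v ![p, q + 1, 1] = z ^ p * v ![0, m, 1] / (-f) ^ p := by
        rw [eq_div_iff (pow_ne_zero _ hf'), h1]
      rw [h3]
      simp only [Nat.add_eq_zero_iff, one_ne_zero, and_false, if_false, hβ]
      obtain rfl : m = p + (q + 1) := by omega
      generalize v ![0, p + (q + 1), 1] = x
      rw [pow_add (-f) p (q + 1)]
      have e1 := pow_ne_zero p hf'
      have e2 := pow_ne_zero (q + 1) hf'
      have e3 : (-f) ^ (q + 1 + 1) = (-f) ^ (q + 1) * (-f) := pow_succ _ _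
      have e4 : z ^ (p + 1) = z ^ p * z := pow_succ _ _
      rw [e3, e4]
      generalize (-f) ^ p = X at e1 ⊢
      generalize (-f) ^ (q + 1) = Y at e2 ⊢
      generalize z ^ p = Z
      field_simp
      ring

/-- A solution of the recursion `f c (p + 1) q + z c p (q + 1) = g p q`. -/
def solveRec (f z : ℝ) (g : ℕ → ℕ → ℝ) : ℕ → ℕ → ℝ
  | 0, _ => 0
  | p + 1, q => (g p q - z * solveRec f z g p (q + 1)) / f

/-- With a = 0 the requirement is -f_{u₁} (u₁ c_{p,q+1} + f c_{p+1,q}) = v_{p,q,0}. As f and f_{u₁}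
do not vanish, it is solved recursively in p from c_{0,q} = 0. -/
theorem exists_prol_apply_zero (hf : fd 0 0 0 θ ≠ 0) (hz : fd 0 0 1 θ ≠ 0) (hm : 0 < m) :
    ∃ (a : ℝ → ℝ) (b : ℝ × ℝ → ℝ), ContDiff ℝ ∞ a ∧ ContDiff ℝ ∞ b ∧
      (prol a b θ).1 = 0 ∧ (∀ σ, σ 0 + σ 1 < m → (prol a b θ).2 σ = 0) ∧
      (∀ σ, σ 0 + σ 1 = m → σ 2 = 0 → (prol a b θ).2 σ = v σ) := by
  set c := solveRec (fd 0 0 0 θ) (u₁ θ) fun p q => -v ![p, q, 0] / fd 0 0 1 θ with hc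
  have hξ : m = 0 → u₁ θ * c 0 1 + fd 0 0 0 θ * c 1 0 = 0 := fun h => absurd h hm.ne'
  refine ⟨testA θ m 0, testB θ m c, contDiff_testA θ m 0, contDiff_testB θ m c, ?_,
    fun σ hσ => prol_test_of_lt hξ hσ, fun σ hσ h2 => ?_⟩
  · rw [prol_fst, xi_test hξ]
  · rw [prol_test_zero hξ hσ h2]
    have hs : σ = ![σ 0, σ 1, 0] := by
      funext i; fin_cases i <;> simp [h2]
    have h3 : c (σ 0 + 1) (σ 1) =
      (-v ![σ 0, σ 1, 0] / fd 0 0 1 θ - u₁ θ * c (σ 0) (σ 1 + 1)) / fd 0 0 0 θ := rfl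
    rw [h3, ← hs]
    simp only [ite_self]
    field_simp
    ring

/-- At a regular jet, a vector which annihilates all the basic invariants of order `≤ k` is, up to
order `k`, the value of a prolonged feedback vector field. -/
theorem exists_prol_of_annihilates (hθ : θ ∈ regJet) (k : ℕ) (v : JetInf)
    (hJ : ∀ w : List (Fin 3), w.length + 2 ≤ k → lineDeriv ℝ (nablaWord w J) θ v = 0)
    (hK : ∀ w : List (Fin 3), w.length + 3 ≤ k → lineDeriv ℝ (nablaWord w K) θ v = 0) :
    ∃ (a : ℝ → ℝ) (b : ℝ × ℝ → ℝ), ContDiff ℝ ∞ a ∧ ContDiff ℝ ∞ b ∧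
      proj k (prol a b θ) = proj k v := by
  induction k with
  | zero => exact exists_prol_base hθ.1 v
  | succ k ih =>
    obtain ⟨a₁, b₁, ha₁, hb₁, h₁⟩ := ih (fun w hw => hJ w (by omega)) (fun w hw => hK w (by omega))
    have h₁' : (prol a₁ b₁ θ).1 = v.1 := congrArg (fun p : JetK k => p.1) h₁
    have h₁'' : ∀ σ : MIdx, ∑ i, σ i ≤ k → (prol a₁ b₁ θ).2 σ = v.2 σ := fun σ hσ =>
      congrFun (congrArg (fun p : JetK k => p.2) h₁) ⟨σ, mem_multiIdx.2 hσ⟩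
    -- The prolonged field is itself annihilated by the invariants, so the defect, vertical and
    -- purely of order k + 1, is still annihilated.
    have sub : ∀ {l : ℕ} {F : JetInf → ℝ}, SmoothOn l regJet F → prolD a₁ b₁ F θ = 0 →
        lineDeriv ℝ F θ v = 0 → lineDeriv ℝ F θ (0, v.2 - (prol a₁ b₁ θ).2) = 0 := by
      intro l F hF hp hv
      have h2 := hF.lineDeriv_add_vec isOpen_regJet hθ (prol a₁ b₁ θ)
        (0, v.2 - (prol a₁ b₁ θ).2)
      have h3 : prol a₁ b₁ θ + (0, v.2 - (prol a₁ b₁ θ).2) = v :=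
        Prod.ext (by simp [h₁']) (by simp)
      rw [h3, hv] at h2
      rw [prolD] at hp
      linarith
    set x : MIdx → ℝ := v.2 - (prol a₁ b₁ θ).2 with hx
    have hx0 : ∀ σ : MIdx, ∑ i, σ i < k + 1 → x σ = 0 := fun σ hσ => by
      rw [hx, Pi.sub_apply, h₁'' σ (by omega), sub_self]
    have hxJ : ∀ w : List (Fin 3), w.length + 2 ≤ k + 1 →
        lineDeriv ℝ (nablaWord w J) θ (0, x) = 0 := fun w hw =>
      sub (smoothOn_nablaWord smoothOn_J (by simp) w) (prolD_nablaWord smoothOn_J (by simp)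
        (fun _ _ ha hb _ hθ => prolD_J ha hb hθ) w ha₁ hb₁ hθ) (hJ w hw)
    have hxK : ∀ w : List (Fin 3), w.length + 3 ≤ k + 1 →
        lineDeriv ℝ (nablaWord w K) θ (0, x) = 0 := fun w hw =>
      sub (smoothOn_nablaWord smoothOn_K (by simp) w) (prolD_nablaWord smoothOn_K (by simp)
        (fun _ _ ha hb _ hθ => prolD_K ha hb hθ) w ha₁ hb₁ hθ) (hK w hw)
    -- Fields with a and b of degree k + 1 fix the components with σ 0 + σ 1 = k, σ 2 = 1, and keep
    -- those already correct.
    obtain ⟨a₂, b₂, ha₂, hb₂, h20, h21, h22, h23⟩ := exists_prol_apply_one (m := k) (v := x) hθ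
      fun i j hij => relation_of_annihilates_K hθ hx0 hxJ hxK (by omega)
    -- The previous field has uncontrolled components with σ 0 + σ 1 = k + 1. They are subtracted
    -- from the target, and one more degree for b leaves everything with σ 0 + σ 1 ≤ k untouched.
    obtain ⟨a₃, b₃, ha₃, hb₃, h30, h31, h32⟩ := exists_prol_apply_zero (m := k + 1)
      (v := x - (prol a₂ b₂ θ).2) hθ.1 hθ.2.1 (Nat.succ_pos k)
    have ha : ContDiff ℝ ∞ (a₂ + a₃) := ha₂.add ha₃
    have hb : ContDiff ℝ ∞ (b₂ + b₃) := hb₂.add hb₃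
    refine ⟨a₁ + (a₂ + a₃), b₁ + (b₂ + b₃), ha₁.add ha, hb₁.add hb, ?_⟩
    rw [prol_add ha₁ hb₁ ha hb, prol_add ha₂ hb₂ ha₃ hb₃]
    refine Prod.ext ?_ (funext fun σ => ?_)
    · change (prol a₁ b₁ θ).1 + ((prol a₂ b₂ θ).1 + (prol a₃ b₃ θ).1) = v.1
      rw [h₁', h20, h30, add_zero, add_zero]
    · change (prol a₁ b₁ θ).2 σ + ((prol a₂ b₂ θ).2 σ + (prol a₃ b₃ θ).2 σ) = v.2 σ
      obtain ⟨σ, hσ⟩ := σ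
      rw [mem_multiIdx] at hσ
      have hs : ∑ i, σ i = σ 0 + σ 1 + σ 2 := Fin.sum_univ_three _
      suffices (prol a₂ b₂ θ).2 σ + (prol a₃ b₃ θ).2 σ = x σ by
        rw [this, hx, Pi.sub_apply, add_sub_cancel]
      by_cases hlt : σ 0 + σ 1 < k + 1
      · rw [h31 σ hlt, add_zero]
        by_cases hlt' : σ 0 + σ 1 < k
        · rw [h21 σ hlt']
          by_cases ho : ∑ i, σ i < k + 1
          · exact (hx0 σ ho).symm
          · exact (apply_eq_zero_of_annihilates_J hθ hx0 hxJ (by omega) (by omega)).symm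
        · by_cases h2 : σ 2 = 0
          · rw [h22 σ (by omega) h2, hx0 σ (by omega)]
          · exact h23 σ (by omega) (by omega)
      · rw [h32 σ (by omega) (by omega), Pi.sub_apply, add_sub_cancel]

/-! ### Functions constant along the fibres of a submersion -/

section Factor

variable {E R : Type*} [NormedAddCommGroup E] [NormedSpace ℝ E] [FiniteDimensional ℝ E]
  [NormedAddCommGroup R] [NormedSpace ℝ R]

theorem exists_equiv_prod_ker (L : E →L[ℝ] R) (hL : Function.Surjective L) :
    ∃ (π : E →L[ℝ] L.ker) (e : E ≃L[ℝ] R × L.ker), (∀ v : L.ker, π v = v) ∧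
      (e : E →L[ℝ] R × L.ker) = L.prod π := by
  obtain ⟨π, hπ⟩ := Submodule.ClosedComplemented.of_finiteDimensional (𝕜 := ℝ) L.ker
  have hb : Function.Bijective (L.prod π : E →ₗ[ℝ] R × L.ker) := by
    constructor
    · refine (injective_iff_map_eq_zero _).2 fun v hv => ?_
      have h1 : L v = 0 := congrArg Prod.fst hv
      have h2 : π v = 0 := congrArg Prod.snd hv
      have h3 := hπ ⟨v, h1⟩
      rw [h2] at h3
      exact (congrArg Subtype.val h3).symm
    · rintro ⟨r, c⟩
      obtain ⟨v, rfl⟩ := hL r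
      have hz : ∀ w : L.ker, L w = 0 := fun w => w.2
      refine ⟨v + ((c - π v : L.ker) : E), Prod.ext ?_ ?_⟩
      · change L (v + ((c - π v : L.ker) : E)) = L v
        rw [map_add, hz, add_zero]
      · change π (v + ((c - π v : L.ker) : E)) = c
        rw [map_add, hπ, add_sub_cancel]
  refine ⟨π, (LinearEquiv.ofBijective _ hb).toContinuousLinearEquiv, hπ, ?_⟩
  ext v <;> rfl

/-- A derivative that is onto at `q`, completed by a projection to its kernel, is invertible.
Invertibility is an open condition, so one fixed projection serves near `q`. -/
theorem eventually_exists_equiv {G : E → R} {q : E} (hG : ContDiffAt ℝ ∞ G q)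
    (hs : Function.Surjective (fderiv ℝ G q)) :
    ∃ π : E →L[ℝ] (fderiv ℝ G q).ker, (∀ v : (fderiv ℝ G q).ker, π v = v) ∧
      ∀ᶠ x in 𝓝 q, ∃ e : E ≃L[ℝ] R × (fderiv ℝ G q).ker,
        (e : E →L[ℝ] R × (fderiv ℝ G q).ker) = (fderiv ℝ G x).prod π := by
  obtain ⟨π, e, hπ, he⟩ := exists_equiv_prod_ker (fderiv ℝ G q) hs
  refine ⟨π, hπ, ?_⟩
  have h1 : ContinuousAt (fderiv ℝ G) q :=
    (hG.fderiv_right (m := 0) (by simp)).continuousAt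
  have h2 : ContinuousAt (fun x => (fderiv ℝ G x).prod π) q :=
    (ContinuousLinearMap.prodₗᵢ (𝕜 := ℝ) ℝ).continuous.continuousAt.comp (h1.prodMk continuousAt_const)
  have h3 := h2.eventually_mem (he ▸ e.nhds)
  exact h3

/-- Although `hker` is assumed at `q` only, the fields span the kernel of dG nearby: fields forming
a basis of it at `q` have projections by π that stay independent, and the dimension of the kernel
does not change. -/
theorem eventually_fderiv_eq_zero {ι : Type*} {X : ι → E → E} {G : E → R} {g : E → ℝ} {q : E}
    (hG : ContDiffAt ℝ ∞ G q) (hs : Function.Surjective (fderiv ℝ G q))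
    (hX : ∀ i, ContinuousAt (X i) q) (hGX : ∀ᶠ x in 𝓝 q, ∀ i, fderiv ℝ G x (X i x) = 0)
    (hgX : ∀ᶠ x in 𝓝 q, ∀ i, fderiv ℝ g x (X i x) = 0)
    (hker : ∀ v, fderiv ℝ G q v = 0 → ∃ i, X i q = v) :
    ∀ᶠ x in 𝓝 q, ∀ v, fderiv ℝ G x v = 0 → fderiv ℝ g x v = 0 := by
  have hsplit := eventually_exists_equiv hG hs
  set C := (fderiv ℝ G q).ker with hC
  obtain ⟨π, hπ, he⟩ := hsplit
  let B := Module.finBasis ℝ C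
  choose i hi using fun j => hker (B j) (B j).2
  have hc : ContinuousAt (fun x j => π (X (i j) x)) q :=
    continuousAt_pi.2 fun j => π.continuous.continuousAt.comp (hX (i j))
  have hq : (fun j => π (X (i j) q)) = B := by
    funext j
    rw [hi, hπ]
  have hlin : ∀ᶠ x in 𝓝 q, LinearIndependent ℝ fun j => π (X (i j) x) :=
    hc.eventually_mem (isOpen_setOfPred_linearIndependent.mem_nhds (by
      change LinearIndependent ℝ fun j => π (X (i j) q)
      rw [hq]; exact B.linearIndependent))
  filter_upwards [he, hGX, hgX, hlin] with x ⟨e, hex⟩ h1 h2 h3 v hv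
  have htop := h3.span_eq_top_of_card_eq_finrank' (by simp)
  have hmem : π v ∈ Submodule.span ℝ (Set.range fun j => π (X (i j) x)) := by
    rw [htop]; trivial
  obtain ⟨s, hsum⟩ := (Submodule.mem_span_range_iff_exists_fun ℝ).1 hmem
  have hev : v = ∑ j, s j • X (i j) x := by
    apply e.injective
    have h4 : ∀ w, e w = (fderiv ℝ G x w, π w) := fun w => by
      change (e : E →L[ℝ] R × C) w = _
      rw [hex]; rfl
    rw [h4, h4, hv]
    refine Prod.ext ?_ ?_
    · simp [h1]
    · simp [← hsum]
  rw [hev]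
  simp [h2]

variable [FiniteDimensional ℝ R]

theorem contDiff_bump_mul {y₀ : R} (χ : ContDiffBump y₀) {Φ : R → ℝ}
    (hΦ : ∀ y ∈ Metric.closedBall y₀ χ.rOut, ContDiffAt ℝ ∞ Φ y) :
    ContDiff ℝ ∞ fun y => χ y * Φ y := by
  rw [contDiff_iff_contDiffAt]
  intro y
  by_cases hy : y ∈ Metric.closedBall y₀ χ.rOut
  · exact χ.contDiffAt.mul (hΦ y hy)
  · have h1 : (fun y => χ y * Φ y) =ᶠ[𝓝 y] fun _ => 0 := by
      filter_upwards [Metric.isClosed_closedBall.isOpen_compl.mem_nhds hy] with z hz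
      have : (χ : R → ℝ) z = 0 := χ.zero_of_le_dist (by
        rw [Set.mem_compl_iff, Metric.mem_closedBall, not_le] at hz
        exact hz.le)
      rw [this, zero_mul]
    exact contDiffAt_const.congr_of_eventuallyEq h1

/-- A function whose derivative vanishes on the kernels of the derivative of a submersion is
locally a smooth function of this submersion. -/
theorem exists_eventually_factor {G : E → R} {g : E → ℝ} {q : E}
    (hG : ∀ᶠ x in 𝓝 q, ContDiffAt ℝ ∞ G x) (hs : Function.Surjective (fderiv ℝ G q))
    (hg : ∀ᶠ x in 𝓝 q, ContDiffAt ℝ ∞ g x)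
    (hker : ∀ᶠ x in 𝓝 q, ∀ v, fderiv ℝ G x v = 0 → fderiv ℝ g x v = 0) :
    ∃ Φ : R → ℝ, ContDiff ℝ ∞ Φ ∧ ∀ᶠ x in 𝓝 q, g x = Φ (G x) := by
  have hsplit := eventually_exists_equiv hG.self_of_nhds hs
  set C := (fderiv ℝ G q).ker with hC
  obtain ⟨π, hπ, he⟩ := hsplit
  -- Adding π to G gives local coordinates in which G is the first component.
  set Ψ : E → R × C := fun x => (G x, π x) with hΨ
  have hΨd : ∀ᶠ x in 𝓝 q, ContDiffAt ℝ ∞ Ψ x ∧ ∃ e : E ≃L[ℝ] R × C,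
      HasFDerivAt Ψ (e : E →L[ℝ] R × C) x ∧ ∀ v, e v = (fderiv ℝ G x v, π v) := by
    filter_upwards [hG, he] with x hx ⟨e, hex⟩
    refine ⟨hx.prodMk π.contDiff.contDiffAt, e, ?_, fun v => ?_⟩
    · rw [hex]
      exact (hx.differentiableAt (by simp)).hasFDerivAt.prodMk π.hasFDerivAt
    · change (e : E →L[ℝ] R × C) v = _
      rw [hex]; rfl
  obtain ⟨hq, e, heq, -⟩ := hΨd.self_of_nhds
  let ψ := hq.toOpenPartialHomeomorph Ψ heq (by simp)
  have hψ : ∀ x, ψ x = Ψ x := fun x => rfl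
  have hqs : q ∈ ψ.source := hq.mem_toOpenPartialHomeomorph_source heq (by simp)
  have hqt : Ψ q ∈ ψ.target := hq.image_mem_toOpenPartialHomeomorph_target heq (by simp)
  have hinv : ψ.symm (Ψ q) = q := ψ.left_inv hqs
  have hcont : ContinuousAt ψ.symm (Ψ q) := ψ.continuousAt_symm hqt
  have htgt : ∀ᶠ y in 𝓝 (Ψ q), y ∈ ψ.target := ψ.open_target.mem_nhds hqt
  have hgood := htgt.and
    (hcont.eventually (by rw [hinv]; exact hΨd.and (hg.and hker)))
  obtain ⟨r, hr, hball⟩ := Metric.eventually_nhds_iff_ball.1 hgood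
  have hsm : ∀ y ∈ Metric.ball (Ψ q) r, ContDiffAt ℝ ∞ (fun y => g (ψ.symm y)) y := by
    intro y hy
    obtain ⟨ht, ⟨h1, e', h2, -⟩, h3, -⟩ := hball y hy
    exact h3.comp y (ψ.contDiffAt_symm ht h2 h1)
  have hmem : ∀ y c, y ∈ Metric.ball (G q) r → c ∈ Metric.ball (π q) r →
      (y, c) ∈ Metric.ball (Ψ q) r := by
    intro y c hy hc
    rw [← ball_prod_same]
    exact ⟨hy, hc⟩
  -- In these coordinates the derivative of g along the fibre vanishes, so g is constant on each
  -- slice, which is a ball.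
  have hconst : ∀ y ∈ Metric.ball (G q) r, ∀ c ∈ Metric.ball (π q) r,
      g (ψ.symm (y, c)) = g (ψ.symm (y, π q)) := by
    intro y hy c hc
    have hd : ∀ c ∈ Metric.ball (π q) r,
        HasFDerivAt (fun c => g (ψ.symm (y, c))) (0 : C →L[ℝ] ℝ) c := by
      intro c hc
      obtain ⟨ht, ⟨h1, e', h2, h2'⟩, h3, h4⟩ := hball (y, c) (hmem y c hy hc)
      have h5 : HasFDerivAt ψ.symm (e'.symm : R × C →L[ℝ] E) (y, c) :=
        ψ.hasFDerivAt_symm ht h2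
      have h6 := (h3.differentiableAt (by simp)).hasFDerivAt.comp (y, c) h5
      have h7 := h6.comp c (hasFDerivAt_prodMk_right y c)
      refine h7.congr_fderiv ?_
      ext w
      refine h4 (e'.symm (0, w)) ?_
      have h8 := h2' (e'.symm (0, w))
      rw [e'.apply_symm_apply] at h8
      exact (congrArg Prod.fst h8).symm
    exact Metric.isOpen_ball.is_const_of_fderiv_eq_zero (𝕜 := ℝ)
      (convex_ball _ _).isPreconnected
      (fun c hc => (hd c hc).differentiableAt.differentiableWithinAt)
      (fun c hc => (hd c hc).fderiv) hc (Metric.mem_ball_self hr)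
  -- The cutoff makes Φ smooth on all of `R`: it is 1 on the ball of radius r/4, where the formula
  -- is used, and supported where g ∘ ψ⁻¹ is smooth.
  let χ : ContDiffBump (G q) := ⟨r / 4, r / 2, by positivity, by linarith⟩
  refine ⟨fun y => χ y * g (ψ.symm (y, π q)), contDiff_bump_mul χ fun y hy => ?_, ?_⟩
  · have hy' : y ∈ Metric.ball (G q) r :=
      Metric.closedBall_subset_ball (by change r / 2 < r; linarith) hy
    exact ContDiffAt.comp (g := fun z => g (ψ.symm z)) (f := fun y => (y, π q)) y
      (hsm (y, π q) (hmem y _ hy' (Metric.mem_ball_self hr)))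
      (contDiffAt_id.prodMk contDiffAt_const)
  · have hGc : ContinuousAt G q := hG.self_of_nhds.continuousAt
    filter_upwards [ψ.open_source.mem_nhds hqs,
      hGc.eventually_mem (Metric.ball_mem_nhds (G q) (ε := r / 4) (by positivity)),
      π.continuous.continuousAt.eventually_mem (Metric.ball_mem_nhds (π q) hr)] with x hx h1 h2
    have h3 : χ (G x) = 1 := χ.one_of_mem_closedBall (Metric.ball_subset_closedBall h1)
    have h4 : ψ.symm (G x, π x) = x := ψ.left_inv hx
    rw [h3, one_mul, ← hconst (G x) (Metric.ball_subset_ball (by linarith) h1) (π x) h2, h4]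

end Factor

/-! ### First integrals of a family of vector fields -/

section FirstIntegral

variable {E A : Type*} [NormedAddCommGroup E] [NormedSpace ℝ E] [FiniteDimensional ℝ E]
  [NormedAddCommGroup A] [NormedSpace ℝ A]
  {ι : Type*} {X : ι → E → E} {W : Set E} {F : E → A} {g : E → ℝ}

/-- If at every point of `W` the vectors of the family `X` fill the kernel of the derivative
of `F`, then a first integral of `X` is locally a smooth function of a submersive part of `F`. -/
theorem exists_submersion_factor (hW : IsOpen W) (hF : ∀ x ∈ W, ContDiffAt ℝ ∞ F x)
    (hX : ∀ i, Continuous (X i)) (hFX : ∀ x ∈ W, ∀ i, fderiv ℝ F x (X i x) = 0)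
    (hker : ∀ x ∈ W, ∀ v, fderiv ℝ F x v = 0 → ∃ i, X i x = v)
    (hg : ∀ x ∈ W, ContDiffAt ℝ ∞ g x) (hgX : ∀ x ∈ W, ∀ i, fderiv ℝ g x (X i x) = 0)
    {q : E} (hq : q ∈ W) :
    ∃ (R : Submodule ℝ A) (P : A →L[ℝ] R) (Φ : R → ℝ),
      Function.Surjective (fderiv ℝ (fun x => P (F x)) q) ∧ ContDiff ℝ ∞ Φ ∧
        ∀ᶠ x in 𝓝 q, g x = Φ (P (F x)) := by
  -- The components of F may be dependent, so F is replaced by its projection to the range of dF at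
  -- `q`. This is onto at `q` and loses nothing of the kernel there.
  obtain ⟨P, hP⟩ := Submodule.ClosedComplemented.of_finiteDimensional (𝕜 := ℝ)
    (fderiv ℝ F q).range
  have hWq : ∀ᶠ x in 𝓝 q, x ∈ W := hW.mem_nhds hq
  have hd : ∀ x ∈ W, ∀ v, fderiv ℝ (fun x => P (F x)) x v = P (fderiv ℝ F x v) := by
    intro x hx v
    have h1 := P.hasFDerivAt.comp x ((hF x hx).differentiableAt (by simp)).hasFDerivAt
    have h2 : fderiv ℝ (fun x => P (F x)) x = P.comp (fderiv ℝ F x) := h1.fderiv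
    rw [h2]; rfl
  have hPq : ∀ v, P (fderiv ℝ F q v) = ⟨fderiv ℝ F q v, v, rfl⟩ := fun v =>
    hP ⟨fderiv ℝ F q v, v, rfl⟩
  have hs : Function.Surjective (fderiv ℝ (fun x => P (F x)) q) := by
    rintro ⟨-, v, rfl⟩
    exact ⟨v, (hd q hq v).trans (hPq v)⟩
  have hG : ∀ᶠ x in 𝓝 q, ContDiffAt ℝ ∞ (fun x => P (F x)) x := by
    filter_upwards [hWq] with x hx
    exact P.contDiff.contDiffAt.comp x (hF x hx)
  have hk := eventually_fderiv_eq_zero (X := X) (g := g) hG.self_of_nhds hs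
    (fun i => (hX i).continuousAt)
    (by filter_upwards [hWq] with x hx i; rw [hd x hx, hFX x hx, map_zero])
    (by filter_upwards [hWq] with x hx i using hgX x hx i)
    (fun v hv => hker q hq v (by
      rw [hd q hq, hPq] at hv
      exact congrArg Subtype.val hv))
  obtain ⟨Φ, hΦ, hgΦ⟩ := exists_eventually_factor hG hs
    (by filter_upwards [hWq] with x hx using hg x hx) hk
  exact ⟨_, P, Φ, hs, hΦ, hgΦ⟩

theorem exists_eventually_eq_comp (hW : IsOpen W) (hF : ∀ x ∈ W, ContDiffAt ℝ ∞ F x)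
    (hX : ∀ i, Continuous (X i)) (hFX : ∀ x ∈ W, ∀ i, fderiv ℝ F x (X i x) = 0)
    (hker : ∀ x ∈ W, ∀ v, fderiv ℝ F x v = 0 → ∃ i, X i x = v)
    (hg : ∀ x ∈ W, ContDiffAt ℝ ∞ g x) (hgX : ∀ x ∈ W, ∀ i, fderiv ℝ g x (X i x) = 0)
    {q : E} (hq : q ∈ W) :
    ∃ Φ : A → ℝ, ContDiff ℝ ∞ Φ ∧ ∀ᶠ x in 𝓝 q, g x = Φ (F x) := by
  obtain ⟨R, P, Φ, -, hΦ, h⟩ := exists_submersion_factor hW hF hX hFX hker hg hgX hq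
  exact ⟨fun y => Φ (P y), hΦ.comp P.contDiff, h⟩

variable [FiniteDimensional ℝ A]

/-- A first integral vanishing near a point `x` of the level of `F` through `q` vanishes
near `q`, provided that `x` is close to `q`. -/
theorem eventually_eq_zero_of_level (hW : IsOpen W) (hF : ∀ x ∈ W, ContDiffAt ℝ ∞ F x)
    (hX : ∀ i, Continuous (X i)) (hFX : ∀ x ∈ W, ∀ i, fderiv ℝ F x (X i x) = 0)
    (hker : ∀ x ∈ W, ∀ v, fderiv ℝ F x v = 0 → ∃ i, X i x = v)
    (hg : ∀ x ∈ W, ContDiffAt ℝ ∞ g x) (hgX : ∀ x ∈ W, ∀ i, fderiv ℝ g x (X i x) = 0)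
    {q : E} (hq : q ∈ W) :
    ∀ᶠ x in 𝓝 q, F x = F q → (∀ᶠ y in 𝓝 x, g y = 0) → ∀ᶠ y in 𝓝 q, g y = 0 := by
  obtain ⟨R, P, Φ, hs, hΦ, h⟩ := exists_submersion_factor hW hF hX hFX hker hg hgX hq
  have hG : ∀ x ∈ W, ContDiffAt ℝ ∞ (fun x => P (F x)) x := fun x hx =>
    P.contDiff.contDiffAt.comp x (hF x hx)
  obtain ⟨π, -, he⟩ := eventually_exists_equiv (hG q hq) hs
  filter_upwards [hW.mem_nhds hq, he, h.eventually_nhds] with x hx ⟨e, hex⟩ hgx hFx h0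
  have hsx : Function.Surjective (fderiv ℝ (fun x => P (F x)) x) := by
    intro r
    refine ⟨e.symm (r, 0), ?_⟩
    have h1 : e (e.symm (r, 0)) = _ :=
      congrArg (fun L : E →L[ℝ] _ => L (e.symm (r, 0))) hex
    rw [e.apply_symm_apply] at h1
    exact (congrArg Prod.fst h1).symm
  -- A submersion is open, so vanishing of g near `x` makes Φ vanish near P (F x); this point equals
  -- P (F q), which carries the vanishing over to `q`.
  have hm : map (fun x => P (F x)) (𝓝 x) = 𝓝 (P (F x)) :=
    ((hG x hx).hasStrictFDerivAt (by simp)).map_nhds_eq_of_surj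
      (LinearMap.range_eq_top.2 hsx)
  have hz : ∀ᶠ z in 𝓝 (P (F x)), Φ z = 0 := by
    rw [← hm, eventually_map]
    filter_upwards [hgx, h0] with y hy1 hy2
    rw [← hy1, hy2]
  rw [hFx] at hz
  filter_upwards [(hG q hq).continuousAt.eventually hz, h] with y hy1 hy2
  rw [hy2, hy1]

/-- F is constant along the curve, so all its points lie on one level of F and vanishing can be
passed between nearby points by `eventually_eq_zero_of_level`. -/
theorem eventually_eq_zero_of_curve (hW : IsOpen W) (hF : ∀ x ∈ W, ContDiffAt ℝ ∞ F x)
    (hX : ∀ i, Continuous (X i)) (hFX : ∀ x ∈ W, ∀ i, fderiv ℝ F x (X i x) = 0)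
    (hker : ∀ x ∈ W, ∀ v, fderiv ℝ F x v = 0 → ∃ i, X i x = v)
    (hg : ∀ x ∈ W, ContDiffAt ℝ ∞ g x) (hgX : ∀ x ∈ W, ∀ i, fderiv ℝ g x (X i x) = 0)
    {γ : ℝ → E} {i : ι}
    (hγ : ∀ t ∈ Set.Icc (0 : ℝ) 1, γ t ∈ W ∧ HasDerivAt γ (X i (γ t)) t)
    (h0 : ∀ᶠ y in 𝓝 (γ 0), g y = 0) : ∀ᶠ y in 𝓝 (γ 1), g y = 0 := by
  have hd : ∀ t ∈ Set.Icc (0 : ℝ) 1, HasDerivAt (fun t => F (γ t)) 0 t := by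
    intro t ht
    have h1 := ((hF _ (hγ t ht).1).differentiableAt (by simp)).hasFDerivAt.comp_hasDerivAt t
      (hγ t ht).2
    rwa [hFX _ (hγ t ht).1] at h1
  have hc : ∀ t ∈ Set.Icc (0 : ℝ) 1, F (γ t) = F (γ 0) :=
    constant_of_has_deriv_right_zero (fun t ht => (hd t ht).continuousAt.continuousWithinAt)
      fun t ht => (hd t (Set.Ico_subset_Icc_self ht)).hasDerivWithinAt
  let δ : Set.Icc (0 : ℝ) 1 → E := fun t => γ t
  have hδ : Continuous δ := continuous_iff_continuousAt.2 fun t =>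
    ContinuousAt.comp (hγ t t.2).2.continuousAt continuous_subtype_val.continuousAt
  have hopen : IsOpen {x | ∀ᶠ y in 𝓝 x, g y = 0} := isOpen_setOfPred_eventually_nhds
  -- Openness is immediate. At a limit time t, some time s of the set is so close that the level
  -- argument applies from γ s to γ t.
  have hclopen : IsClopen {t | ∀ᶠ y in 𝓝 (δ t), g y = 0} := by
    refine ⟨isClosed_of_closure_subset fun t ht => ?_, hopen.preimage hδ⟩
    have h1 := hδ.continuousAt.eventually
      (eventually_eq_zero_of_level hW hF hX hFX hker hg hgX (hγ t t.2).1)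
    obtain ⟨s, hs1, hs2⟩ := ((mem_closure_iff_frequently.1 ht).and_eventually h1).exists
    exact hs2 ((hc s s.2).trans (hc t t.2).symm) hs1
  have huniv := hclopen.eq_univ ⟨⟨0, by simp⟩, h0⟩
  exact huniv.ge (Set.mem_univ (⟨1, by simp⟩ : Set.Icc (0 : ℝ) 1))

end FirstIntegral

/-! ### Differential invariants on jets of a fixed order -/

theorem Smooth.continuous {F : JetInf → ℝ} (hF : Smooth F) : Continuous F := by
  obtain ⟨k, g, hg⟩ := hF
  have h : F = g ∘ proj k := funext fun θ => (hg θ trivial).2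
  rw [h]
  exact continuous_iff_continuousAt.2 fun θ =>
    ContinuousAt.comp (hg θ trivial).1.continuousAt (continuous_proj k).continuousAt

theorem continuous_ext (k : ℕ) : Continuous (ext k) := by
  refine Continuous.prodMk continuous_fst (continuous_pi fun σ => ?_)
  by_cases h : σ ∈ multiIdx k
  · simp only [h, dif_pos]; fun_prop
  · simp only [h, dif_neg, not_false_iff]; fun_prop

theorem continuous_prolK (k : ℕ) {a : ℝ → ℝ} {b : ℝ × ℝ → ℝ} (ha : ContDiff ℝ ∞ a)
    (hb : ContDiff ℝ ∞ b) : Continuous (prolK k a b) := by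
  refine (continuous_proj k).comp ((Continuous.prodMk ?_ ?_ : Continuous (prol a b)).comp
    (continuous_ext k))
  · refine continuous_pi fun j => ?_
    change Continuous fun θ => (prol a b θ).1 j
    simp only [prol_fst]
    cases j using Fin.cases <;> exact Smooth.continuous ⟨_, smoothOn_xi (k := 0) ha hb _⟩
  · exact continuous_pi fun σ => (smooth_prol_snd ha hb σ).continuous

/-- Representatives on `k`-jets of the derivatives of `F` along words of bounded length. -/
theorem exists_nablaWord_reps {k l : ℕ} {F : JetInf → ℝ} (hF : SmoothOn l regJet F) (hl : 1 ≤ l)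
    (h : ∀ (a : ℝ → ℝ) (b : ℝ × ℝ → ℝ), ContDiff ℝ ∞ a → ContDiff ℝ ∞ b → ∀ θ ∈ regJet,
      prolD a b F θ = 0) :
    ∃ (m : ℕ) (v : Fin m → List (Fin 3)) (g : JetK k → Fin m → ℝ),
      (∀ w, w.length + l ≤ k → ∃ i, v i = w) ∧
      ∀ θ ∈ regJet, ContDiffAt ℝ ∞ g (proj k θ) ∧ (∀ i, nablaWord (v i) F θ = g (proj k θ) i) ∧
        (∀ (a : ℝ → ℝ) (b : ℝ × ℝ → ℝ), ContDiff ℝ ∞ a → ContDiff ℝ ∞ b →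
          fderiv ℝ g (proj k θ) (proj k (prol a b θ)) = 0) ∧
        ∀ v', fderiv ℝ g (proj k θ) (proj k v') = 0 →
          ∀ i, lineDeriv ℝ (nablaWord (v i) F) θ v' = 0 := by
  have hfin : {w : List (Fin 3) | w.length + l ≤ k}.Finite :=
    (List.finite_length_le (Fin 3) k).subset fun w hw => by
      have : w.length + l ≤ k := hw
      change w.length ≤ k
      omega
  let S := hfin.toFinset
  let v : Fin S.card → List (Fin 3) := fun i => (S.equivFin.symm i : List (Fin 3))
  have hv : ∀ i, (v i).length + l ≤ k := fun i => hfin.mem_toFinset.1 (S.equivFin.symm i).2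
  choose g hg using fun i =>
    (smoothOn_nablaWord hF hl (v i)).mono (l := k) (by have := hv i; omega)
  refine ⟨S.card, v, fun p i => g i p, fun w hw => ?_, fun θ hθ => ?_⟩
  · exact ⟨S.equivFin ⟨w, hfin.mem_toFinset.2 hw⟩, by simp [v]⟩
  have hd : ∀ i v', fderiv ℝ (fun p i => g i p) (proj k θ) (proj k v') i
      = lineDeriv ℝ (nablaWord (v i) F) θ v' := by
    intro i v'
    rw [(hasLineDerivAt_of_eq isOpen_regJet hθ (fun θ hθ => (hg i θ hθ).2) (hg i θ hθ).1
      v').lineDeriv, fderiv_pi fun i => (hg i θ hθ).1.differentiableAt (by simp)]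
    rfl
  refine ⟨contDiffAt_pi.2 fun i => (hg i θ hθ).1, fun i => (hg i θ hθ).2,
    fun a b ha hb => funext fun i => ?_, fun v' hv' i => ?_⟩
  · rw [hd]
    exact prolD_nablaWord hF hl h (v i) ha hb hθ
  · rw [← hd, hv']
    rfl

/-- All iterated derivatives of J and K of nominal order ≤ k form one map whose differential has as
kernel exactly the values of the prolonged fields. For k < 2 there are no regular jets, and this is
vacuous. -/
theorem exists_invariants (k : ℕ) :
    ∃ (m n : ℕ) (v : Fin m → List (Fin 3)) (w : Fin n → List (Fin 3))
      (F : JetK k → (Fin m → ℝ) × (Fin n → ℝ)),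
      (∀ θ, Regular θ → F (proj k θ) =
        (fun i => nablaWord (v i) J θ, fun i => nablaWord (w i) K θ)) ∧
      ∀ x ∈ regularSet k, ContDiffAt ℝ ∞ F x ∧
        (∀ (a : ℝ → ℝ) (b : ℝ × ℝ → ℝ), ContDiff ℝ ∞ a → ContDiff ℝ ∞ b →
          fderiv ℝ F x (prolK k a b x) = 0) ∧
        ∀ u, fderiv ℝ F x u = 0 →
          ∃ a b, ContDiff ℝ ∞ a ∧ ContDiff ℝ ∞ b ∧ prolK k a b x = u := by
  obtain ⟨m, v, f, hv, hf⟩ := exists_nablaWord_reps (k := k) smoothOn_J (by simp)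
    fun _ _ ha hb _ hθ => prolD_J ha hb hθ
  obtain ⟨n, w, g, hw, hg⟩ := exists_nablaWord_reps (k := k) smoothOn_K (by simp)
    fun _ _ ha hb _ hθ => prolD_K ha hb hθ
  refine ⟨m, n, v, w, fun x => (f x, g x), fun θ hθ => Prod.ext ?_ ?_, fun x hx => ?_⟩
  · exact funext fun i => ((hf θ hθ).2.1 i).symm
  · exact funext fun i => ((hg θ hθ).2.1 i).symm
  obtain ⟨f1, -, f3, f4⟩ := hf (ext k x) hx
  obtain ⟨g1, -, g3, g4⟩ := hg (ext k x) hx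
  rw [proj_ext] at f1 f3 f4 g1 g3 g4
  have hd : ∀ u, fderiv ℝ (fun x => (f x, g x)) x u = (fderiv ℝ f x u, fderiv ℝ g x u) := by
    intro u
    rw [(f1.differentiableAt (by simp)).fderiv_prodMk (g1.differentiableAt (by simp))]
    rfl
  refine ⟨f1.prodMk g1, fun a b ha hb => ?_, fun u hu => ?_⟩
  · rw [hd]
    exact Prod.ext (f3 a b ha hb) (g3 a b ha hb)
  · rw [hd] at hu
    obtain ⟨a, b, ha, hb, hab⟩ := exists_prol_of_annihilates (θ := ext k x) hx k (ext k u)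
      (fun c hc => by
        obtain ⟨i, rfl⟩ := hv c hc
        exact f4 _ (by rw [proj_ext]; exact congrArg Prod.fst hu) i)
      (fun c hc => by
        obtain ⟨i, rfl⟩ := hw c hc
        exact g4 _ (by rw [proj_ext]; exact congrArg Prod.snd hu) i)
    exact ⟨a, b, ha, hb, hab.trans (proj_ext k u)⟩

theorem IsInvariantOn.fderiv_prolK {k : ℕ} {W : Set (JetK k)} {I : JetK k → ℝ} (hW : IsOpen W)
    (hI : IsInvariantOn k W I) {a : ℝ → ℝ} {b : ℝ × ℝ → ℝ} (ha : ContDiff ℝ ∞ a)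
    (hb : ContDiff ℝ ∞ b) {x : JetK k} (hx : x ∈ W) : fderiv ℝ I x (prolK k a b x) = 0 := by
  have hx' : proj k (ext k x) ∈ W := by rwa [proj_ext]
  have h1 := hI.2 a b ha hb (ext k x) hx'
  have h2 := hasLineDerivAt_of_eq (F := fun θ => I (proj k θ)) isOpen_univ (θ := ext k x) trivial
    (fun _ _ => rfl) (hI.1.contDiffAt (hW.mem_nhds hx')) (prol a b (ext k x))
  rw [prolD, h2.lineDeriv, proj_ext] at h1
  exact h1

/-- Near an orbit every differential invariant is a smooth function of finitely many iterated
derivatives of `J` and `K`. -/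
theorem IsInvariantOn.exists_eq_comp {k : ℕ} (hk : 2 ≤ k) {W : Set (JetK k)} (hW : IsOpen W)
    (hWr : W ⊆ regularSet k) {I : JetK k → ℝ} (hI : IsInvariantOn k W I) {p : JetK k}
    (hp : p ∈ W) :
    ∃ V : Set (JetK k), IsOpen V ∧ orbitIn k W p ⊆ V ∧ V ⊆ W ∧
      ∃ (m n : ℕ) (v : Fin m → List (Fin 3)) (w : Fin n → List (Fin 3))
        (Φ : (Fin m → ℝ) × (Fin n → ℝ) → ℝ), ContDiff ℝ ∞ Φ ∧
        ∀ θ : JetInf, proj k θ ∈ V → I (proj k θ) =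
          Φ (fun i => nablaWord (v i) J θ, fun i => nablaWord (w i) K θ) := by
  obtain ⟨m, n, v, w, F, hFval, hF⟩ := exists_invariants k
  let ι := {c : (ℝ → ℝ) × (ℝ × ℝ → ℝ) // ContDiff ℝ ∞ c.1 ∧ ContDiff ℝ ∞ c.2}
  let X : ι → JetK k → JetK k := fun c => prolK k c.1.1 c.1.2
  have hX : ∀ c, Continuous (X c) := fun c => continuous_prolK k c.2.1 c.2.2
  have hFs : ∀ x ∈ W, ContDiffAt ℝ ∞ F x := fun x hx => (hF x (hWr hx)).1
  have hFX : ∀ x ∈ W, ∀ c, fderiv ℝ F x (X c x) = 0 := fun x hx c =>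
    (hF x (hWr hx)).2.1 _ _ c.2.1 c.2.2
  have hker : ∀ x ∈ W, ∀ u, fderiv ℝ F x u = 0 → ∃ c, X c x = u := fun x hx u hu => by
    obtain ⟨a, b, ha, hb, h⟩ := (hF x (hWr hx)).2.2 u hu
    exact ⟨⟨(a, b), ha, hb⟩, h⟩
  have hIs : ∀ x ∈ W, ContDiffAt ℝ ∞ I x := fun x hx => hI.1.contDiffAt (hW.mem_nhds hx)
  have hIX : ∀ x ∈ W, ∀ c, fderiv ℝ I x (X c x) = 0 := fun x hx c =>
    hI.fderiv_prolK hW c.2.1 c.2.2 hx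
  obtain ⟨Φ, hΦ, hΦp⟩ := exists_eventually_eq_comp hW hFs hX hFX hker hIs hIX hp
  -- Φ is chosen once, at `p`. The difference I - Φ ∘ F is again a first integral, so its vanishing
  -- near `p` propagates.
  have hgs : ∀ x ∈ W, ContDiffAt ℝ ∞ (fun x => I x - Φ (F x)) x := fun x hx =>
    (hIs x hx).sub (hΦ.contDiffAt.comp x (hFs x hx))
  have hgX : ∀ x ∈ W, ∀ c, fderiv ℝ (fun x => I x - Φ (F x)) x (X c x) = 0 := by
    intro x hx c
    have h1 := ((hΦ.differentiable (by simp)) (F x)).hasFDerivAt.comp x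
      ((hFs x hx).differentiableAt (by simp)).hasFDerivAt
    have h2 := ((hIs x hx).differentiableAt (by simp)).hasFDerivAt.sub h1
    have h3 : fderiv ℝ (fun x => I x - Φ (F x)) x = _ := h2.fderiv
    rw [h3, sub_apply, ContinuousLinearMap.comp_apply, hFX x hx, hIX x hx,
      map_zero, sub_zero]
  -- V is the set of points of W near which I = Φ ∘ F. It is open by construction and contains the
  -- orbit by induction on the number of steps.
  refine ⟨{x | ∀ᶠ y in 𝓝 x, I y - Φ (F y) = 0} ∩ W,
    isOpen_setOfPred_eventually_nhds.inter hW, fun q hq => ?_, Set.inter_subset_right,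
    m, n, v, w, Φ, hΦ, fun θ hθ => ?_⟩
  · induction hq with
    | refl => exact ⟨hΦp.mono fun y hy => sub_eq_zero.2 hy, hp⟩
    | tail _ hs ih =>
      obtain ⟨a, b, γ, ha, hb, rfl, rfl, hγ⟩ := hs
      exact ⟨eventually_eq_zero_of_curve (i := (⟨(a, b), ha, hb⟩ : ι)) hW hFs hX hFX hker hgs hgX
        hγ ih.1, (hγ 1 (by simp)).1⟩
  · rw [← hFval θ ((regular_ext_proj hk θ).1 (hWr hθ.2))]
    exact sub_eq_zero.1 hθ.1.self_of_nhds

end Feedback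

end

theorem theorem2 :
    -- `J`, `K` and all their iterated derivatives are feedback differential invariants
    (∀ w : List (Fin 3),
      Feedback.IsInvariant (2 + w.length) (Feedback.nablaWord w Feedback.J) ∧
      Feedback.IsInvariant (3 + w.length) (Feedback.nablaWord w Feedback.K)) ∧
    -- `∇₁, ∇₂, ∇₃` are feedback invariant derivations
    (∀ i : Fin 3, Feedback.IsInvariantDerivation (Feedback.nablaCoeff i)) ∧
    -- every feedback differential invariant is, in a neighbourhood of each orbit, a smooth
    -- function of finitely many of these
    (∀ (k : ℕ), 2 ≤ k → ∀ (W : Set (Feedback.JetK k)), IsOpen W → W ⊆ Feedback.regularSet k →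
      ∀ I : Feedback.JetK k → ℝ, Feedback.IsInvariantOn k W I →
      ∀ p ∈ W, ∃ V : Set (Feedback.JetK k),
        IsOpen V ∧ Feedback.orbitIn k W p ⊆ V ∧ V ⊆ W ∧
        ∃ (m n : ℕ) (v : Fin m → List (Fin 3)) (w : Fin n → List (Fin 3))
          (Φ : (Fin m → ℝ) × (Fin n → ℝ) → ℝ), ContDiff ℝ ∞ Φ ∧
          ∀ θ : Feedback.JetInf, Feedback.proj k θ ∈ V →
            I (Feedback.proj k θ) =
              Φ (fun i => Feedback.nablaWord (v i) Feedback.J θ,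
                 fun i => Feedback.nablaWord (w i) Feedback.K θ)) :=
  ⟨fun w => ⟨Feedback.isInvariant_nablaWord_J w, Feedback.isInvariant_nablaWord_K w⟩,
    Feedback.isInvariantDerivation_nablaCoeff,
    fun _ hk _ hW hWr _ hI _ hp => hI.exists_eq_comp hk hW hWr hp⟩
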